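/- For $\tau\in\mathbb H=\{\operatorname{Im}\tau>0\}$ let $\Lambda_\tau=\mathbb Z+\mathbb Z\tau$, let $g_2(\tau)=60\sum_{\omega\in\Lambda_\tau\setminus\{0\}}\omega^{-4}$ and $g_3(\tau)=140\sum_{\omega\in\Lambda_\tau\setminus\{0\}}\omega^{-6}$, and let $\eta_1(\tau)=2\zeta(\tfrac12;\tau)$, where $\zeta(z;\tau)=\frac1z+\sum_{\omega\in\Lambda_\tau\setminus\{0\}}\big(\frac1{z-\omega}+\frac1\omega+\frac z{\omega^2}\big)$ is the Weierstrass zeta function. Put $$\phi(\tau)=\tau+\frac{36\pi i\,g_3(\tau)}{g_2(\tau)^2-18\,\eta_1(\tau)\,g_3(\tau)}\in\mathbb C\cup\{\infty\},$$ with $\phi(\tau)=\infty$ exactly where the denominator vanishes. Let $\Gamma_0(2)$ be the group of matrices $\bigl(\begin{smallmatrix}a&b\\c&d\end{smallmatrix}\bigr)\in SL(2,\mathbb Z)$ with $c$ even, acting on $\mathbb H$ by Möbius transformations, and let $$F_0=\{\tau\in\mathbb H:\ 0\le\operatorname{Re}\tau\le1,\ |\tau-\tfrac12|\ge\tfrac12\}.$$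 Let $\mathcal D_0$ be the set of all $\tau\in F_0$ of the form $\tau=\gamma\cdot z$ with $\gamma\in\Gamma_0(2)$ and $z\in\mathbb H$ a critical point of the normalized Eisenstein series $E_6$ of weight $6$ (that is, $E_6'(z)=0$). **Theorem 1.2 (Location).** There are three pairwise disjoint smooth ($C^\infty$, regular, embedded) curves $\mathcal C_1,\mathcal C_2,\mathcal C_3$ in $F_0$, with endpoints $$\partial\mathcal C_1=\{0,1\},\qquad \partial\mathcal C_2=\{0,\tfrac14+i\infty\},\qquad \partial\mathcal C_3=\{1,\tfrac34+i\infty\},$$ such that $$\mathcal D_0\subset\mathcal C_1\cup\mathcal C_2\cup\mathcal C_3=\overline{\mathcal D_0}\cap F_0=\overline{\mathcal D_0}\setminus\{0,1,\infty\}.$$ The last closure is taken in the Riemann sphere $\mathbb C\cup\{\infty\}$. In particular $\mathcal D_0$ is dense in the union of the three curves. Moreover the curves are smoothly and regularly parametrized by $C=\phi(\tau)$: $\mathcal C_1$ by $C\in(1,+\infty)\cup\{\infty\}\cup(-\infty,0)$ (with $1/C\in(-\infty,1)$ as smooth coordinate on this arc), $\mathcal C_2$ by $C\in(0,+\infty)$,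 and $\mathcal C_3$ by $C\in(-\infty,1)$. The curve $\mathcal C_1$ tends to $0$ as $C\to0^-$ and to $1$ as $C\to1^+$; $\mathcal C_2$ tends to $0$ as $C\to0^+$ and to $\tfrac14+i\infty$ as $C\to+\infty$; $\mathcal C_3$ tends to $1$ as $C\to1^-$ and to $\tfrac34+i\infty$ as $C\to-\infty$. Here $\tau\to a+i\infty$ means $\operatorname{Re}\tau\to a$ and $\operatorname{Im}\tau\to+\infty$. -/

import Mathlib

open Set Filter Topology UpperHalfPlane

noncomputable section

/-- The pair of periods `(1, τ)` with `τ ∈ ℍ`; its lattice is `Λ_τ = ℤ + ℤ τ`. -/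
def periodPair (τ : ℍ) : PeriodPair where
  ω₁ := 1
  ω₂ := (τ : ℂ)
  indep := by
    rw [LinearIndependent.pair_iff]
    intro s t h
    have him := congrArg Complex.im h
    have hre := congrArg Complex.re h
    simp at him hre
    have ht : t = 0 := by
      rcases him with h | h
      · exact h
      · exact absurd h τ.im_ne_zero
    subst ht
    simpa using hre

/-- The invariant `g₂(τ) = 60 ∑' (m τ + n)⁻⁴`, through Mathlib's `PeriodPair.g₂`. -/
def g2 (τ : ℍ) : ℂ := (periodPair τ).g₂

/-- The invariant `g₃(τ) = 140 ∑' (m τ + n)⁻⁶`, through Mathlib's `PeriodPair.g₃`. -/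
def g3 (τ : ℍ) : ℂ := (periodPair τ).g₃

/-- The Weierstrass zeta function
`ζ(z; τ) = 1 / z + ∑_{ω ∈ Λ_τ \ {0}} (1 / (z - ω) + 1 / ω + z / ω ^ 2)`,
the odd primitive of `-℘(z; τ)`. As in Mathlib's definition of `℘`, the sum is over the whole
lattice: by `1 / 0 = 0` the term with `ω = 0` is the leading term `1 / z`. -/
def weierstrassZeta (z : ℂ) (τ : ℍ) : ℂ :=
  ∑' ω : (periodPair τ).lattice, (1 / (z - ω) + 1 / (ω : ℂ) + z / (ω : ℂ) ^ 2)

/-- The quasi-period `η₁(τ) = 2 ζ(1 / 2; τ)`. -/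
def eta1 (τ : ℍ) : ℂ := 2 * weierstrassZeta (1 / 2) τ

/-- The denominator `g₂² - 18 η₁ g₃`. -/
def phiDenom (τ : ℍ) : ℂ := g2 τ ^ 2 - 18 * eta1 τ * g3 τ

/-- The meromorphic function `φ = τ + 36 π i g₃ / (g₂² - 18 η₁ g₃)`, as a map to the Riemann
sphere; its numerator `36 π i g₃` has no zero in common with the denominator, because
`g₂³ - 27 g₃²` does not vanish. -/
def phi (τ : ℍ) : OnePoint ℂ :=
  open Classical in
  if phiDenom τ = 0 then OnePoint.infty
  else (((τ : ℂ) + 36 * Real.pi * Complex.I * g3 τ / phiDenom τ : ℂ) : OnePoint ℂ)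

/-- `τ` is a critical point of the Eisenstein series `E₆`, i.e. `E₆'(τ) = 0`. -/
def IsCriticalPointE6 (τ : ℍ) : Prop :=
  deriv ((ModularForm.E₆ : ℍ → ℂ) ∘ UpperHalfPlane.ofComplex) (τ : ℂ) = 0

/-- The basic fundamental domain of `Γ₀(2)`. -/
def F0 : Set ℍ := {τ | 0 ≤ τ.re ∧ τ.re ≤ 1 ∧ 1 / 2 ≤ ‖(τ : ℂ) - 1 / 2‖}

/-- The points of `F0` obtained from the critical points of `E₆` by the action of `Γ₀(2)`. -/
def D0 : Set ℍ :=
  {τ | τ ∈ F0 ∧ ∃ γ ∈ CongruenceSubgroup.Gamma0 2, ∃ z : ℍ, IsCriticalPointE6 z ∧ τ = γ • z}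

/-- The image in `ℂ` of a subset of the upper half plane. -/
def toPlane (S : Set ℍ) : Set ℂ := (fun τ : ℍ => (τ : ℂ)) '' S

/-- The image in the Riemann sphere `ℂ ∪ {∞}` of a subset of the upper half plane. -/
def toSphere (S : Set ℍ) : Set (OnePoint ℂ) := (fun τ : ℍ => ((τ : ℂ) : OnePoint ℂ)) '' S

/-- `S` is a smooth curve in `ℍ`, parametrized by `c` on the open interval `J`: the map `c` is
`C^∞` on `J` with nowhere vanishing derivative, is a homeomorphism of `J` onto its image (so there
are no self-intersections), and its image is `S`. -/
structure IsSmoothCurve (J : Set ℝ) (c : ℝ → ℍ) (S : Set ℍ) : Prop where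
  contDiffOn : ContDiffOn ℝ (⊤ : ℕ∞) (fun t => (c t : ℂ)) J
  deriv_ne_zero : ∀ t ∈ J, deriv (fun t => (c t : ℂ)) t ≠ 0
  isEmbedding : IsEmbedding (J.domRestrict c)
  image_eq : c '' J = S

end

/-!
The idea is to read `D0` off the values of `φ`. Put `N = z E₆' + 6 E₆`. Ramanujan's identity
`E₆' = π i (E₂ E₆ - E₄²)` and the classical expressions of `g₂`, `g₃` and `η₁` through `E₄`, `E₆`
and `E₂` give `φ = N / E₆'` (`phi_eq_coe`, `phi_eq_infty`). Differentiating the modularity relation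
of `E₆` shows that under `γ ∈ SL(2, ℤ)` the pair `(N, E₆')` is multiplied by the matrix `γ` and by a
scalar factor (`phiNum_smul`, `deriv_e6_smul`), so `φ` is equivariant. Hence the critical points of
`E₆` are the points with `φ = ∞`, and a point `τ` of `F0` lies in `D0` exactly when
`φ(τ) = a / c` with `a` odd and `c` even. Such quotients are dense in the real projective line, so
everything reduces to the description of the set of points of `F0` at which `φ` is real or
infinite (`realLocus`), a closed set containing `D0`.

The domain `F0` is the union of the kite `0 ≤ Re z ≤ 1 / 2`, `1 ≤ |z - 1|` and its images under the
reflection `τ ↦ 1 - conj τ` and the rotation `τ ↦ 1 / (1 - τ)`, which act on the values of `φ` by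
the same formulas. The kite is in turn the union of the half triangle `0 ≤ Re z ≤ 1 / 2`, `1 ≤ |z|`
and its mirror image in the unit circle. On the half triangle the nome `q` is so small that power
series estimates show: `φ` is finite and nonzero, it is positive imaginary on the left side, it
lies in the lower half plane on the right side, and its real part is positive away from the left
side (`phiFin_of_re_eq_zero`, `phiFin_im_neg`, `phiFin_re_pos`). So in the kite the real values of
`φ` are positive and are taken in the interior. There `φ` is a local diffeomorphism, because `φ'` is
`7 E₄ (E₄³ - E₆²) / (E₂ E₆ - E₄²)²` and `E₄` vanishes only at the corner
(`exists_hasStrictDerivAt_phiFin`).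

Since `φ` is moreover proper on the kite as a map to the punctured plane (`exists_isCompact_kite`),
the number of points of the kite with `φ = C` is constant for `C ∈ (0, ∞)`. For large `C` these
points are close to `i ∞`, where `φ(z) q` tends to `i / (168 π)` and `φ'(z) q` to `1 / 84`; this
forces `Re z` to be near `1 / 4` and makes `φ` injective there, so the number is one
(`exists_phiFin_eq`, `phiFin_injective`). The inverse function `curve` on `(0, ∞)` is the second
curve, smooth by the inverse function theorem; its behaviour at `0` follows from that at `∞` by the
reflection in the unit circle (`curve_inv`). The other two curves are its images under the rotation
and the reflection.
-/

noncomputable section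

/-! ### Power series in the nome -/

/-- The coefficients `a` grow at most polynomially, so that `∑ a n q ^ n` and all its derivatives
converge in the unit disc. -/
def PolyGrowth (a : ℕ → ℂ) : Prop := ∃ k : ℕ, a =O[atTop] fun n : ℕ => ((n ^ k : ℕ) : ℝ)

/-- The sum of the power series `∑ a n q ^ n`. -/
def qSeries (a : ℕ → ℂ) (q : ℂ) : ℂ := ∑' n, a n * q ^ n

/-- The nome `q = exp (2 π i z)`. -/
def nome (z : ℂ) : ℂ := Complex.exp (2 * Real.pi * Complex.I * z)

lemma PolyGrowth.natCast_mul {a : ℕ → ℂ} (ha : PolyGrowth a) :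
    PolyGrowth (fun n => (n : ℂ) * a n) := by
  obtain ⟨k, hk⟩ := ha
  refine ⟨k + 1, ?_⟩
  have h : (fun n : ℕ => (n : ℂ)) =O[atTop] fun n : ℕ => (n : ℝ) :=
    Asymptotics.IsBigO.of_bound 1 (by simp)
  refine (h.mul hk).congr_right fun n => ?_
  push_cast; ring

lemma PolyGrowth.summable_norm {a : ℕ → ℂ} (ha : PolyGrowth a) {q : ℂ} (hq : ‖q‖ < 1) :
    Summable fun n => ‖a n * q ^ n‖ := by
  obtain ⟨k, hk⟩ := ha
  refine summable_norm_mul_geometric_of_norm_lt_one' (k := k) hq ?_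
  refine hk.trans (Asymptotics.IsBigO.of_bound 1 ?_)
  simp

lemma PolyGrowth.summable {a : ℕ → ℂ} (ha : PolyGrowth a) {q : ℂ} (hq : ‖q‖ < 1) :
    Summable fun n => a n * q ^ n := (ha.summable_norm hq).of_norm

lemma PolyGrowth.sigma (j : ℕ) :
    PolyGrowth fun n => (ArithmeticFunction.sigma j n : ℂ) := by
  refine ⟨j + 1, Asymptotics.IsBigO.of_bound 1 (Eventually.of_forall fun n => ?_)⟩
  have := ArithmeticFunction.sigma_le_pow_succ j n
  simp only [Complex.norm_natCast, Real.norm_natCast, one_mul]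
  exact_mod_cast this

lemma PolyGrowth.const_mul {a : ℕ → ℂ} (ha : PolyGrowth a) (c : ℂ) :
    PolyGrowth fun n => c * a n := by
  obtain ⟨k, hk⟩ := ha
  exact ⟨k, hk.const_mul_left c⟩

lemma PolyGrowth.hasDerivAt {a : ℕ → ℂ} (ha : PolyGrowth a) {q : ℂ} (hq : ‖q‖ < 1) :
    HasDerivAt (qSeries a) (∑' n : ℕ, a n * (n * q ^ (n - 1))) q := by
  obtain ⟨ρ, hqρ, hρ⟩ := exists_between hq
  have hρ0 : 0 < ρ := (norm_nonneg q).trans_lt hqρ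
  have hs : Summable fun n : ℕ => ‖(n : ℂ) * a n‖ * ρ ^ (n - 1) := by
    have h := (ha.natCast_mul.summable_norm (q := (ρ : ℂ))
      (by simpa [abs_of_pos hρ0] using hρ)).mul_left ρ⁻¹
    refine h.congr fun n => ?_
    rcases n with _ | n
    · simp
    · simp only [norm_mul, norm_pow, Complex.norm_real, Real.norm_eq_abs, abs_of_pos hρ0,
        Nat.add_sub_cancel, pow_succ]
      field_simp
  refine hasDerivAt_tsum_of_isPreconnected (u := fun n : ℕ => ‖(n : ℂ) * a n‖ * ρ ^ (n - 1))
    (g := fun n z => a n * z ^ n) (g' := fun n z => a n * (n * z ^ (n - 1)))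
    (t := Metric.ball (0 : ℂ) ρ) (y₀ := 0) hs
    Metric.isOpen_ball (convex_ball 0 ρ).isPreconnected ?_ ?_ (Metric.mem_ball_self hρ0) ?_
    (by simpa using hqρ)
  · intro n y _
    exact (hasDerivAt_pow n y).const_mul (a n)
  · intro n y hy
    have hy' : ‖y‖ ≤ ρ := by simpa using (mem_ball_zero_iff.mp hy).le
    rw [show a n * ((n : ℂ) * y ^ (n - 1)) = ((n : ℂ) * a n) * y ^ (n - 1) by ring, norm_mul,
      norm_pow]
    gcongr
  · exact ha.summable (by simp)

lemma qSeries_deriv_mul {a : ℕ → ℂ} (q : ℂ) :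
    (∑' n : ℕ, a n * (n * q ^ (n - 1))) * q = qSeries (fun n => (n : ℂ) * a n) q := by
  rw [← tsum_mul_right]
  refine tsum_congr fun n => ?_
  rcases n with _ | n
  · simp
  · simp only [Nat.add_sub_cancel, pow_succ]; ring

lemma qSeries_zero (a : ℕ → ℂ) : qSeries a 0 = a 0 := by
  rw [qSeries, tsum_eq_single 0 (fun n hn => by simp [hn])]
  simp

lemma hasDerivAt_nome (z : ℂ) : HasDerivAt nome (2 * Real.pi * Complex.I * nome z) z := by
  have h := ((hasDerivAt_id z).const_mul (2 * Real.pi * Complex.I : ℂ)).cexp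
  refine h.congr_deriv ?_
  simp [nome, mul_comm]

lemma norm_nome (z : ℂ) : ‖nome z‖ = Real.exp (-(2 * Real.pi * z.im)) := by
  rw [nome, Complex.norm_exp]
  congr 1
  simp

lemma norm_nome_lt_one {z : ℂ} (hz : 0 < z.im) : ‖nome z‖ < 1 := by
  rw [norm_nome]
  exact Real.exp_lt_one_iff.mpr (by have := mul_pos Real.pi_pos hz; linarith)

lemma nome_ne_zero (z : ℂ) : nome z ≠ 0 := Complex.exp_ne_zero _

lemma PolyGrowth.hasDerivAt_nome {a : ℕ → ℂ} (ha : PolyGrowth a) {z : ℂ} (hz : 0 < z.im) :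
    HasDerivAt (fun w => qSeries a (nome w))
      (2 * Real.pi * Complex.I * qSeries (fun n => (n : ℂ) * a n) (nome z)) z := by
  have h := (ha.hasDerivAt (norm_nome_lt_one hz)).comp z (_root_.hasDerivAt_nome z)
  refine h.congr_deriv ?_
  rw [← qSeries_deriv_mul]; ring

lemma tendsto_nome_atImInfty : Tendsto (fun τ : ℍ => nome τ) atImInfty (𝓝 0) := by
  have := UpperHalfPlane.qParam_tendsto_atImInfty (h := 1) one_pos
  simpa [Function.Periodic.qParam, nome] using this

lemma PolyGrowth.tendsto_atImInfty {a : ℕ → ℂ} (ha : PolyGrowth a) :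
    Tendsto (fun τ : ℍ => qSeries a (nome τ)) atImInfty (𝓝 (a 0)) := by
  have h : ContinuousAt (qSeries a) 0 := (ha.hasDerivAt (q := 0) (by simp)).continuousAt
  have h2 := h.tendsto.comp tendsto_nome_atImInfty
  rwa [qSeries_zero] at h2

/-! ### The Eisenstein series as power series in the nome -/

/-- The coefficients `1, c σⱼ(1), c σⱼ(2), …` of a normalized Eisenstein series. -/
def eisCoeff (j : ℕ) (c : ℂ) (n : ℕ) : ℂ :=
  if n = 0 then 1 else c * ArithmeticFunction.sigma j n

lemma PolyGrowth.eisCoeff (j : ℕ) (c : ℂ) : PolyGrowth (eisCoeff j c) := by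
  obtain ⟨k, hk⟩ := (PolyGrowth.sigma j).const_mul c
  refine ⟨k, hk.congr' ?_ EventuallyEq.rfl⟩
  filter_upwards [eventually_gt_atTop 0] with n hn
  simp [_root_.eisCoeff, hn.ne']

lemma qSeries_eisCoeff (j : ℕ) (c : ℂ) {q : ℂ} (hq : ‖q‖ < 1) :
    qSeries (eisCoeff j c) q
      = 1 + c * qSeries (fun n => (ArithmeticFunction.sigma j n : ℂ)) q := by
  have h1 := (PolyGrowth.eisCoeff j c).summable hq
  have h2 := (PolyGrowth.sigma j).summable hq
  rw [qSeries, qSeries, h1.tsum_eq_zero_add, h2.tsum_eq_zero_add]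
  simp [eisCoeff, ← tsum_mul_left, mul_assoc]

lemma natCast_mul_eisCoeff (j : ℕ) (c : ℂ) :
    (fun n : ℕ => (n : ℂ) * eisCoeff j c n)
      = fun n : ℕ => c * ((n : ℂ) * (ArithmeticFunction.sigma j n : ℂ)) := by
  funext n
  rcases n with _ | n
  · simp
  · simp [eisCoeff]; ring

lemma qSeries_const_mul (a : ℕ → ℂ) (c q : ℂ) :
    qSeries (fun n => c * a n) q = c * qSeries a q := by
  simp [qSeries, ← tsum_mul_left, mul_assoc]

lemma E_eq_qSeries {k : ℕ} (hk : 3 ≤ k) (hk2 : Even k) (τ : ℍ) :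
    ModularForm.E hk τ = qSeries (eisCoeff (k - 1) (-(2 * k / bernoulli k))) (nome τ) := by
  have h := ModularForm.hasSum_qExpansion (h := 1) (ModularForm.E hk) one_pos
    (by simp) τ
  rw [← h.tsum_eq, qSeries]
  refine tsum_congr fun n => ?_
  rw [EisensteinSeries.E_qExpansion_coeff hk hk2]
  simp [eisCoeff, Function.Periodic.qParam, nome]

lemma E4_eq_qSeries (τ : ℍ) : ModularForm.E₄ τ = qSeries (eisCoeff 3 240) (nome τ) := by
  rw [E_eq_qSeries _ ⟨2, rfl⟩]
  norm_num [show bernoulli 4 = -1 / 30 by decide +kernel]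

lemma E6_eq_qSeries (τ : ℍ) : ModularForm.E₆ τ = qSeries (eisCoeff 5 (-504)) (nome τ) := by
  rw [E_eq_qSeries _ ⟨3, rfl⟩]
  norm_num [show bernoulli 6 = 1 / 42 by decide +kernel]

lemma E2_eq_qSeries (τ : ℍ) :
    EisensteinSeries.E2 τ = qSeries (eisCoeff 1 (-24)) (nome τ) := by
  have h := EisensteinSeries.hasSum_qExpansion_E2 (z := τ)
  rw [← h.tsum_eq, qSeries]
  refine tsum_congr fun n => ?_
  simp [eisCoeff, nome]

open Derivative in
/-- Termwise differentiation: `(2 π i)⁻¹ d/dz` multiplies the `n`-th coefficient by `n`. -/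
lemma normalizedDeriv_eq_qSeries {F : ℍ → ℂ} {a : ℕ → ℂ} (ha : PolyGrowth a)
    (hF : ∀ τ, F τ = qSeries a (nome τ)) (τ : ℍ) :
    normalizedDerivOfComplex F τ = qSeries (fun n => (n : ℂ) * a n) (nome τ) := by
  have h := ha.hasDerivAt_nome τ.im_pos
  have h2 : F ∘ ofComplex =ᶠ[𝓝 (τ : ℂ)] fun w => qSeries a (nome w) := by
    filter_upwards [isOpen_upperHalfPlaneSet.mem_nhds τ.im_pos] with w hw
    simp [hF, ofComplex_apply_of_im_pos hw]
  rw [normalizedDerivOfComplex, h2.deriv_eq, h.deriv]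
  field_simp [Complex.two_pi_I_ne_zero]

/-! ### Ramanujan's differential equations -/

section Ramanujan

open Derivative EisensteinSeries ModularForm
open scoped MatrixGroups Manifold

/-- A holomorphic function of level one and weight `k` is a multiple of any modular form with
limit `1` at `i∞`, if the space of modular forms is one-dimensional. -/
lemma eq_const_mul_of_rank_one {k : ℤ} (hk : Module.rank ℂ (ModularForm 𝒮ℒ k) = 1)
    {F : ℍ → ℂ} (hF : MDiff F) (hslash : ∀ γ : SL(2, ℤ), F ∣[k] γ = F) {c : ℂ}
    (hlim : Tendsto F atImInfty (𝓝 c)) (G : ModularForm 𝒮ℒ k)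
    (hG : Tendsto G atImInfty (𝓝 1)) (τ : ℍ) : F τ = c * G τ := by
  let F' : ModularForm 𝒮ℒ k :=
    { toFun := F
      slash_action_eq' := fun _ ⟨γ, hγ⟩ => hγ ▸ hslash γ
      holo' := hF
      bdd_at_cusps' := by
        intro c hc
        rw [Subgroup.IsArithmetic.isCusp_iff_isCusp_SL2Z] at hc
        rw [OnePoint.isBoundedAt_iff_forall_SL2Z hc]
        intro γ _
        rw [hslash]
        exact hlim.isBigO_one ℝ }
  have hG0 : G ≠ 0 := by
    rintro rfl
    exact one_ne_zero (tendsto_nhds_unique hG tendsto_const_nhds)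
  obtain ⟨d, hd⟩ := (finrank_eq_one_iff_of_nonzero' G hG0).mp
    (Module.rank_eq_one_iff_finrank_eq_one.mp hk) F'
  have hd' : ∀ τ, d * G τ = F τ := fun τ => congrFun (congrArg DFunLike.coe hd) τ
  have : d = c := by
    refine tendsto_nhds_unique ?_ hlim
    have := hG.const_mul d
    simpa [hd'] using this
  rw [← hd', this]

lemma tendsto_E4 : Tendsto E₄ atImInfty (𝓝 1) := by
  have := (PolyGrowth.eisCoeff 3 240).tendsto_atImInfty
  simpa [← E4_eq_qSeries, eisCoeff] using this

lemma tendsto_E6 : Tendsto E₆ atImInfty (𝓝 1) := by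
  have := (PolyGrowth.eisCoeff 5 (-504)).tendsto_atImInfty
  simpa [← E6_eq_qSeries, eisCoeff] using this

lemma tendsto_E2 : Tendsto E2 atImInfty (𝓝 1) := by
  have := (PolyGrowth.eisCoeff 1 (-24)).tendsto_atImInfty
  simpa [← E2_eq_qSeries, eisCoeff] using this

lemma tendsto_normalizedDeriv {F : ℍ → ℂ} {a : ℕ → ℂ} (ha : PolyGrowth a)
    (hF : ∀ τ, F τ = qSeries a (nome τ)) :
    Tendsto (normalizedDerivOfComplex F) atImInfty (𝓝 0) := by
  have := ha.natCast_mul.tendsto_atImInfty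
  simpa [← normalizedDeriv_eq_qSeries ha hF] using this

lemma E4_slash (γ : SL(2, ℤ)) : (E₄ : ℍ → ℂ) ∣[(4 : ℤ)] γ = E₄ := by
  rw [ModularForm.SL_slash]
  exact SlashInvariantFormClass.slash_action_eq E₄ _ ⟨γ, rfl⟩

lemma E6_slash (γ : SL(2, ℤ)) : (E₆ : ℍ → ℂ) ∣[(6 : ℤ)] γ = E₆ := by
  rw [ModularForm.SL_slash]
  exact SlashInvariantFormClass.slash_action_eq E₆ _ ⟨γ, rfl⟩

lemma normalizedDeriv_E4 (τ : ℍ) :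
    normalizedDerivOfComplex E₄ τ = (E2 τ * E₄ τ - E₆ τ) / 3 := by
  have hlim : Tendsto (serreDerivative 4 E₄) atImInfty (𝓝 (-1 / 3)) := by
    have h := (tendsto_normalizedDeriv (PolyGrowth.eisCoeff 3 240) E4_eq_qSeries).sub
      ((tendsto_E2.const_mul (4 * 12⁻¹ : ℂ)).mul tendsto_E4)
    refine (h.congr fun τ => ?_).trans_eq (by norm_num)
    simp [serreDerivative]
  have := eq_const_mul_of_rank_one (F := serreDerivative 4 E₄) levelOne_weight_six_rank_one
    (serreDerivative_mdifferentiable _ (ModularFormClass.holo E₄))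
    (fun γ => serreDerivative_slash_invariant (k := 4) (ModularFormClass.holo E₄) (E4_slash γ))
    hlim E₆ tendsto_E6 τ
  rw [serreDerivative_apply] at this
  linear_combination this

lemma normalizedDeriv_E6 (τ : ℍ) :
    normalizedDerivOfComplex E₆ τ = (E2 τ * E₆ τ - E₄ τ ^ 2) / 2 := by
  have hlim : Tendsto (serreDerivative 6 E₆) atImInfty (𝓝 (-1 / 2)) := by
    have h := (tendsto_normalizedDeriv (PolyGrowth.eisCoeff 5 (-504)) E6_eq_qSeries).sub
      ((tendsto_E2.const_mul (6 * 12⁻¹ : ℂ)).mul tendsto_E6)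
    refine (h.congr fun τ => ?_).trans_eq (by norm_num)
    simp [serreDerivative]
  have := eq_const_mul_of_rank_one (k := 8) (F := serreDerivative 6 E₆)
    (by simpa [Nat.ModEq] using dimension_level_one 8 ⟨4, rfl⟩)
    (serreDerivative_mdifferentiable _ (ModularFormClass.holo E₆))
    (fun γ => serreDerivative_slash_invariant (k := 6) (ModularFormClass.holo E₆) (E6_slash γ))
    hlim (E₄.mul E₄) (by
        have := tendsto_E4.mul tendsto_E4
        rw [mul_one] at this
        exact this) τ
  rw [serreDerivative_apply] at this
  have h2 : (E₄.mul E₄) τ = E₄ τ * E₄ τ := rfl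
  rw [h2] at this
  linear_combination this

lemma normalizedDeriv_E2_slash (γ : SL(2, ℤ)) (τ : ℍ) :
    (normalizedDerivOfComplex E2 ∣[(4 : ℤ)] γ) τ = normalizedDerivOfComplex E2 τ
      - (E2 τ ^ 2 - (E2 ∣[(2 : ℤ)] γ) τ ^ 2) / 12 := by
  have hz := denom_ne_zero (γ : GL (Fin 2) ℝ) τ
  have h1 := congrFun (normalizedDerivOfComplex_SL_slash (k := 2) E2_mdifferentiable (γ := γ)) τ
  have hS : E2 ∣[(2 : ℤ)] γ = E2 - (1 / (2 * riemannZeta 2)) • D2 γ := E2_slash_action γ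
  have hD2 : HasDerivAt (D2 γ ∘ ofComplex)
      (2 * Real.pi * Complex.I * γ 1 0 * (-(γ 1 0 : ℂ) * (denom (γ : GL (Fin 2) ℝ) τ ^ 2)⁻¹))
      (τ : ℂ) := by
    have h := (hasDerivAt_denom_zpow (γ : GL (Fin 2) ℝ) (-1) τ).const_mul
      (2 * Real.pi * Complex.I * γ 1 0 : ℂ)
    refine (h.congr_of_eventuallyEq ?_).congr_deriv ?_
    · filter_upwards [isOpen_upperHalfPlaneSet.mem_nhds τ.im_pos] with w hw
      simp [D2, ofComplex_apply_of_im_pos hw, div_eq_mul_inv]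
    · norm_num
  have hE2 : HasDerivAt (E2 ∘ ofComplex) (deriv (E2 ∘ ofComplex) τ) (τ : ℂ) :=
    (mdifferentiableAt_iff.mp (E2_mdifferentiable τ)).hasDerivAt
  have h2 : normalizedDerivOfComplex (E2 ∣[(2 : ℤ)] γ) τ = normalizedDerivOfComplex E2 τ
      + 1 / (2 * riemannZeta 2) * ((γ 1 0 : ℂ) / denom (γ : GL (Fin 2) ℝ) τ) ^ 2 := by
    have h3 := (hE2.sub (hD2.const_mul (1 / (2 * riemannZeta 2)))).deriv
    rw [hS, normalizedDerivOfComplex, normalizedDerivOfComplex]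
    have h4 : (E2 - (1 / (2 * riemannZeta 2)) • D2 γ) ∘ ofComplex
      = E2 ∘ ofComplex - fun y => 1 / (2 * riemannZeta 2) * (D2 γ ∘ ofComplex) y := by
        ext; simp
    rw [h4, h3]
    field_simp [Complex.two_pi_I_ne_zero]
    ring
  have hX : (E2 ∣[(2 : ℤ)] γ) τ = E2 τ - 1 / (2 * riemannZeta 2) *
      (2 * Real.pi * Complex.I * ((γ 1 0 : ℂ) / denom (γ : GL (Fin 2) ℝ) τ)) := by
    rw [hS]; simp only [Pi.sub_apply, Pi.smul_apply, smul_eq_mul, D2]; ring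
  rw [h2] at h1
  simp only [Pi.sub_apply] at h1
  rw [hX] at h1 ⊢
  set X : ℂ := (γ 1 0 : ℂ) / denom (γ : GL (Fin 2) ℝ) τ
  rw [riemannZeta_two] at h1 ⊢
  have hpi : (Real.pi : ℂ) ≠ 0 := by exact_mod_cast Real.pi_ne_zero
  have h5 : (normalizedDerivOfComplex E2 ∣[(2 + 2 : ℤ)] γ) τ
    = (normalizedDerivOfComplex E2 ∣[(4 : ℤ)] γ) τ := rfl
  rw [h5] at h1
  generalize (normalizedDerivOfComplex E2 ∣[(4 : ℤ)] γ) τ = A at h1 ⊢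
  generalize normalizedDerivOfComplex E2 τ = B at h1 ⊢
  have hI : Complex.I ^ 2 = -1 := Complex.I_sq
  have h6 : A = B + 1 / (2 * ((Real.pi : ℂ) ^ 2 / 6)) * X ^ 2 + (2 : ℤ) * (2 * Real.pi * Complex.I)⁻¹ * X *
      (E2 τ - 1 / (2 * ((Real.pi : ℂ) ^ 2 / 6)) * (2 * Real.pi * Complex.I * X)) := by
    linear_combination -h1
  rw [h6]
  field_simp
  push_cast
  linear_combination (24 * Real.pi * X * E2 τ - 72 * X ^ 2 * Complex.I) * hI

lemma normalizedDeriv_E2 (τ : ℍ) :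
    normalizedDerivOfComplex E2 τ = (E2 τ ^ 2 - E₄ τ) / 12 := by
  have hF : MDiff (fun τ => normalizedDerivOfComplex E2 τ - 12⁻¹ * (E2 τ * E2 τ)) := by
    refine (normalizedDerivOfComplex_mdifferentiable E2_mdifferentiable).sub ?_
    exact (mdifferentiable_const.mul (E2_mdifferentiable.mul E2_mdifferentiable) :
      MDiff (fun τ => (12⁻¹ : ℂ) * (E2 τ * E2 τ)))
  have hlim : Tendsto (fun τ => normalizedDerivOfComplex E2 τ - 12⁻¹ * (E2 τ * E2 τ))
      atImInfty (𝓝 (-1 / 12)) := by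
    have h := (tendsto_normalizedDeriv (PolyGrowth.eisCoeff 1 (-24)) E2_eq_qSeries).sub
      ((tendsto_E2.mul tendsto_E2).const_mul (12⁻¹ : ℂ))
    exact h.trans_eq (by norm_num)
  have := eq_const_mul_of_rank_one levelOne_weight_four_rank_one hF (fun γ => ?_) hlim
    E₄ tendsto_E4 τ
  · linear_combination this
  · ext τ
    have h1 := normalizedDeriv_E2_slash γ τ
    rw [SL_slash_apply] at h1 ⊢
    rw [SL_slash_apply] at h1
    have hz := denom_ne_zero (γ : GL (Fin 2) ℝ) τ
    rw [sub_mul, h1]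
    have : ∀ x : ℂ, 12⁻¹ * (x * x) * denom (γ : GL (Fin 2) ℝ) τ ^ (-4 : ℤ)
      = (x * denom (γ : GL (Fin 2) ℝ) τ ^ (-2 : ℤ)) ^ 2 / 12 := by
      intro x
      rw [mul_pow, ← zpow_natCast (denom _ _ ^ (-2 : ℤ)), ← zpow_mul]
      norm_num
      ring
    rw [this]
    ring

end Ramanujan

/-! ### The lattice invariants as Eisenstein series -/

section Lattice

open EisensteinSeries ModularForm

/-- The lattice `ℤ + ℤ τ`, indexed by pairs `(m, n) ↦ m τ + n`. -/
def latticeEquiv (τ : ℍ) : ℤ × ℤ ≃ (periodPair τ).lattice :=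
  (Equiv.prodComm ℤ ℤ).trans (periodPair τ).latticeEquivProd.symm.toEquiv

lemma coe_latticeEquiv (τ : ℍ) (p : ℤ × ℤ) : (latticeEquiv τ p : ℂ) = p.1 * τ + p.2 := by
  have := (periodPair τ).latticeEquiv_symm_apply (p.2, p.1)
  simp only [periodPair, mul_one] at this
  rw [add_comm, ← this]
  rfl

lemma periodPair_G {k : ℕ} (hk : 3 ≤ k) (τ : ℍ) :
    (periodPair τ).G k = 2 * riemannZeta k * E hk τ := by
  have h1 := tsum_eisSummand_eq_riemannZeta_mul_eisensteinSeries hk τ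
  have h2 : E hk τ = (1 / 2 : ℂ) * eisensteinSeries (N := 1) 0 k τ := rfl
  rw [h2, PeriodPair.G, ← (latticeEquiv τ).tsum_eq]
  rw [← (finTwoArrowEquiv ℤ).symm.tsum_eq] at h1
  have h3 : ∑' c : ℤ × ℤ, ((latticeEquiv τ c : ℂ) ^ k)⁻¹
      = riemannZeta k * eisensteinSeries (N := 1) 0 k τ := by
    rw [← h1]
    refine tsum_congr fun p => ?_
    simp [coe_latticeEquiv, eisSummand]
  rw [h3]; ring

lemma g2_eq (τ : ℍ) : g2 τ = 4 * Real.pi ^ 4 / 3 * E₄ τ := by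
  have h := riemannZeta_four
  rw [g2, PeriodPair.g₂, periodPair_G (by norm_num : 3 ≤ 4)]
  push_cast
  rw [h]; ring

lemma g3_eq (τ : ℍ) : g3 τ = 8 * Real.pi ^ 6 / 27 * E₆ τ := by
  have h := riemannZeta_two_mul_nat (k := 3) (by norm_num)
  have h6 : bernoulli 6 = 1 / 42 := by decide +kernel
  norm_num [h6, Nat.factorial] at h
  rw [g3, PeriodPair.g₃, periodPair_G (by norm_num : 3 ≤ 6)]
  push_cast
  rw [h]; ring

/-- The terms of the series for `ζ(1 / 2; τ)`. -/
def zetaTerm (w : ℂ) : ℂ := 1 / (1 / 2 - w) + 1 / w + 1 / 2 / w ^ 2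

lemma norm_zetaTerm_le {w : ℂ} (h1 : w ≠ 1 / 2) :
    ‖zetaTerm w‖ ≤ 4⁻¹ * (‖w - 0‖ ^ (-3 : ℤ) + ‖w - 1 / 2‖ ^ (-3 : ℤ)) := by
  rcases eq_or_ne w 0 with rfl | h0
  · norm_num [zetaTerm]
  have h1' : (1 / 2 - w) ≠ 0 := sub_ne_zero.mpr h1.symm
  have h : zetaTerm w = 4⁻¹ * (w ^ 2 * (1 / 2 - w))⁻¹ := by
    have h2 : 1 - 2 * w ≠ 0 := fun h => h1' (by linear_combination h / 2)
    rw [zetaTerm, show (1 / 2 - w : ℂ) = (1 - 2 * w) / 2 by ring]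
    field_simp
    ring
  have ha : 0 < ‖w‖ := norm_pos_iff.mpr h0
  have hb : 0 < ‖w - 1 / 2‖ := norm_pos_iff.mpr (sub_ne_zero.mpr h1)
  rw [h, norm_mul, norm_inv, norm_inv, norm_mul, norm_pow, norm_sub_rev, sub_zero]
  have e : ∀ x : ℝ, x ^ (-3 : ℤ) = x⁻¹ ^ 3 := by intro x; simp [zpow_neg]
  rw [e, e, mul_inv, ← inv_pow]
  have ha' := inv_pos.mpr ha
  have hb' := inv_pos.mpr hb
  set a := ‖w‖⁻¹
  set b := ‖w - 1 / 2‖⁻¹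
  have : a ^ 2 * b ≤ a ^ 3 + b ^ 3 := by
    nlinarith [mul_nonneg (add_pos ha' hb').le (sq_nonneg (a - b)), pow_pos ha' 3, pow_pos hb' 3,
      mul_pos ha' (pow_pos hb' 2)]
  norm_num
  linarith

lemma sub_one_half_ne_zero (τ : ℍ) (m n : ℤ) : (m : ℂ) * τ + n - 1 / 2 ≠ 0 := by
  intro h
  have him := congrArg Complex.im h
  have hre := congrArg Complex.re h
  simp at him hre
  rcases him with h0 | h0
  · subst h0
    have : (2 * n : ℝ) = 1 := by
      have : ((0 : ℤ) : ℝ) * (τ : ℂ).re + n - 2⁻¹ = 0 := by simpa using hre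
      push_cast at this; linarith
    norm_cast at this
    omega
  · exact τ.im_ne_zero h0

lemma summable_zetaTerm (τ : ℍ) : Summable fun p : ℤ × ℤ => zetaTerm (p.1 * τ + p.2) := by
  have h : ∀ x : ℂ, Summable fun l : (periodPair τ).lattice => ‖(l : ℂ) - x‖ ^ (-3 : ℤ) :=
    fun x => ZLattice.summable_norm_sub_zpow _ (-3) (by simp) x
  have h2 : Summable fun l : (periodPair τ).lattice => zetaTerm l :=
    Summable.of_norm_bounded (((h 0).add (h (1 / 2))).mul_left 4⁻¹) fun l => norm_zetaTerm_le fun hl => by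
      obtain ⟨p, rfl⟩ := (latticeEquiv τ).surjective l
      rw [coe_latticeEquiv] at hl
      exact sub_one_half_ne_zero τ p.1 p.2 (sub_eq_zero.mpr hl)
  rw [← (latticeEquiv τ).summable_iff] at h2
  refine h2.congr fun p => ?_
  simp [coe_latticeEquiv]

lemma tsum_telescope (c : ℂ) (h : Summable fun n : ℤ => 1 / (c + n) - 1 / (c + n + 1)) :
    ∑' n : ℤ, (1 / (c + n) - 1 / (c + n + 1)) = 0 := by
  refine tendsto_nhds_unique (h.hasSum.comp (Finset.tendsto_Ico_neg (R := ℤ))) ?_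
  have key : ∀ N : ℕ, ∑ n ∈ Finset.Ico (-N : ℤ) N, (1 / (c + (n : ℂ)) - 1 / (c + n + 1))
      = 1 / (c - N) - 1 / (c + N) := by
    intro N
    convert! Finset.sum_Ico_int_sub N (fun n => 1 / (c + (n : ℂ))) using 2 <;>
      simp [add_assoc, sub_eq_add_neg]
  have h1 := (tendsto_zero_inv_linear_sub c 1).sub (tendsto_zero_inv_linear c 1)
  simp only [sub_zero] at h1
  refine h1.congr fun N => ?_
  simp only [Function.comp_apply, key]
  simp

/-- Legendre's quasi-period is the Eisenstein series of weight `2`. Adding the terms of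
`ζ(1 / 2; τ)` at `ω` and `-ω` gives `1 / ω ^ 2` and a part that telescopes along `ω ↦ ω + 1`. -/
lemma eta1_eq_G2 (τ : ℍ) : eta1 τ = G2 τ := by
  have hs := summable_zetaTerm τ
  have hsn : Summable fun p : ℤ × ℤ => zetaTerm (-(p.1 * τ + p.2)) := by
    rw [← (Equiv.neg (ℤ × ℤ)).summable_iff]
    refine hs.congr fun p => ?_
    simp only [Function.comp_apply, Equiv.neg_apply, Prod.fst_neg, Prod.snd_neg, Int.cast_neg]
    ring_nf
  have h1 : weierstrassZeta (1 / 2) τ = ∑' p : ℤ × ℤ, zetaTerm (p.1 * τ + p.2) := by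
    rw [weierstrassZeta, ← (latticeEquiv τ).tsum_eq]
    simp [coe_latticeEquiv, zetaTerm]
  have h2 : weierstrassZeta (1 / 2) τ = ∑' p : ℤ × ℤ, zetaTerm (-(p.1 * τ + p.2)) := by
    rw [h1, ← (Equiv.neg (ℤ × ℤ)).tsum_eq]
    refine tsum_congr fun p => ?_
    simp only [Equiv.neg_apply, Prod.fst_neg, Prod.snd_neg, Int.cast_neg]
    ring_nf
  have h3 : eta1 τ = ∑' p : ℤ × ℤ,
      ((1 / ((p.1 : ℂ) * τ - 1 / 2 + p.2 + 1) - 1 / (p.1 * τ - 1 / 2 + p.2))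
        + eisSummand 2 ![p.1, p.2] τ) := by
    rw [eta1, two_mul]
    nth_rewrite 1 [h1]
    rw [h2, ← hs.tsum_add hsn]
    refine tsum_congr fun p => ?_
    have hz : eisSummand 2 ![p.1, p.2] τ = 1 / ((p.1 : ℂ) * τ + p.2) ^ 2 := by
      simp [eisSummand]
    rw [hz]
    set w : ℂ := (p.1 : ℂ) * τ + p.2 with hw
    have e1 : (p.1 : ℂ) * τ - 1 / 2 + p.2 + 1 = 1 / 2 + w := by rw [hw]; ring
    have e2 : (p.1 : ℂ) * τ - 1 / 2 + p.2 = -(1 / 2 - w) := by rw [hw]; ring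
    rw [e1, e2, zetaTerm, zetaTerm, neg_sq, sub_neg_eq_add, one_div_neg_eq_neg_one_div,
      one_div_neg_eq_neg_one_div]
    ring
  have hsum : Summable fun p : ℤ × ℤ =>
      ((1 / ((p.1 : ℂ) * τ - 1 / 2 + p.2 + 1) - 1 / (p.1 * τ - 1 / 2 + p.2))
        + eisSummand 2 ![p.1, p.2] τ) := by
    refine (hs.add hsn).congr fun p => ?_
    have hz : eisSummand 2 ![p.1, p.2] τ = 1 / ((p.1 : ℂ) * τ + p.2) ^ 2 := by
      simp [eisSummand]
    rw [hz]
    set w : ℂ := (p.1 : ℂ) * τ + p.2 with hw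
    have e1 : (p.1 : ℂ) * τ - 1 / 2 + p.2 + 1 = 1 / 2 + w := by rw [hw]; ring
    have e2 : (p.1 : ℂ) * τ - 1 / 2 + p.2 = -(1 / 2 - w) := by rw [hw]; ring
    rw [e1, e2, zetaTerm, zetaTerm, neg_sq, sub_neg_eq_add, one_div_neg_eq_neg_one_div,
      one_div_neg_eq_neg_one_div]
    ring
  have hinner : ∀ m : ℤ, ∑' n : ℤ,
      ((1 / ((m : ℂ) * τ - 1 / 2 + n + 1) - 1 / (m * τ - 1 / 2 + n)) + eisSummand 2 ![m, n] τ)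
      = e2Summand m τ := by
    intro m
    have ha := hsum.prod_factor m
    have hb := e2Summand_summable m τ
    have hc : Summable fun n : ℤ =>
        (1 / ((m : ℂ) * τ - 1 / 2 + n) - 1 / (m * τ - 1 / 2 + n + 1)) := by
      refine (hb.sub ha).congr fun n => ?_
      ring
    have hd : Summable fun n : ℤ =>
        (1 / ((m : ℂ) * τ - 1 / 2 + n + 1) - 1 / (m * τ - 1 / 2 + n)) :=
      hc.neg.congr fun n => by ring
    rw [hd.tsum_add hb, ← e2Summand]
    have := tsum_telescope _ hc
    rw [← neg_eq_zero, ← tsum_neg] at this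
    simp only [neg_sub] at this
    rw [this, zero_add]
  have hout : Summable fun m : ℤ => e2Summand m τ := by
    refine hsum.prod.congr fun m => ?_
    rw [hinner]
  rw [h3, hsum.tsum_prod, G2, tsum_eq_of_summable_unconditional hout]
  exact tsum_congr hinner

lemma eta1_eq (τ : ℍ) : eta1 τ = Real.pi ^ 2 / 3 * E2 τ := by
  have hpi : (Real.pi : ℂ) ≠ 0 := by exact_mod_cast Real.pi_ne_zero
  rw [eta1_eq_G2, E2]
  simp only [Pi.smul_apply, smul_eq_mul, riemannZeta_two]
  field_simp
  ring

end Lattice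

/-! ### The equivariant function of `E₆` -/

section Equivariant

open EisensteinSeries ModularForm

/-- The Eisenstein series `E₆` as a function on `ℂ` (of interest on the upper half plane). -/
def e6 : ℂ → ℂ := (E₆ : ℍ → ℂ) ∘ ofComplex

/-- The numerator of `φ = (z E₆' + 6 E₆) / E₆'`. -/
def phiNum (z : ℂ) : ℂ := z * deriv e6 z + 6 * e6 z

/-- The finite values of `φ`, in the form `z + 6 E₆ / E₆'`; meaningless at the zeros of `E₆'`. -/
def phiFin (z : ℂ) : ℂ := z + 6 * e6 z / deriv e6 z

lemma e6_coe (τ : ℍ) : e6 τ = E₆ τ := by simp [e6]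

lemma deriv_e6 (τ : ℍ) :
    deriv e6 τ = Real.pi * Complex.I * (E2 τ * E₆ τ - E₄ τ ^ 2) := by
  have h := normalizedDeriv_E6 τ
  rw [Derivative.normalizedDerivOfComplex, inv_mul_eq_iff_eq_mul₀ Complex.two_pi_I_ne_zero] at h
  rw [e6, h]; ring

lemma isCriticalPointE6_iff (τ : ℍ) : IsCriticalPointE6 τ ↔ deriv e6 τ = 0 := Iff.rfl

lemma phiDenom_eq (τ : ℍ) :
    phiDenom τ = 16 * Real.pi ^ 7 / 9 * Complex.I * deriv e6 τ := by
  rw [phiDenom, g2_eq, g3_eq, eta1_eq, deriv_e6]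
  linear_combination (-(16 * Real.pi ^ 8 / 9 * (E2 τ * E₆ τ - E₄ τ ^ 2)) : ℂ) * Complex.I_sq

lemma phi_eq_infty {τ : ℍ} (h : deriv e6 τ = 0) : phi τ = OnePoint.infty := by
  rw [phi, if_pos (by rw [phiDenom_eq, h, mul_zero])]

lemma phi_eq_coe {τ : ℍ} (h : deriv e6 τ ≠ 0) : phi τ = (phiFin τ : OnePoint ℂ) := by
  have hpi : (Real.pi : ℂ) ≠ 0 := by exact_mod_cast Real.pi_ne_zero
  have h1 : phiDenom τ ≠ 0 := by
    rw [phiDenom_eq]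
    simp [hpi, h]
  rw [phi, if_neg h1, phiFin, phiDenom_eq, g3_eq, e6_coe]
  congr 2
  have hI := Complex.I_ne_zero
  field_simp
  ring

end Equivariant

/-! ### Transformation laws -/

section Transformation

open EisensteinSeries ModularForm Derivative
open scoped MatrixGroups Manifold ComplexConjugate

lemma differentiableAt_e6 {z : ℂ} (hz : 0 < z.im) : DifferentiableAt ℂ e6 z :=
  mdifferentiableAt_iff.mp (ModularFormClass.holo E₆ ⟨z, hz⟩)

lemma analyticAt_e6 {z : ℂ} (hz : 0 < z.im) : AnalyticAt ℂ e6 z :=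
  DifferentiableOn.analyticAt (s := upperHalfPlaneSet)
    (fun _ hw => (differentiableAt_e6 hw).differentiableWithinAt)
    (isOpen_upperHalfPlaneSet.mem_nhds hz)

lemma hasDerivAt_comp_ofComplex {F : ℍ → ℂ} (hF : MDiff F) (τ : ℍ) :
    HasDerivAt (F ∘ ofComplex) (2 * Real.pi * Complex.I * normalizedDerivOfComplex F τ)
      (τ : ℂ) := by
  have h := (mdifferentiableAt_iff.mp (hF τ)).hasDerivAt
  refine h.congr_deriv ?_
  rw [normalizedDerivOfComplex, mul_inv_cancel_left₀ Complex.two_pi_I_ne_zero]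

/-- The numerator of `φ'`, a modular form of weight `16`. -/
def phiDerivNum (τ : ℍ) : ℂ := E₄ τ * (E₄ τ ^ 3 - E₆ τ ^ 2)

lemma hasDerivAt_phiFin {τ : ℍ} (h : deriv e6 τ ≠ 0) :
    HasDerivAt phiFin (7 * phiDerivNum τ / (E2 τ * E₆ τ - E₄ τ ^ 2) ^ 2) (τ : ℂ) := by
  have h2 := hasDerivAt_comp_ofComplex E2_mdifferentiable τ
  have h4 := hasDerivAt_comp_ofComplex (ModularFormClass.holo E₄) τ
  have h6 := hasDerivAt_comp_ofComplex (ModularFormClass.holo E₆) τ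
  rw [normalizedDeriv_E2] at h2
  rw [normalizedDeriv_E4] at h4
  rw [normalizedDeriv_E6] at h6
  have hd := ((h2.mul h6).sub (h4.pow 2)).const_mul (Real.pi * Complex.I : ℂ)
  have hd' : HasDerivAt (deriv e6) _ (τ : ℂ) := hd.congr_of_eventuallyEq (by
    filter_upwards [isOpen_upperHalfPlaneSet.mem_nhds τ.im_pos] with w hw
    have := deriv_e6 ⟨w, hw⟩
    simp only [Pi.sub_apply, Pi.mul_apply, Pi.pow_apply, Function.comp_apply]
    rw [ofComplex_apply_of_im_pos hw]
    exact this)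
  have hq := (hasDerivAt_id (τ : ℂ)).add ((h6.const_mul 6).div hd' h)
  refine hq.congr_deriv ?_
  have hpi : (Real.pi : ℂ) ≠ 0 := by exact_mod_cast Real.pi_ne_zero
  have hI := Complex.I_ne_zero
  rw [deriv_e6] at h ⊢
  have hX : E2 τ * E₆ τ - E₄ τ ^ 2 ≠ 0 := fun h0 => h (by rw [h0, mul_zero])
  simp only [Function.comp_apply, ofComplex_apply, phiDerivNum]
  field_simp
  ring

lemma smul_eq_div (γ : SL(2, ℤ)) (τ : ℍ) :
    ((γ • τ : ℍ) : ℂ) = ((γ 0 0 : ℂ) * τ + γ 0 1) / ((γ 1 0 : ℂ) * τ + γ 1 1) := by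
  rw [UpperHalfPlane.specialLinearGroup_apply]
  simp

lemma denom_eq (γ : SL(2, ℤ)) (τ : ℍ) :
    denom (γ : GL (Fin 2) ℝ) τ = (γ 1 0 : ℂ) * τ + γ 1 1 := by
  simp [denom]

lemma cz_add_d_ne_zero (γ : SL(2, ℤ)) (τ : ℍ) : (γ 1 0 : ℂ) * τ + γ 1 1 ≠ 0 := by
  rw [← denom_eq]
  exact denom_ne_zero _ _

lemma e6_smul (γ : SL(2, ℤ)) (τ : ℍ) :
    e6 (γ • τ : ℍ) = ((γ 1 0 : ℂ) * τ + γ 1 1) ^ 6 * e6 τ := by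
  have h := congrFun (E6_slash γ) τ
  rw [SL_slash_apply, denom_eq, zpow_neg, mul_inv_eq_iff_eq_mul₀
    (zpow_ne_zero _ (cz_add_d_ne_zero γ τ))] at h
  rw [e6_coe, e6_coe, h, mul_comm]
  norm_cast

lemma deriv_e6_smul (γ : SL(2, ℤ)) (τ : ℍ) :
    deriv e6 (γ • τ : ℍ) = ((γ 1 0 : ℂ) * τ + γ 1 1) ^ 7 *
      (γ 1 0 * phiNum τ + γ 1 1 * deriv e6 τ) := by
  have h := congrFun (normalizedDerivOfComplex_SL_slash (k := 6) (ModularFormClass.holo E₆)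
    (γ := γ)) τ
  have hj := cz_add_d_ne_zero γ τ
  rw [E6_slash] at h
  simp only [Pi.sub_apply, SL_slash_apply, denom_eq, normalizedDerivOfComplex] at h
  have h8 : ((γ 1 0 : ℂ) * τ + γ 1 1) ^ (-(6 + 2) : ℤ)
      = (((γ 1 0 : ℂ) * τ + γ 1 1) ^ 8)⁻¹ := by
    rw [zpow_neg]; norm_cast
  rw [h8, ← e6, ← e6_coe] at h
  rw [phiNum]
  set j : ℂ := (γ 1 0 : ℂ) * τ + γ 1 1 with hjdef
  have h11 : (γ 1 1 : ℂ) = j - γ 1 0 * τ := by rw [hjdef]; ring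
  rw [h11]
  have hpi : (Real.pi : ℂ) ≠ 0 := by exact_mod_cast Real.pi_ne_zero
  have hI := Complex.I_ne_zero
  generalize deriv e6 (γ • τ : ℍ) = A at h ⊢
  generalize deriv e6 τ = B at h ⊢
  generalize (γ 1 0 : ℂ) = c at h ⊢
  field_simp at h
  push_cast at h
  linear_combination -h

lemma phiNum_smul (γ : SL(2, ℤ)) (τ : ℍ) :
    phiNum (γ • τ : ℍ) = ((γ 1 0 : ℂ) * τ + γ 1 1) ^ 7 *
      (γ 0 0 * phiNum τ + γ 0 1 * deriv e6 τ) := by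
  have hdet : (γ 0 0 : ℂ) * γ 1 1 - γ 0 1 * γ 1 0 = 1 := by
    have := γ.det_coe
    rw [Matrix.det_fin_two] at this
    exact_mod_cast this
  have hj := cz_add_d_ne_zero γ τ
  rw [phiNum, deriv_e6_smul, e6_smul, smul_eq_div, phiNum]
  field_simp
  linear_combination (((γ 1 0 : ℂ) * τ + γ 1 1) ^ 6 * (-6 * e6 τ)) * hdet

lemma nome_neg_conj (z : ℂ) : nome (-conj z) = conj (nome z) := by
  rw [nome, nome, ← Complex.exp_conj]
  simp [map_ofNat]

lemma qSeries_conj {a : ℕ → ℂ} (ha : ∀ n, conj (a n) = a n) (q : ℂ) :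
    qSeries a (conj q) = conj (qSeries a q) := by
  rw [qSeries, qSeries, Complex.conj_tsum]
  simp [ha]

lemma e6_eq {z : ℂ} (hz : 0 < z.im) :
    e6 z = 1 - 504 * qSeries (fun n => (ArithmeticFunction.sigma 5 n : ℂ)) (nome z) := by
  have := E6_eq_qSeries ⟨z, hz⟩
  rw [qSeries_eisCoeff _ _ (norm_nome_lt_one hz)] at this
  rw [show e6 z = e6 ((⟨z, hz⟩ : ℍ) : ℂ) from rfl, e6_coe, this]
  ring

lemma deriv_e6_eq {z : ℂ} (hz : 0 < z.im) :
    deriv e6 z = -(1008 * Real.pi * Complex.I *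
      qSeries (fun n => (n : ℂ) * (ArithmeticFunction.sigma 5 n : ℂ)) (nome z)) := by
  have := normalizedDeriv_eq_qSeries (PolyGrowth.eisCoeff 5 (-504)) E6_eq_qSeries ⟨z, hz⟩
  rw [natCast_mul_eisCoeff, qSeries_const_mul, normalizedDerivOfComplex,
    inv_mul_eq_iff_eq_mul₀ Complex.two_pi_I_ne_zero] at this
  change deriv e6 z = _ at this
  rw [this]
  push_cast
  ring

lemma e6_neg_conj {z : ℂ} (hz : 0 < z.im) : e6 (-conj z) = conj (e6 z) := by
  rw [e6_eq (by simpa using hz), e6_eq hz, nome_neg_conj, qSeries_conj (by simp)]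
  simp [map_ofNat]

lemma deriv_e6_neg_conj {z : ℂ} (hz : 0 < z.im) :
    deriv e6 (-conj z) = -conj (deriv e6 z) := by
  rw [deriv_e6_eq (by simpa using hz), deriv_e6_eq hz, nome_neg_conj, qSeries_conj (by simp)]
  simp [map_ofNat]

lemma phiNum_neg_conj {z : ℂ} (hz : 0 < z.im) : phiNum (-conj z) = conj (phiNum z) := by
  rw [phiNum, phiNum, e6_neg_conj hz, deriv_e6_neg_conj hz]
  simp [map_ofNat]

lemma modular_S_coe (z : ℂ) (hz : 0 < z.im) :
    ((ModularGroup.S • (⟨z, hz⟩ : ℍ) : ℍ) : ℂ) = -1 / z := by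
  rw [smul_eq_div]
  simp [ModularGroup.S]

/-- Behaviour of `E₆'` under the reflection `z ↦ 1 / z̄`. -/
lemma deriv_e6_inv_conj {z : ℂ} (hz : 0 < z.im) :
    deriv e6 (conj z)⁻¹ = -conj (z ^ 7 * phiNum z) := by
  have hw : 0 < (-conj z).im := by simpa using hz
  have h := deriv_e6_smul ModularGroup.S ⟨-conj z, hw⟩
  rw [modular_S_coe] at h
  simp only [ModularGroup.S, Matrix.SpecialLinearGroup.coe_mk] at h
  simp only [Matrix.of_apply, Matrix.cons_val', Matrix.cons_val_zero, Matrix.cons_val_one,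
    Matrix.cons_val_fin_one, Int.cast_one, Int.cast_zero, zero_mul, add_zero, one_mul] at h
  rw [show (conj z)⁻¹ = -1 / -conj z by rw [neg_div_neg_eq, one_div], h, phiNum_neg_conj hz]
  simp only [map_mul, map_pow]
  ring

/-- Behaviour of `z E₆' + 6 E₆` under the reflection `z ↦ 1 / z̄`. -/
lemma phiNum_inv_conj {z : ℂ} (hz : 0 < z.im) :
    phiNum (conj z)⁻¹ = -conj (z ^ 7 * deriv e6 z) := by
  have hw : 0 < (-conj z).im := by simpa using hz
  have h := phiNum_smul ModularGroup.S ⟨-conj z, hw⟩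
  rw [modular_S_coe] at h
  simp only [ModularGroup.S, Matrix.SpecialLinearGroup.coe_mk] at h
  simp only [Matrix.of_apply, Matrix.cons_val', Matrix.cons_val_zero, Matrix.cons_val_one,
    Matrix.cons_val_fin_one, Int.cast_one, Int.cast_zero, zero_mul, add_zero, one_mul,
    zero_add, Int.cast_neg] at h
  rw [show (conj z)⁻¹ = -1 / -conj z by rw [neg_div_neg_eq, one_div], h, deriv_e6_neg_conj hz]
  simp only [map_mul, map_pow]
  ring

lemma modular_T_coe (z : ℂ) (hz : 0 < z.im) :
    ((ModularGroup.T • (⟨z, hz⟩ : ℍ) : ℍ) : ℂ) = z + 1 := by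
  rw [smul_eq_div]
  simp [ModularGroup.T]

lemma deriv_e6_one_sub_conj {z : ℂ} (hz : 0 < z.im) :
    deriv e6 (1 - conj z) = -conj (deriv e6 z) := by
  have hw : 0 < (-conj z).im := by simpa using hz
  have h := deriv_e6_smul ModularGroup.T ⟨-conj z, hw⟩
  rw [modular_T_coe] at h
  simp only [ModularGroup.T, Matrix.SpecialLinearGroup.coe_mk] at h
  simp only [Matrix.of_apply, Matrix.cons_val', Matrix.cons_val_zero, Matrix.cons_val_one,
    Matrix.cons_val_fin_one, Int.cast_one, Int.cast_zero, zero_mul, one_mul,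
    zero_add, one_pow] at h
  rw [show 1 - conj z = -conj z + 1 by ring, h, deriv_e6_neg_conj hz]

lemma phiNum_one_sub_conj {z : ℂ} (hz : 0 < z.im) :
    phiNum (1 - conj z) = conj (phiNum z - deriv e6 z) := by
  have hw : 0 < (-conj z).im := by simpa using hz
  have h := phiNum_smul ModularGroup.T ⟨-conj z, hw⟩
  rw [modular_T_coe] at h
  simp only [ModularGroup.T, Matrix.SpecialLinearGroup.coe_mk] at h
  simp only [Matrix.of_apply, Matrix.cons_val', Matrix.cons_val_zero, Matrix.cons_val_one,
    Matrix.cons_val_fin_one, Int.cast_one, Int.cast_zero, zero_mul, one_mul,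
    zero_add, one_pow] at h
  rw [show 1 - conj z = -conj z + 1 by ring, h, phiNum_neg_conj hz, deriv_e6_neg_conj hz, map_sub]
  ring

/-- `E₄` has the same zeros as its transform under the reflection `z ↦ 1 / z̄`. -/
lemma E4_inv_conj {τ σ : ℍ} (h : (σ : ℂ) = (conj (τ : ℂ))⁻¹) (h0 : E₄ σ = 0) : E₄ τ = 0 := by
  have hw : 0 < (-conj (τ : ℂ)).im := by simpa using τ.im_pos
  set w : ℍ := ⟨-conj (τ : ℂ), hw⟩
  have hS : ModularGroup.S • w = σ := by
    ext
    rw [modular_S_coe, h, neg_div_neg_eq, one_div]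
  have h1 := congrFun (E4_slash ModularGroup.S) w
  rw [SL_slash_apply, hS, h0, zero_mul] at h1
  rw [E4_eq_qSeries] at h1 ⊢
  have h2 : nome w = conj (nome τ) := nome_neg_conj τ
  rw [h2, qSeries_conj (by intro n; by_cases hn : n = 0 <;> simp [eisCoeff, hn, map_ofNat])] at h1
  simpa using h1.symm

end Transformation

/-! ### Estimates for power series in the nome -/

section Estimates

open ArithmeticFunction
open scoped ComplexConjugate

/-- The part `∑_{n ≥ 4} a n q ^ n` of a power series. -/
def qTail (a : ℕ → ℕ) (q : ℂ) : ℂ := ∑' n, (a (n + 4) : ℂ) * q ^ (n + 4)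

lemma norm_pow_sub_pow_le {q p : ℂ} {r : ℝ} (hq : ‖q‖ ≤ r) (hp : ‖p‖ ≤ r) (n : ℕ) :
    ‖q ^ (n + 1) - p ^ (n + 1)‖ ≤ (n + 1) * r ^ n * ‖q - p‖ := by
  have hr : 0 ≤ r := (norm_nonneg q).trans hq
  induction n with
  | zero => simp
  | succ n ih =>
    have h : q ^ (n + 1 + 1) - p ^ (n + 1 + 1)
      = q * (q ^ (n + 1) - p ^ (n + 1)) + p ^ (n + 1) * (q - p) := by ring
    rw [h]
    refine (norm_add_le _ _).trans ?_
    rw [norm_mul, norm_mul, norm_pow]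
    have h1 : ‖q‖ * ‖q ^ (n + 1) - p ^ (n + 1)‖ ≤ r * ((n + 1) * r ^ n * ‖q - p‖) := by
      gcongr
    have h2 : ‖p‖ ^ (n + 1) * ‖q - p‖ ≤ r ^ (n + 1) * ‖q - p‖ := by gcongr
    push_cast
    calc _ ≤ _ := add_le_add h1 h2
      _ = _ := by ring

lemma qSeries_eq_add_qTail {a : ℕ → ℕ} (ha : PolyGrowth fun n => (a n : ℂ)) (h0 : a 0 = 0)
    {q : ℂ} (hq : ‖q‖ < 1) :
    qSeries (fun n => (a n : ℂ)) q = a 1 * q + a 2 * q ^ 2 + a 3 * q ^ 3 + qTail a q := by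
  rw [qSeries, qTail, ← (ha.summable hq).sum_add_tsum_nat_add 4]
  simp [Finset.sum_range_succ, h0]

/-- The tail of a power series with `n a n ≤ C 6 ^ (n - 4)` is Lipschitz on small discs. -/
lemma norm_qTail_sub_le {a : ℕ → ℕ} {C : ℕ} (hg : PolyGrowth fun n => (a n : ℂ))
    (ha : ∀ n, (n + 4) * a (n + 4) ≤ C * 6 ^ n)
    {q p : ℂ} {r : ℝ} (hq : ‖q‖ ≤ r) (hp : ‖p‖ ≤ r) (hr : r ≤ 9 / 2000) :
    ‖qTail a q - qTail a p‖ ≤ 1.03 * C * r ^ 3 * ‖q - p‖ := by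
  have hr0 : 0 ≤ r := (norm_nonneg q).trans hq
  have hs : ∀ w : ℂ, ‖w‖ ≤ r → Summable fun n => (a (n + 4) : ℂ) * w ^ (n + 4) := fun w hw =>
    (summable_nat_add_iff (f := fun n => (a n : ℂ) * w ^ n) 4).mpr
      (hg.summable (by linarith))
  have h6 : 6 * r < 1 := by linarith
  have hgeo := (hasSum_geometric_of_lt_one (by positivity) h6).mul_left (C * r ^ 3 * ‖q - p‖)
  rw [qTail, qTail, ← (hs q hq).tsum_sub (hs p hp)]
  refine (tsum_of_norm_bounded hgeo fun n => ?_).trans ?_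
  · rw [← mul_sub, norm_mul, Complex.norm_natCast]
    have h1 := norm_pow_sub_pow_le hq hp (n + 3)
    have h2 : ((n : ℝ) + 4) * a (n + 4) ≤ C * 6 ^ n := by exact_mod_cast ha n
    calc (a (n + 4) : ℝ) * ‖q ^ (n + 4) - p ^ (n + 4)‖
        ≤ a (n + 4) * (((n + 3 : ℕ) + 1) * r ^ (n + 3) * ‖q - p‖) := by gcongr
      _ = (((n : ℝ) + 4) * a (n + 4)) * (r ^ (n + 3) * ‖q - p‖) := by push_cast; ring
      _ ≤ (C * 6 ^ n) * (r ^ (n + 3) * ‖q - p‖) := by gcongr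
      _ = C * r ^ 3 * ‖q - p‖ * (6 * r) ^ n := by ring
  · have h7 : (1 - 6 * r)⁻¹ ≤ 1.03 := by
      rw [inv_le_comm₀ (by linarith) (by norm_num)]
      norm_num
      linarith
    calc C * r ^ 3 * ‖q - p‖ * (1 - 6 * r)⁻¹ ≤ C * r ^ 3 * ‖q - p‖ * 1.03 := by gcongr
      _ = _ := by ring

lemma qTail_zero (a : ℕ → ℕ) : qTail a 0 = 0 := by simp [qTail]

lemma qTail_conj (a : ℕ → ℕ) (q : ℂ) : qTail a (conj q) = conj (qTail a q) := by
  rw [qTail, qTail, Complex.conj_tsum]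
  simp

lemma norm_sub_conj (z : ℂ) : ‖z - conj z‖ = 2 * |z.im| := by
  rw [Complex.sub_conj]
  simp

lemma pow_eight_le (n : ℕ) : (n + 4) ^ 8 ≤ 65536 * 6 ^ n := by
  induction n with
  | zero => norm_num
  | succ n ih =>
    have h1 : (4 * (n + 1 + 4)) ^ 8 ≤ (5 * (n + 4)) ^ 8 := Nat.pow_le_pow_left (by omega) 8
    rw [mul_pow, mul_pow] at h1
    norm_num at h1
    rw [pow_succ 6 n]
    omega

lemma mul_sigma_five_le (n : ℕ) : (n + 4) * sigma 5 (n + 4) ≤ 16384 * 6 ^ n := by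
  have h1 := sigma_le_pow_succ 5 (n + 4)
  have h2 := pow_eight_le n
  have h3 : (n + 4) * sigma 5 (n + 4) ≤ (n + 4) ^ 7 := by
    calc _ ≤ (n + 4) * (n + 4) ^ 6 := Nat.mul_le_mul_left _ h1
      _ = _ := by ring
  have h4 : 4 * (n + 4) ^ 7 ≤ (n + 4) ^ 8 := by
    rw [show (n + 4) ^ 8 = (n + 4) * (n + 4) ^ 7 by ring]
    exact Nat.mul_le_mul_right _ (by omega)
  omega

lemma mul_mul_sigma_five_le (n : ℕ) :
    (n + 4) * ((n + 4) * sigma 5 (n + 4)) ≤ 65536 * 6 ^ n := by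
  have h1 := sigma_le_pow_succ 5 (n + 4)
  calc _ ≤ (n + 4) * ((n + 4) * (n + 4) ^ 6) :=
        Nat.mul_le_mul_left _ (Nat.mul_le_mul_left _ h1)
    _ = (n + 4) ^ 8 := by ring
    _ ≤ _ := pow_eight_le n

lemma mul_sigma_three_le (n : ℕ) : (n + 4) * sigma 3 (n + 4) ≤ 65536 * 6 ^ n := by
  have h1 := sigma_le_pow_succ 3 (n + 4)
  calc _ ≤ (n + 4) * (n + 4) ^ 4 := Nat.mul_le_mul_left _ h1
    _ = (n + 4) ^ 5 := by ring
    _ ≤ (n + 4) ^ 8 := Nat.pow_le_pow_right (by omega) (by norm_num)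
    _ ≤ _ := pow_eight_le n

/-- The series `∑ σ₅(n) q ^ n = (1 - E₆) / 504`. -/
def sigS (q : ℂ) : ℂ := qSeries (fun n => (sigma 5 n : ℂ)) q

/-- The series `∑ n σ₅(n) q ^ n`, proportional to `E₆'`. -/
def sigD (q : ℂ) : ℂ := qSeries (fun n => (n : ℂ) * (sigma 5 n : ℂ)) q

/-- The terms of `sigS` of degree at least three. -/
def remS (q : ℂ) : ℂ := 244 * q ^ 3 + qTail (fun n => sigma 5 n) q

/-- The terms of `sigD` of degree at least three. -/
def remD (q : ℂ) : ℂ := 732 * q ^ 3 + qTail (fun n => n * sigma 5 n) q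

lemma sigma_five_two : sigma 5 2 = 33 := by decide +kernel

lemma sigma_five_three : sigma 5 3 = 244 := by decide +kernel

lemma sigma_three_two : sigma 3 2 = 9 := by decide +kernel

lemma sigma_three_three : sigma 3 3 = 28 := by decide +kernel

lemma polyGrowth_mul_sigma_five : PolyGrowth fun n => ((n * sigma 5 n : ℕ) : ℂ) := by
  have := (PolyGrowth.sigma 5).natCast_mul
  exact_mod_cast this

lemma sigS_eq {q : ℂ} (hq : ‖q‖ < 1) : sigS q = q + 33 * q ^ 2 + remS q := by
  rw [sigS, qSeries_eq_add_qTail (PolyGrowth.sigma 5) (by simp) hq, sigma_five_two,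
    sigma_five_three, remS]
  simp
  ring

lemma sigD_eq {q : ℂ} (hq : ‖q‖ < 1) : sigD q = q + 66 * q ^ 2 + remD q := by
  have h := qSeries_eq_add_qTail polyGrowth_mul_sigma_five (by simp) hq
  have h2 : sigD q = qSeries (fun n => ((n * sigma 5 n : ℕ) : ℂ)) q := by
    simp [sigD]
  rw [h2, h, sigma_five_two, sigma_five_three, remD]
  norm_num
  ring

lemma abs_im_le_of_norm_sub_conj_le {w q : ℂ} {c : ℝ}
    (h : ‖w - conj w‖ ≤ c * ‖q - conj q‖) : |w.im| ≤ c * |q.im| := by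
  rw [norm_sub_conj, norm_sub_conj] at h
  linarith

lemma remS_conj (q : ℂ) : remS (conj q) = conj (remS q) := by
  simp [remS, qTail_conj, map_ofNat]

lemma remD_conj (q : ℂ) : remD (conj q) = conj (remD q) := by
  simp [remD, qTail_conj, map_ofNat]

lemma norm_remS_le {q : ℂ} (hq : ‖q‖ ≤ 0.00435) : ‖remS q‖ ≤ 320 * ‖q‖ ^ 3 := by
  have h := norm_qTail_sub_le (PolyGrowth.sigma 5) mul_sigma_five_le (p := 0) le_rfl
    (by simp) (hq.trans (by norm_num))
  rw [qTail_zero, sub_zero, sub_zero] at h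
  refine (norm_add_le _ _).trans ?_
  rw [norm_mul, norm_pow]
  norm_num at h ⊢
  nlinarith [pow_nonneg (norm_nonneg q) 3, mul_le_mul_of_nonneg_left hq (pow_nonneg (norm_nonneg q) 3)]

lemma norm_remD_le {q : ℂ} (hq : ‖q‖ ≤ 0.00435) : ‖remD q‖ ≤ 1030 * ‖q‖ ^ 3 := by
  have h := norm_qTail_sub_le polyGrowth_mul_sigma_five mul_mul_sigma_five_le (p := 0) le_rfl
    (by simp) (hq.trans (by norm_num))
  rw [qTail_zero, sub_zero, sub_zero] at h
  refine (norm_add_le _ _).trans ?_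
  rw [norm_mul, norm_pow]
  norm_num at h ⊢
  nlinarith [pow_nonneg (norm_nonneg q) 3, mul_le_mul_of_nonneg_left hq (pow_nonneg (norm_nonneg q) 3)]

lemma abs_im_remS_le {q : ℂ} (hq : ‖q‖ ≤ 0.00435) :
    |(remS q).im| ≤ 810 * ‖q‖ ^ 2 * |q.im| := by
  have h := norm_qTail_sub_le (PolyGrowth.sigma 5) mul_sigma_five_le (q := q) (p := conj q) le_rfl
    (by simp) (hq.trans (by norm_num))
  have h3 := norm_pow_sub_pow_le (q := q) (p := conj q) le_rfl (by simp) 2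
  apply abs_im_le_of_norm_sub_conj_le
  rw [← remS_conj, remS, remS, add_sub_add_comm, ← mul_sub]
  refine (norm_add_le _ _).trans ?_
  rw [norm_mul]
  norm_num at h h3 ⊢
  nlinarith [mul_nonneg (pow_nonneg (norm_nonneg q) 2) (norm_nonneg (q - conj q)),
    mul_le_mul_of_nonneg_left hq (mul_nonneg (pow_nonneg (norm_nonneg q) 2)
      (norm_nonneg (q - conj q)))]

lemma abs_im_remD_le {q : ℂ} (hq : ‖q‖ ≤ 0.00435) :
    |(remD q).im| ≤ 2500 * ‖q‖ ^ 2 * |q.im| := by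
  have h := norm_qTail_sub_le polyGrowth_mul_sigma_five mul_mul_sigma_five_le (q := q)
    (p := conj q) le_rfl (by simp) (hq.trans (by norm_num))
  have h3 := norm_pow_sub_pow_le (q := q) (p := conj q) le_rfl (by simp) 2
  apply abs_im_le_of_norm_sub_conj_le
  rw [← remD_conj, remD, remD, add_sub_add_comm, ← mul_sub]
  refine (norm_add_le _ _).trans ?_
  rw [norm_mul]
  norm_num at h h3 ⊢
  nlinarith [mul_nonneg (pow_nonneg (norm_nonneg q) 2) (norm_nonneg (q - conj q)),
    mul_le_mul_of_nonneg_left hq (mul_nonneg (pow_nonneg (norm_nonneg q) 2)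
      (norm_nonneg (q - conj q)))]

lemma norm_sigD_ge {q : ℂ} (hq : ‖q‖ ≤ 0.00435) : 0.69 * ‖q‖ ≤ ‖sigD q‖ := by
  rw [sigD_eq (hq.trans_lt (by norm_num))]
  have h1 := norm_remD_le hq
  have h2 : ‖q‖ ≤ ‖q + 66 * q ^ 2 + remD q‖ + ‖66 * q ^ 2‖ + ‖remD q‖ := by
    calc ‖q‖ = ‖(q + 66 * q ^ 2 + remD q) - 66 * q ^ 2 - remD q‖ := by ring_nf
      _ ≤ _ := (norm_sub_le _ _).trans (by gcongr; exact norm_sub_le _ _)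
  rw [norm_mul, norm_pow] at h2
  norm_num at h2 ⊢
  have h0 := norm_nonneg q
  nlinarith [mul_nonneg h0 h0, mul_le_mul_of_nonneg_left hq h0,
    mul_le_mul_of_nonneg_left hq (mul_nonneg h0 h0)]

lemma sigD_ne_zero {q : ℂ} (hq : ‖q‖ ≤ 0.00435) (h0 : q ≠ 0) : sigD q ≠ 0 := by
  have h1 := norm_sigD_ge hq
  have h2 := norm_pos_iff.mpr h0
  rw [← norm_pos_iff]
  linarith

/-- `∑ σ₃(n) q ^ n` is injective on a disc which contains the nome of the points of the
fundamental domain of the modular group. -/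
lemma injOn_sigma_three {q p : ℂ} (hq : ‖q‖ ≤ 0.00435) (hp : ‖p‖ ≤ 0.00435)
    (h : qSeries (fun n => (sigma 3 n : ℂ)) q = qSeries (fun n => (sigma 3 n : ℂ)) p) :
    q = p := by
  rw [qSeries_eq_add_qTail (PolyGrowth.sigma 3) (by simp) (hq.trans_lt (by norm_num)),
    qSeries_eq_add_qTail (PolyGrowth.sigma 3) (by simp) (hp.trans_lt (by norm_num)),
    sigma_three_two, sigma_three_three] at h
  have ht := norm_qTail_sub_le (PolyGrowth.sigma 3) mul_sigma_three_le hq hp (by norm_num)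
  have h2 := norm_pow_sub_pow_le hq hp 1
  have h3 := norm_pow_sub_pow_le hq hp 2
  have he : q - p = -(9 * (q ^ 2 - p ^ 2)) - 28 * (q ^ 3 - p ^ 3)
      - (qTail (fun n => sigma 3 n) q - qTail (fun n => sigma 3 n) p) := by
    simp only [isMultiplicative_sigma.map_one] at h
    push_cast at h
    linear_combination h
  have hn : ‖q - p‖ ≤ ‖9 * (q ^ 2 - p ^ 2)‖ + ‖28 * (q ^ 3 - p ^ 3)‖
      + ‖qTail (fun n => sigma 3 n) q - qTail (fun n => sigma 3 n) p‖ := by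
    calc ‖q - p‖ = _ := congrArg norm he
      _ ≤ _ := (norm_sub_le _ _).trans (by
        gcongr; exact (norm_sub_le _ _).trans (by rw [norm_neg]))
  rw [norm_mul, norm_mul] at hn
  norm_num at hn h2 h3 ht
  have : ‖q - p‖ ≤ 0 := by linarith [norm_nonneg (q - p)]
  exact sub_eq_zero.mp (norm_le_zero_iff.mp this)

end Estimates

/-! ### The function `φ` on half of the fundamental domain of the modular group -/

section HalfTriangle

open ModularForm
open scoped ComplexConjugate

/-- The right half of the fundamental domain of the modular group. -/
def halfTriangle : Set ℂ := {z | 0 < z.im ∧ 0 ≤ z.re ∧ z.re ≤ 1 / 2 ∧ 1 ≤ ‖z‖}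

lemma normSq_eq_re_sq_add_im_sq (z : ℂ) : ‖z‖ ^ 2 = z.re ^ 2 + z.im ^ 2 := by
  rw [← Complex.normSq_eq_norm_sq, Complex.normSq_apply]; ring

lemma im_gt_of_mem_halfTriangle {z : ℂ} (hz : z ∈ halfTriangle) : 0.866 < z.im := by
  obtain ⟨h0, h1, h2, h3⟩ := hz
  have h4 := normSq_eq_re_sq_add_im_sq z
  nlinarith

lemma lt_exp_const : (230 : ℝ) < Real.exp 5.44 := by
  have h1 : (2.718281828 : ℝ) < Real.exp 1 := by have := Real.exp_one_gt_d9; linarith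
  have h2 : (1.11605 : ℝ) ≤ Real.exp 0.11 := by
    have := Real.quadratic_le_exp_of_nonneg (x := 0.11) (by norm_num)
    norm_num at this ⊢
    linarith
  have h3 : Real.exp 5.44 = Real.exp 1 ^ 5 * Real.exp 0.11 ^ 4 := by
    rw [← Real.exp_nat_mul, ← Real.exp_nat_mul, ← Real.exp_add]
    norm_num
  rw [h3]
  calc (230 : ℝ) < 2.718281828 ^ 5 * 1.11605 ^ 4 := by norm_num
    _ ≤ _ := by gcongr

lemma two_pi_mul_gt {y : ℝ} (hy : 0.866 < y) : 5.44 < 2 * Real.pi * y := by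
  have := Real.pi_gt_d6
  nlinarith

lemma norm_nome_le {z : ℂ} (hz : 0.866 < z.im) : ‖nome z‖ ≤ 0.00435 := by
  rw [norm_nome, Real.exp_neg, inv_le_comm₀ (Real.exp_pos _) (by norm_num)]
  have h1 := Real.exp_le_exp.mpr (two_pi_mul_gt hz).le
  have h2 := lt_exp_const
  have h3 := h2.trans_le h1
  refine le_trans ?_ h3.le
  norm_num

lemma nome_re (z : ℂ) : (nome z).re = ‖nome z‖ * Real.cos (2 * Real.pi * z.re) := by
  rw [norm_nome, nome, Complex.exp_re]
  congr 2 <;> simp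

lemma nome_im (z : ℂ) : (nome z).im = ‖nome z‖ * Real.sin (2 * Real.pi * z.re) := by
  rw [norm_nome, nome, Complex.exp_im]
  congr 2 <;> simp

lemma deriv_e6_ne_zero_of_im_gt {z : ℂ} (hz : 0.866 < z.im) : deriv e6 z ≠ 0 := by
  have hpi : (Real.pi : ℂ) ≠ 0 := by exact_mod_cast Real.pi_ne_zero
  have h := sigD_ne_zero (norm_nome_le hz) (nome_ne_zero z)
  rw [deriv_e6_eq (by linarith)]
  rw [sigD] at h
  simp [hpi, h]

/-- The quotient `W = E₆ / (168 π ∑ n σ₅(n) q ^ n)`, for which `φ(z) = z + i W(z)`. -/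
def phiCorr (z : ℂ) : ℂ := e6 z / (168 * Real.pi * sigD (nome z))

lemma phiFin_eq {z : ℂ} (hz : 0.866 < z.im) : phiFin z = z + Complex.I * phiCorr z := by
  have hpi : (Real.pi : ℂ) ≠ 0 := by exact_mod_cast Real.pi_ne_zero
  have h := sigD_ne_zero (norm_nome_le hz) (nome_ne_zero z)
  have hI := Complex.I_ne_zero
  rw [phiFin, phiCorr, deriv_e6_eq (by linarith)]
  rw [← sigD]
  congr 1
  field_simp
  rw [Complex.I_sq]
  ring

lemma phiFin_re {z : ℂ} (hz : 0.866 < z.im) : (phiFin z).re = z.re - (phiCorr z).im := by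
  rw [phiFin_eq hz]; simp; ring

lemma phiFin_im {z : ℂ} (hz : 0.866 < z.im) : (phiFin z).im = z.im + (phiCorr z).re := by
  rw [phiFin_eq hz]; simp

lemma phiCorr_eq_mul_conj {z : ℂ} :
    phiCorr z = ((168 * Real.pi * ‖sigD (nome z)‖ ^ 2)⁻¹ : ℝ) * (e6 z * conj (sigD (nome z))) := by
  have hpi : (Real.pi : ℂ) ≠ 0 := by exact_mod_cast Real.pi_ne_zero
  rw [phiCorr]
  rcases eq_or_ne (sigD (nome z)) 0 with h | h
  · simp [h]
  have h2 : conj (sigD (nome z)) ≠ 0 := by simpa using h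
  have h3 : ((‖sigD (nome z)‖ ^ 2 : ℝ) : ℂ) = sigD (nome z) * conj (sigD (nome z)) := by
    rw [Complex.mul_conj, Complex.normSq_eq_norm_sq]
  push_cast at h3 ⊢
  rw [h3]
  field_simp

/-- Estimate for the imaginary part of `(1 - 504 S) * conj D` when `S = q + 33 q² + s` and
`D = q + 66 q² + d` with remainders `s` and `d` of order three. -/
lemma im_mul_conj_le {q s d : ℂ} (hq : ‖q‖ ≤ 0.00435) (hv : 0 ≤ q.im)
    (hs : ‖s‖ ≤ 320 * ‖q‖ ^ 3) (hd : ‖d‖ ≤ 1030 * ‖q‖ ^ 3)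
    (hs' : |s.im| ≤ 810 * ‖q‖ ^ 2 * q.im) (hd' : |d.im| ≤ 2500 * ‖q‖ ^ 2 * q.im) :
    ((1 - 504 * (q + 33 * q ^ 2 + s)) * conj (q + 66 * q ^ 2 + d)).im
      ≤ q.im * (-1 - 132 * q.re + 32000 * ‖q‖ ^ 2) := by
  set r := ‖q‖ with hr
  have hr0 : 0 ≤ r := norm_nonneg q
  have hbil : ∀ a b : ℂ, (conj a * b).im ≤ ‖a‖ * |b.im| + |a.im| * ‖b‖ := by
    intro a b
    have h1 : (conj a * b).im = a.re * b.im - a.im * b.re := by simp; ring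
    rw [h1]
    have h2 : a.re * b.im ≤ ‖a‖ * |b.im| := (le_abs_self _).trans (by
      rw [abs_mul]; gcongr; exact Complex.abs_re_le_norm a)
    have h3 : -(a.im * b.re) ≤ |a.im| * ‖b‖ := (neg_le_abs _).trans (by
      rw [abs_mul]; gcongr; exact Complex.abs_re_le_norm b)
    linarith
  have hsq := normSq_eq_re_sq_add_im_sq q
  rw [← hr] at hsq
  have hu : |q.re| ≤ r := Complex.abs_re_le_norm q
  -- bounds for `q + 33 q²` and `q + 66 q²`, the parts of order at most two
  have hS0 : ‖q + 33 * q ^ 2‖ ≤ r * (1 + 33 * r) := by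
    refine (norm_add_le _ _).trans ?_
    rw [norm_mul, norm_pow, ← hr]; norm_num; linarith
  have hD0 : ‖q + 66 * q ^ 2‖ ≤ r * (1 + 66 * r) := by
    refine (norm_add_le _ _).trans ?_
    rw [norm_mul, norm_pow, ← hr]; norm_num; linarith
  have him : ∀ c : ℝ, 0 ≤ c → |(q + c * q ^ 2).im| ≤ q.im * (1 + 2 * c * r) := by
    intro c hc
    have h1 : (q + c * q ^ 2).im = q.im * (1 + 2 * c * q.re) := by simp [pow_two]; ring
    rw [h1, abs_mul, abs_of_nonneg hv]
    gcongr
    refine (abs_add_le _ _).trans ?_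
    rw [abs_one, abs_mul, abs_of_nonneg (by positivity : 0 ≤ 2 * c)]
    gcongr
  have hS0' := him 33 (by norm_num)
  have hD0' := him 66 (by norm_num)
  push_cast at hS0' hD0'
  have e : ((1 - 504 * (q + 33 * q ^ 2 + s)) * conj (q + 66 * q ^ 2 + d)).im
      = -(q.im * (1 + 132 * q.re)) - d.im + 504 * (33 * r ^ 2 * q.im
        + (conj (q + 33 * q ^ 2) * d).im + (conj s * (q + 66 * q ^ 2)).im
        + (conj s * d).im) := by
    rw [hsq]
    simp [pow_two, Complex.mul_im, Complex.mul_re, map_ofNat]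
    ring
  rw [e]
  have b1 := (hbil (q + 33 * q ^ 2) d).trans (add_le_add
    (mul_le_mul hS0 hd' (abs_nonneg _) (by positivity))
    (mul_le_mul hS0' hd (norm_nonneg _) (by positivity)))
  have b2 := (hbil s (q + 66 * q ^ 2)).trans (add_le_add
    (mul_le_mul hs hD0' (abs_nonneg _) (by positivity))
    (mul_le_mul hs' hD0 (norm_nonneg _) (by positivity)))
  have b3 := (hbil s d).trans (add_le_add
    (mul_le_mul hs hd' (abs_nonneg _) (by positivity))
    (mul_le_mul hs' hd (norm_nonneg _) (by positivity)))
  have hd'' := (abs_le.mp hd').1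
  have key : r * (1 + 33 * r) * (2500 * r ^ 2 * q.im) + q.im * (1 + 2 * 33 * r) * (1030 * r ^ 3)
      + (320 * r ^ 3 * (q.im * (1 + 2 * 66 * r)) + 810 * r ^ 2 * q.im * (r * (1 + 66 * r)))
      + (320 * r ^ 3 * (2500 * r ^ 2 * q.im) + 810 * r ^ 2 * q.im * (1030 * r ^ 3))
      ≤ 25.5 * (r ^ 2 * q.im) := by
    have : r * (1 + 33 * r) * 2500 + (1 + 66 * r) * (1030 * r) + (320 * r * (1 + 132 * r)
      + 810 * (r * (1 + 66 * r))) + (320 * 2500 * r ^ 3 + 810 * 1030 * r ^ 3) ≤ 25.5 := by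
      have h2 : r ^ 2 ≤ 0.00435 ^ 2 := by gcongr
      have h3 : r ^ 3 ≤ 0.00435 ^ 3 := by gcongr
      norm_num at h2 h3 ⊢
      nlinarith
    nlinarith [mul_le_mul_of_nonneg_right this (mul_nonneg (pow_nonneg hr0 2) hv)]
  nlinarith [mul_nonneg (pow_nonneg hr0 2) hv]

lemma e6_eq_rem {z : ℂ} (hz : 0.866 < z.im) :
    e6 z = 1 - 504 * (nome z + 33 * nome z ^ 2 + remS (nome z)) := by
  rw [e6_eq (by linarith), ← sigS, sigS_eq ((norm_nome_le hz).trans_lt (by norm_num))]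

/-- On the half triangle away from the imaginary axis `φ` has positive real part. -/
lemma phiFin_re_pos {z : ℂ} (hz : 0.866 < z.im) (h0 : 0 < z.re) (h1 : z.re ≤ 1 / 2) :
    0 < (phiFin z).re := by
  have hq := norm_nome_le hz
  have hqpos : 0 < ‖nome z‖ := norm_pos_iff.mpr (nome_ne_zero z)
  have hpi := Real.pi_gt_d6
  have hv : 0 ≤ (nome z).im := by
    rw [nome_im]
    exact mul_nonneg hqpos.le (Real.sin_nonneg_of_nonneg_of_le_pi (by positivity) (by nlinarith))
  have hs' := abs_im_remS_le hq
  have hd' := abs_im_remD_le hq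
  rw [abs_of_nonneg hv] at hs' hd'
  have key := im_mul_conj_le hq hv (norm_remS_le hq) (norm_remD_le hq) hs' hd'
  rw [← e6_eq_rem hz, ← sigD_eq (hq.trans_lt (by norm_num))] at key
  rw [phiFin_re hz, phiCorr_eq_mul_conj, Complex.im_ofReal_mul]
  have hD := norm_sigD_ge hq
  set A := (e6 z * conj (sigD (nome z))).im
  set r := ‖nome z‖
  have hD2 : 0.476 * r ^ 2 ≤ ‖sigD (nome z)‖ ^ 2 := by
    calc 0.476 * r ^ 2 ≤ (0.69 * r) ^ 2 := by nlinarith [sq_nonneg r]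
      _ ≤ _ := by gcongr
  have hDpos : 0 < ‖sigD (nome z)‖ ^ 2 := by nlinarith [pow_pos hqpos 2]
  have hden : 0 < 168 * Real.pi * ‖sigD (nome z)‖ ^ 2 := by positivity
  have hr2 : r ^ 2 ≤ 0.00435 * r := by nlinarith
  suffices h : A < z.re * (168 * Real.pi * ‖sigD (nome z)‖ ^ 2) by
    rw [inv_mul_eq_div, sub_pos, div_lt_iff₀ hden]
    exact h
  rcases le_or_gt 0 (nome z).re with hu | hu
  · have hA : A ≤ 0 := by
      refine key.trans (mul_nonpos_of_nonneg_of_nonpos hv ?_)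
      nlinarith
    exact hA.trans_lt (by positivity)
  · -- a negative real part of the nome forces `1 / 4 < z.re`
    have hx : 1 / 4 < z.re := by
      by_contra! hx
      have := Real.cos_nonneg_of_neg_pi_div_two_le_of_le (x := 2 * Real.pi * z.re)
        (by nlinarith [mul_pos Real.pi_pos h0]) (by nlinarith)
      rw [nome_re] at hu
      have := mul_nonneg hqpos.le this
      linarith
    have hur : -r ≤ (nome z).re := (abs_le.mp (Complex.abs_re_le_norm (nome z))).1
    have hvr : (nome z).im ≤ r := (le_abs_self _).trans (Complex.abs_im_le_norm _)
    have hA : A ≤ r * (60 * r) := by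
      refine key.trans ?_
      have h2 : -1 - 132 * (nome z).re + 32000 * r ^ 2 ≤ 60 * r := by nlinarith
      calc _ ≤ (nome z).im * (60 * r) := by gcongr
        _ ≤ _ := by gcongr
    have h3 : 1 / 4 * (168 * 3.141592 * (0.476 * r ^ 2))
        ≤ z.re * (168 * Real.pi * ‖sigD (nome z)‖ ^ 2) := by gcongr
    nlinarith [pow_pos hqpos 2]

/-- `φ` maps the right side of the half triangle into the lower half plane. -/
lemma phiFin_im_neg {z : ℂ} (hz : 0.866 < z.im) (h1 : z.re = 1 / 2) : (phiFin z).im < 0 := by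
  have hq := norm_nome_le hz
  have hqpos : 0 < ‖nome z‖ := norm_pos_iff.mpr (nome_ne_zero z)
  have hpi := Real.pi_gt_d6
  have hpi' := Real.pi_lt_d6
  have hre : (nome z).re = -‖nome z‖ := by
    rw [nome_re, h1, show 2 * Real.pi * (1 / 2) = Real.pi by ring, Real.cos_pi]; ring
  have him : (nome z).im = 0 := by
    rw [nome_im, h1, show 2 * Real.pi * (1 / 2) = Real.pi by ring, Real.sin_pi]; ring
  have hs' := abs_im_remS_le hq
  have hd' := abs_im_remD_le hq
  rw [him, abs_zero, mul_zero] at hs' hd'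
  have hs0 : (remS (nome z)).im = 0 := abs_nonpos_iff.mp hs'
  have hd0 : (remD (nome z)).im = 0 := abs_nonpos_iff.mp hd'
  have hs := (Complex.abs_re_le_norm _).trans (norm_remS_le hq)
  have hd := (Complex.abs_re_le_norm _).trans (norm_remD_le hq)
  rw [phiFin_im hz, phiCorr, e6_eq_rem hz, sigD_eq (hq.trans_lt (by norm_num))]
  set r := ‖nome z‖ with hr
  have hqr : nome z = ((-r : ℝ) : ℂ) := Complex.ext (by simp [hre]) (by simp [him])
  have hsr : remS (nome z) = ((remS (nome z)).re : ℂ) :=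
    Complex.ext (by simp) (by simp [hs0])
  have hdr : remD (nome z) = ((remD (nome z)).re : ℂ) :=
    Complex.ext (by simp) (by simp [hd0])
  set s := (remS (nome z)).re
  set d := (remD (nome z)).re
  rw [hsr, hdr, hqr]
  have e : (1 - 504 * (((-r : ℝ) : ℂ) + 33 * ((-r : ℝ) : ℂ) ^ 2 + (s : ℂ))) /
      (168 * Real.pi * (((-r : ℝ) : ℂ) + 66 * ((-r : ℝ) : ℂ) ^ 2 + (d : ℂ)))
      = (((1 - 504 * (-r + 33 * r ^ 2 + s)) / (168 * Real.pi * (-r + 66 * r ^ 2 + d)) : ℝ) : ℂ) := by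
    push_cast; ring
  rw [e, Complex.ofReal_re]
  have hr2 : r ^ 2 ≤ 0.00435 * r := by nlinarith
  have hr3 : r ^ 3 ≤ 0.00435 * r ^ 2 := by nlinarith [pow_pos hqpos 2]
  have hs1 := (abs_le.mp hs).2
  have hd1 := abs_le.mp hd
  have hD : 0 < r - 66 * r ^ 2 - d := by nlinarith [hd1.2]
  have hD' : r - 66 * r ^ 2 - d ≤ r := by nlinarith [hd1.1, pow_pos hqpos 2]
  have hE : 1 + 424 * r ≤ 1 - 504 * (-r + 33 * r ^ 2 + s) := by nlinarith
  have hquot : (1 + 424 * r) / (527.8 * r) ≤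
      (1 - 504 * (-r + 33 * r ^ 2 + s)) / (168 * Real.pi * (r - 66 * r ^ 2 - d)) := by
    apply div_le_div₀ (by nlinarith) hE (by positivity)
    apply mul_le_mul (by linarith) hD' hD.le (by norm_num)
  have hneg : (1 - 504 * (-r + 33 * r ^ 2 + s)) / (168 * Real.pi * (-r + 66 * r ^ 2 + d))
      = -((1 - 504 * (-r + 33 * r ^ 2 + s)) / (168 * Real.pi * (r - 66 * r ^ 2 - d))) := by
    rw [← div_neg]; congr 1; ring
  rw [hneg]
  have hexp : 1 / r = Real.exp (2 * Real.pi * z.im) := by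
    rw [hr, norm_nome, Real.exp_neg, one_div, inv_inv]
  have hq2 : (1 + 424 * r) / (527.8 * r) = (1 / r + 424) / 527.8 := by
    field_simp
  rw [hq2, hexp] at hquot
  -- the convexity bound at the height of the corner of the half triangle
  have hbound : 230 * (2 * Real.pi * z.im - 4.44) ≤ Real.exp (2 * Real.pi * z.im) := by
    have h2 := Real.add_one_le_exp (2 * Real.pi * z.im - 5.44)
    have h3 : Real.exp (2 * Real.pi * z.im)
        = Real.exp 5.44 * Real.exp (2 * Real.pi * z.im - 5.44) := by
      rw [← Real.exp_add]; congr 1; ring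
    rw [h3]
    have h4 := two_pi_mul_gt hz
    exact mul_le_mul lt_exp_const.le (by linarith) (by linarith) (Real.exp_pos _).le
  have hy : 6.283 * z.im ≤ 2 * Real.pi * z.im := by
    have : 0 < z.im := by linarith
    gcongr; linarith
  have hlt : z.im < (Real.exp (2 * Real.pi * z.im) + 424) / 527.8 := by
    rw [lt_div_iff₀ (by norm_num)]
    linarith
  linarith

lemma nome_of_re_eq_zero {z : ℂ} (h : z.re = 0) : nome z = (‖nome z‖ : ℂ) :=
  Complex.ext (by rw [nome_re, h]; simp) (by rw [nome_im, h]; simp)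

lemma qSeries_ofReal (a : ℕ → ℕ) (r : ℝ) :
    qSeries (fun n => (a n : ℂ)) r = ((∑' n, (a n : ℝ) * r ^ n : ℝ) : ℂ) := by
  rw [qSeries, Complex.ofReal_tsum]
  push_cast
  rfl

lemma e6_I : e6 Complex.I = 0 := by
  have h := e6_smul ModularGroup.S UpperHalfPlane.I
  have hS : ModularGroup.S • UpperHalfPlane.I = UpperHalfPlane.I := by
    ext
    rw [smul_eq_div]
    simp [ModularGroup.S]
  rw [hS] at h
  simp only [ModularGroup.S, Matrix.SpecialLinearGroup.coe_mk] at h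
  simp only [Matrix.of_apply, Matrix.cons_val', Matrix.cons_val_zero, Matrix.cons_val_one,
    Matrix.cons_val_fin_one, Int.cast_one, Int.cast_zero, add_zero, one_mul,
    UpperHalfPlane.coe_I] at h
  rw [show Complex.I ^ 6 = -1 by rw [show 6 = 2 * 3 by norm_num, pow_mul, Complex.I_sq]; norm_num]
    at h
  have : (2 : ℂ) * e6 Complex.I = 0 := by linear_combination h
  simpa using this

/-- On the imaginary axis above `i`, `E₆` is nonnegative: it vanishes at `i`, and `1 - E₆` is a
power series in the nome with positive coefficients. -/
lemma e6_nonneg_of_re_eq_zero {z : ℂ} (h : z.re = 0) (hz : 1 ≤ z.im) :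
    ∃ x : ℝ, 0 ≤ x ∧ e6 z = x := by
  have hval : ∀ w : ℂ, w.re = 0 → 0 < w.im → e6 w =
      ((1 - 504 * ∑' n, (ArithmeticFunction.sigma 5 n : ℝ) * ‖nome w‖ ^ n : ℝ) : ℂ) := by
    intro w hw hw'
    rw [e6_eq hw', nome_of_re_eq_zero hw, qSeries_ofReal]
    simp
  have hI := hval Complex.I (by simp) (by simp)
  rw [e6_I, ← Complex.ofReal_zero, Complex.ofReal_inj] at hI
  refine ⟨_, ?_, hval z h (by linarith)⟩
  have hs : ∀ w : ℂ, 0 < w.im →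
      Summable fun n => (ArithmeticFunction.sigma 5 n : ℝ) * ‖nome w‖ ^ n := by
    intro w hw
    have := (PolyGrowth.sigma 5).summable_norm (norm_nome_lt_one hw)
    simpa using this
  have hle : ‖nome z‖ ≤ ‖nome Complex.I‖ := by
    rw [norm_nome, norm_nome, Real.exp_le_exp]
    have := Real.pi_pos
    simp only [Complex.I_im]
    nlinarith
  have := (hs z (by linarith)).tsum_le_tsum (g := fun n =>
    (ArithmeticFunction.sigma 5 n : ℝ) * ‖nome Complex.I‖ ^ n) (fun n => by gcongr)
    (hs _ (by simp))
  linarith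

/-- `φ` maps the left side of the half triangle into the upper half of the imaginary axis. -/
lemma phiFin_of_re_eq_zero {z : ℂ} (h : z.re = 0) (hz : 1 ≤ z.im) :
    (phiFin z).re = 0 ∧ 0 < (phiFin z).im := by
  have hz' : 0.866 < z.im := by norm_num at hz ⊢; linarith
  obtain ⟨x, hx, hxe⟩ := e6_nonneg_of_re_eq_zero h hz
  have hD : ∃ y : ℝ, 0 ≤ y ∧ sigD (nome z) = y := by
    refine ⟨∑' n, ((n * ArithmeticFunction.sigma 5 n : ℕ) : ℝ) * ‖nome z‖ ^ n,
      tsum_nonneg fun n => by positivity, ?_⟩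
    rw [← qSeries_ofReal, ← nome_of_re_eq_zero h, sigD]
    push_cast
    rfl
  obtain ⟨y, hy, hye⟩ := hD
  rw [phiFin_re hz', phiFin_im hz', phiCorr, hxe, hye]
  have e : (x : ℂ) / (168 * Real.pi * y) = ((x / (168 * Real.pi * y) : ℝ) : ℂ) := by
    push_cast; rfl
  rw [e, Complex.ofReal_im, Complex.ofReal_re, h]
  exact ⟨by ring, by positivity⟩

end HalfTriangle

/-! ### The kite formed by two adjacent half triangles -/

section Kite

open ModularForm EisensteinSeries
open scoped ComplexConjugate

/-- The half triangle together with its mirror image in the unit circle: one third of `F0`, with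
cusps `0` and `∞`. -/
def kite : Set ℂ := {z | 0 < z.im ∧ 0 ≤ z.re ∧ z.re ≤ 1 / 2 ∧ 1 ≤ ‖z - 1‖}

/-- The interior of `kite`. -/
def kiteInterior : Set ℂ := {z | 0 < z.im ∧ 0 < z.re ∧ z.re < 1 / 2 ∧ 1 < ‖z - 1‖}

lemma isOpen_kiteInterior : IsOpen kiteInterior := by
  refine (isOpen_lt continuous_const Complex.continuous_im).inter
    ((isOpen_lt continuous_const Complex.continuous_re).inter
    ((isOpen_lt Complex.continuous_re continuous_const).inter
    (isOpen_lt (f := fun _ : ℂ => (1 : ℝ)) (g := fun z : ℂ => ‖z - 1‖) continuous_const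
      (by fun_prop))))

lemma kiteInterior_subset : kiteInterior ⊆ kite := fun _ hz =>
  ⟨hz.1, hz.2.1.le, hz.2.2.1.le, hz.2.2.2.le⟩

lemma norm_sub_one_sq (z : ℂ) : ‖z - 1‖ ^ 2 = ‖z‖ ^ 2 - 2 * z.re + 1 := by
  rw [normSq_eq_re_sq_add_im_sq, normSq_eq_re_sq_add_im_sq]
  simp; ring

lemma one_le_norm_sub_one_iff (z : ℂ) : 1 ≤ ‖z - 1‖ ↔ 2 * z.re ≤ ‖z‖ ^ 2 := by
  rw [← one_le_sq_iff₀ (norm_nonneg _), norm_sub_one_sq]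
  constructor <;> intro h <;> linarith

lemma one_lt_norm_sub_one_iff (z : ℂ) : 1 < ‖z - 1‖ ↔ 2 * z.re < ‖z‖ ^ 2 := by
  rw [← one_lt_sq_iff₀ (norm_nonneg _), norm_sub_one_sq]
  constructor <;> intro h <;> linarith

lemma ne_zero_of_im_pos {z : ℂ} (h : 0 < z.im) : z ≠ 0 := by
  rintro rfl; simp at h

lemma inv_conj_re (z : ℂ) : (conj z)⁻¹.re = z.re / ‖z‖ ^ 2 := by
  rw [Complex.inv_re, Complex.normSq_conj, Complex.normSq_eq_norm_sq, Complex.conj_re]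

lemma inv_conj_im (z : ℂ) : (conj z)⁻¹.im = z.im / ‖z‖ ^ 2 := by
  rw [Complex.inv_im, Complex.normSq_conj, Complex.normSq_eq_norm_sq, Complex.conj_im, neg_neg]

lemma norm_inv_conj (z : ℂ) : ‖(conj z)⁻¹‖ = ‖z‖⁻¹ := by
  rw [norm_inv, RCLike.norm_conj]

lemma inv_conj_inv_conj (z : ℂ) : (conj (conj z)⁻¹)⁻¹ = z := by simp

lemma inv_conj_im_pos {z : ℂ} (hz : 0 < z.im) : 0 < (conj z)⁻¹.im := by
  rw [inv_conj_im]
  have := norm_pos_iff.mpr (ne_zero_of_im_pos hz)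
  positivity

lemma inv_conj_mem_kite {z : ℂ} (hz : z ∈ kite) : (conj z)⁻¹ ∈ kite := by
  obtain ⟨h0, h1, h2, h3⟩ := hz
  have hn : 0 < ‖z‖ ^ 2 := pow_pos (norm_pos_iff.mpr (ne_zero_of_im_pos h0)) 2
  rw [one_le_norm_sub_one_iff] at h3
  refine ⟨inv_conj_im_pos h0, ?_, ?_, ?_⟩
  · rw [inv_conj_re]; positivity
  · rw [inv_conj_re, div_le_iff₀ hn]; linarith
  · rw [one_le_norm_sub_one_iff, inv_conj_re, norm_inv_conj, inv_pow, ← mul_div_assoc,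
      div_eq_mul_inv]
    have := inv_pos.mpr hn
    nlinarith

lemma mem_halfTriangle_or {z : ℂ} (hz : z ∈ kite) :
    z ∈ halfTriangle ∨ (conj z)⁻¹ ∈ halfTriangle := by
  rcases le_total 1 ‖z‖ with h | h
  · exact Or.inl ⟨hz.1, hz.2.1, hz.2.2.1, h⟩
  · obtain ⟨h0, h1, h2, -⟩ := inv_conj_mem_kite hz
    refine Or.inr ⟨h0, h1, h2, ?_⟩
    rw [norm_inv_conj]
    exact (one_le_inv₀ (norm_pos_iff.mpr (ne_zero_of_im_pos hz.1))).mpr h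

lemma halfTriangle_subset_kite : halfTriangle ⊆ kite := by
  rintro z ⟨h0, h1, h2, h3⟩
  refine ⟨h0, h1, h2, ?_⟩
  rw [one_le_norm_sub_one_iff]
  have : 1 ≤ ‖z‖ ^ 2 := one_le_pow₀ h3
  linarith

lemma phiFin_eq_div {z : ℂ} (h : deriv e6 z ≠ 0) : phiFin z = phiNum z / deriv e6 z := by
  rw [phiFin, phiNum]
  field_simp

lemma deriv_e6_ne_zero_of_mem_halfTriangle {z : ℂ} (hz : z ∈ halfTriangle) :
    deriv e6 z ≠ 0 :=
  deriv_e6_ne_zero_of_im_gt (im_gt_of_mem_halfTriangle hz)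

/-- On the half triangle the values of `φ` avoid the real axis except for positive values, taken
in the interior of the strip. -/
lemma phiFin_real_of_mem_halfTriangle {z : ℂ} (hz : z ∈ halfTriangle)
    (h : (phiFin z).im = 0) : 0 < z.re ∧ z.re < 1 / 2 ∧ 0 < (phiFin z).re := by
  have him := im_gt_of_mem_halfTriangle hz
  obtain ⟨h0, h1, h2, h3⟩ := hz
  have hre : 0 < z.re := by
    refine h1.lt_of_ne' fun hre => ?_
    have h4 := normSq_eq_re_sq_add_im_sq z
    have : 1 ≤ z.im := by
      rw [hre] at h4
      nlinarith
    exact (phiFin_of_re_eq_zero hre this).2.ne' h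
  exact ⟨hre, h2.lt_of_ne fun hre' => (phiFin_im_neg him hre').ne h, phiFin_re_pos him hre h2⟩

lemma phiFin_ne_zero_of_mem_halfTriangle {z : ℂ} (hz : z ∈ halfTriangle) : phiFin z ≠ 0 := by
  intro h
  have := (phiFin_real_of_mem_halfTriangle hz (by rw [h]; simp)).2.2
  rw [h] at this
  simp at this

lemma phiNum_ne_zero_of_mem_halfTriangle {z : ℂ} (hz : z ∈ halfTriangle) : phiNum z ≠ 0 := by
  have h := phiFin_ne_zero_of_mem_halfTriangle hz
  rw [phiFin_eq_div (deriv_e6_ne_zero_of_mem_halfTriangle hz)] at h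
  exact fun h0 => h (by rw [h0, zero_div])

lemma deriv_e6_ne_zero_of_mem_kite {z : ℂ} (hz : z ∈ kite) : deriv e6 z ≠ 0 := by
  rcases mem_halfTriangle_or hz with h | h
  · exact deriv_e6_ne_zero_of_mem_halfTriangle h
  · have h1 := deriv_e6_inv_conj h.1
    rw [inv_conj_inv_conj] at h1
    rw [h1, neg_ne_zero, map_ne_zero]
    exact mul_ne_zero (pow_ne_zero _ (ne_zero_of_im_pos h.1))
      (phiNum_ne_zero_of_mem_halfTriangle h)

/-- `φ` commutes with the reflection in the unit circle. -/
lemma phiFin_inv_conj {z : ℂ} (hz : z ∈ kite) : phiFin (conj z)⁻¹ = (conj (phiFin z))⁻¹ := by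
  rw [phiFin_eq_div (deriv_e6_ne_zero_of_mem_kite hz),
    phiFin_eq_div (deriv_e6_ne_zero_of_mem_kite (inv_conj_mem_kite hz)),
    deriv_e6_inv_conj hz.1, phiNum_inv_conj hz.1, neg_div_neg_eq, ← map_div₀, ← map_inv₀,
    inv_div, mul_div_mul_left _ _ (pow_ne_zero _ (ne_zero_of_im_pos hz.1))]

lemma mem_kiteInterior_of_mem_halfTriangle {z : ℂ} (hz : z ∈ halfTriangle) (h0 : 0 < z.re)
    (h1 : z.re < 1 / 2) : z ∈ kiteInterior := by
  refine ⟨hz.1, h0, h1, ?_⟩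
  rw [one_lt_norm_sub_one_iff]
  have : 1 ≤ ‖z‖ ^ 2 := one_le_pow₀ hz.2.2.2
  linarith

lemma inv_conj_mem_kiteInterior {z : ℂ} (hz : z ∈ kiteInterior) :
    (conj z)⁻¹ ∈ kiteInterior := by
  obtain ⟨h0, h1, h2, h3⟩ := hz
  have hn : 0 < ‖z‖ ^ 2 := pow_pos (norm_pos_iff.mpr (ne_zero_of_im_pos h0)) 2
  rw [one_lt_norm_sub_one_iff] at h3
  refine ⟨inv_conj_im_pos h0, ?_, ?_, ?_⟩
  · rw [inv_conj_re]; positivity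
  · rw [inv_conj_re, div_lt_iff₀ hn]; linarith
  · rw [one_lt_norm_sub_one_iff, inv_conj_re, norm_inv_conj, inv_pow, ← mul_div_assoc,
      div_eq_mul_inv]
    have := inv_pos.mpr hn
    nlinarith

/-- In the kite, `φ` takes real values only in the interior, and these values are positive. -/
lemma phiFin_real_of_mem_kite {z : ℂ} (hz : z ∈ kite) (h : (phiFin z).im = 0) :
    z ∈ kiteInterior ∧ 0 < (phiFin z).re := by
  rcases mem_halfTriangle_or hz with ht | ht
  · obtain ⟨h1, h2, h3⟩ := phiFin_real_of_mem_halfTriangle ht h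
    exact ⟨mem_kiteInterior_of_mem_halfTriangle ht h1 h2, h3⟩
  · have hw := phiFin_inv_conj hz
    have hwim : (phiFin (conj z)⁻¹).im = 0 := by rw [hw, inv_conj_im, h, zero_div]
    obtain ⟨h1, h2, h3⟩ := phiFin_real_of_mem_halfTriangle ht hwim
    have h4 := inv_conj_mem_kiteInterior (mem_kiteInterior_of_mem_halfTriangle ht h1 h2)
    rw [inv_conj_inv_conj] at h4
    refine ⟨h4, ?_⟩
    rw [hw, inv_conj_re] at h3
    exact pos_of_mul_pos_left (by rwa [← div_eq_mul_inv]) (by positivity)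

/-- The corner `exp (π i / 3)` of the half triangle. -/
def corner : ℍ := ⟨⟨1 / 2, √3 / 2⟩, by simp⟩

lemma E4_eq_add (τ : ℍ) :
    E₄ τ = 1 + 240 * qSeries (fun n => (ArithmeticFunction.sigma 3 n : ℂ)) (nome τ) := by
  rw [E4_eq_qSeries, qSeries_eisCoeff _ _ (norm_nome_lt_one τ.im_pos)]

lemma E4_corner : E₄ corner = 0 := by
  have hρ : (corner : ℂ) ^ 2 = corner - 1 := by
    have h3 : √3 ^ 2 = 3 := Real.sq_sqrt (by norm_num)
    apply Complex.ext
    · simp [corner, pow_two]; linarith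
    · simp [corner, pow_two]; ring
  have hρ0 : (corner : ℂ) ≠ 0 := ne_zero_of_im_pos corner.im_pos
  have h1 := congrFun (E4_slash ModularGroup.S) corner
  have hS : ((ModularGroup.S • corner : ℍ) : ℂ) = corner - 1 := by
    rw [smul_eq_div]
    simp [ModularGroup.S]
    field_simp
    linear_combination -hρ
  have hnome : nome (ModularGroup.S • corner : ℍ) = nome corner := by
    rw [hS, nome, nome, mul_sub, mul_one, Complex.exp_sub, Complex.exp_two_pi_mul_I, div_one]
  have hE : E₄ (ModularGroup.S • corner) = E₄ corner := by rw [E4_eq_add, E4_eq_add, hnome]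
  rw [SL_slash_apply, hE, denom_eq] at h1
  simp only [ModularGroup.S, Matrix.SpecialLinearGroup.coe_mk] at h1
  simp only [Matrix.of_apply, Matrix.cons_val', Matrix.cons_val_zero, Matrix.cons_val_one,
    Matrix.cons_val_fin_one, Int.cast_one, Int.cast_zero, add_zero, one_mul] at h1
  have h4 : (corner : ℂ) ^ (-4 : ℤ) = (-(corner : ℂ))⁻¹ := by
    rw [zpow_neg]
    congr 1
    have : (corner : ℂ) ^ 4 = -corner := by
      linear_combination ((corner : ℂ) ^ 2 + corner) * hρ
    exact_mod_cast this
  rw [h4, ← div_eq_mul_inv, div_eq_iff (neg_ne_zero.mpr hρ0)] at h1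
  by_contra hne
  have h5 : (1 : ℂ) = -corner := mul_left_cancel₀ hne (by linear_combination h1)
  have := congrArg Complex.im h5
  simp [corner] at this

lemma E4_ne_zero_of_im_gt {τ : ℍ} (h : 0.866 < (τ : ℂ).im) (h0 : 0 < (τ : ℂ).re)
    (h1 : (τ : ℂ).re < 1 / 2) : E₄ τ ≠ 0 := by
  intro hE
  have hc : 0.866 < (corner : ℂ).im := by
    have : (1.7321 : ℝ) > √3 := by
      rw [gt_iff_lt, Real.sqrt_lt' (by norm_num)]; norm_num
    have : (1.7320 : ℝ) < √3 := by
      rw [Real.lt_sqrt (by norm_num)]; norm_num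
    change 0.866 < √3 / 2
    norm_num at this ⊢
    linarith
  have hEc := E4_corner
  rw [E4_eq_add] at hE hEc
  have hq := injOn_sigma_three (norm_nome_le h) (norm_nome_le hc)
    (mul_left_cancel₀ (by norm_num : (240 : ℂ) ≠ 0) (by linear_combination hE - hEc))
  obtain ⟨n, hn⟩ := Complex.exp_eq_exp_iff_exists_int.mp hq
  have h2 : (τ : ℂ) = corner + n :=
    mul_left_cancel₀ Complex.two_pi_I_ne_zero (by linear_combination hn)
  have h3 := congrArg Complex.re h2
  simp only [corner, Complex.add_re, Complex.intCast_re, UpperHalfPlane.coe_re] at h3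
  rw [UpperHalfPlane.coe_re] at h0 h1
  rw [h3] at h0 h1
  have h4 : (-1 : ℝ) < n := by linarith
  have h5 : (n : ℝ) < 0 := by linarith
  norm_cast at h4 h5
  omega

lemma E4_ne_zero_of_mem_kiteInterior {τ : ℍ} (h : (τ : ℂ) ∈ kiteInterior) : E₄ τ ≠ 0 := by
  rcases mem_halfTriangle_or (kiteInterior_subset h) with ht | ht
  · exact E4_ne_zero_of_im_gt (im_gt_of_mem_halfTriangle ht) h.2.1 h.2.2.1
  · intro h0
    have h2 := inv_conj_mem_kiteInterior h
    refine E4_ne_zero_of_im_gt (τ := ⟨(conj (τ : ℂ))⁻¹, h2.1⟩) (im_gt_of_mem_halfTriangle ht)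
      h2.2.1 h2.2.2.1 (E4_inv_conj (σ := τ) ?_ h0)
    exact (inv_conj_inv_conj _).symm

/-- `φ` is locally injective in the interior of the kite: the numerator of `φ'` is a multiple of
`E₄ (E₄ ^ 3 - E₆ ^ 2)`. -/
lemma exists_hasStrictDerivAt_phiFin {z : ℂ} (hz : z ∈ kiteInterior) :
    ∃ c ≠ 0, HasStrictDerivAt phiFin c z := by
  set τ : ℍ := ⟨z, hz.1⟩
  have hne : deriv e6 τ ≠ 0 := deriv_e6_ne_zero_of_mem_kite (kiteInterior_subset hz)
  have h := hasDerivAt_phiFin hne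
  have hΔ := discriminant_ne_zero τ
  rw [discriminant_eq_E₄_cube_sub_E₆_sq] at hΔ
  have hΔ' : E₄ τ ^ 3 - E₆ τ ^ 2 ≠ 0 := fun h0 => hΔ (by rw [h0, zero_div])
  have hE4 := E4_ne_zero_of_mem_kiteInterior (τ := τ) hz
  have hX : E2 τ * E₆ τ - E₄ τ ^ 2 ≠ 0 := by
    rw [deriv_e6] at hne
    exact fun h0 => hne (by rw [h0, mul_zero])
  refine ⟨7 * phiDerivNum τ / (E2 τ * E₆ τ - E₄ τ ^ 2) ^ 2, ?_, ?_⟩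
  · rw [phiDerivNum]
    exact div_ne_zero (mul_ne_zero (by norm_num) (mul_ne_zero hE4 hΔ')) (pow_ne_zero _ hX)
  · have ha : AnalyticAt ℂ phiFin z :=
      analyticAt_id.add ((analyticAt_const.mul (analyticAt_e6 hz.1)).div
        (analyticAt_e6 hz.1).deriv hne)
    have h2 := ha.hasStrictDerivAt
    rwa [h.deriv] at h2

lemma analyticAt_phiFin {z : ℂ} (hz : z ∈ kite) : AnalyticAt ℂ phiFin z :=
  analyticAt_id.add ((analyticAt_const.mul (analyticAt_e6 hz.1)).div
    (analyticAt_e6 hz.1).deriv (deriv_e6_ne_zero_of_mem_kite hz))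

end Kite

/-! ### Behaviour of `φ` at the cusp `i ∞` -/

section Cusp

open ModularForm EisensteinSeries
open scoped ComplexConjugate

/-- The filter of neighbourhoods of `i ∞` in the plane. -/
def atImTop : Filter ℂ := comap Complex.im atTop

lemma eventually_atImTop {p : ℂ → Prop} :
    (∀ᶠ z in atImTop, p z) ↔ ∃ Y, ∀ z : ℂ, Y < z.im → p z := by
  have h : atImTop.HasBasis (fun _ : ℝ => True) fun Y => Complex.im ⁻¹' Ioi Y :=
    (atTop_basis_Ioi).comap _
  simp [h.eventually_iff]

lemma eventually_lt_im (Y : ℝ) : ∀ᶠ z : ℂ in atImTop, Y < z.im :=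
  eventually_atImTop.mpr ⟨Y, fun _ h => h⟩

lemma tendsto_nome : Tendsto nome atImTop (𝓝[≠] 0) := by
  refine tendsto_nhdsWithin_iff.mpr ⟨?_, Eventually.of_forall nome_ne_zero⟩
  rw [tendsto_zero_iff_norm_tendsto_zero]
  simp only [norm_nome]
  refine Real.tendsto_exp_neg_atTop_nhds_zero.comp ?_
  exact (tendsto_comap).const_mul_atTop (by positivity)

lemma PolyGrowth.tendsto_div {a : ℕ → ℂ} (ha : PolyGrowth a) (h0 : a 0 = 0) :
    Tendsto (fun q => qSeries a q / q) (𝓝[≠] 0) (𝓝 (a 1)) := by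
  have h := hasDerivAt_iff_tendsto_slope.mp (ha.hasDerivAt (q := 0) (by simp))
  have h1 : (∑' n : ℕ, a n * (n * (0 : ℂ) ^ (n - 1))) = a 1 := by
    rw [tsum_eq_single 1]
    · simp
    · intro n hn
      rcases Nat.lt_or_gt_of_ne hn with h | h
      · simp [Nat.lt_one_iff.mp h]
      · rw [zero_pow (by omega)]; simp
  rw [h1] at h
  refine h.congr fun q => ?_
  rw [slope_def_field, qSeries_zero, h0, sub_zero, sub_zero]

lemma PolyGrowth.tendsto_zero {a : ℕ → ℂ} (ha : PolyGrowth a) (h0 : a 0 = 0) :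
    Tendsto (qSeries a) (𝓝[≠] 0) (𝓝 0) := by
  have h : ContinuousAt (qSeries a) 0 := (ha.hasDerivAt (q := 0) (by simp)).continuousAt
  have h2 := h.tendsto
  rw [qSeries_zero, h0] at h2
  exact h2.mono_left nhdsWithin_le_nhds

lemma tendsto_sigma_div (j : ℕ) :
    Tendsto (fun z => qSeries (fun n => (ArithmeticFunction.sigma j n : ℂ)) (nome z) / nome z)
      atImTop (𝓝 1) := by
  have := ((PolyGrowth.sigma j).tendsto_div (by simp)).comp tendsto_nome
  simpa [Function.comp_def] using this

lemma tendsto_sigma_zero (j : ℕ) :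
    Tendsto (fun z => qSeries (fun n => (ArithmeticFunction.sigma j n : ℂ)) (nome z))
      atImTop (𝓝 0) :=
  ((PolyGrowth.sigma j).tendsto_zero (by simp)).comp tendsto_nome

lemma norm_mul_nome_le {z : ℂ} (h0 : 0 ≤ z.re) (h1 : z.re ≤ 1 / 2) (hz : 1 ≤ z.im) :
    ‖z * nome z‖ ≤ 2 * (z.im ^ 1 * Real.exp (-z.im)) := by
  rw [norm_mul, norm_nome, pow_one, ← mul_assoc]
  have h2 : ‖z‖ ≤ 2 * z.im := by
    refine (Complex.norm_le_abs_re_add_abs_im z).trans ?_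
    rw [abs_of_nonneg h0, abs_of_nonneg (by linarith)]
    linarith
  have := Real.pi_gt_three
  gcongr
  nlinarith

/-- In the strip, `φ(z) q` tends to `i / (168 π)` at the cusp. -/
lemma tendsto_phiFin_mul_nome :
    Tendsto (fun z => phiFin z * nome z) (atImTop ⊓ 𝓟 {z : ℂ | 0 ≤ z.re ∧ z.re ≤ 1 / 2})
      (𝓝 (Complex.I / (168 * Real.pi))) := by
  have h1 : Tendsto (fun z : ℂ => z * nome z) (atImTop ⊓ 𝓟 {z : ℂ | 0 ≤ z.re ∧ z.re ≤ 1 / 2})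
      (𝓝 0) := by
    have h2 : Tendsto (fun z : ℂ => 2 * (z.im ^ 1 * Real.exp (-z.im)))
        (atImTop ⊓ 𝓟 {z : ℂ | 0 ≤ z.re ∧ z.re ≤ 1 / 2}) (𝓝 0) := by
      have := (Real.tendsto_pow_mul_exp_neg_atTop_nhds_zero 1).const_mul 2
      rw [mul_zero] at this
      exact this.comp (tendsto_comap.mono_left inf_le_left)
    refine squeeze_zero_norm' ?_ h2
    rw [eventually_inf_principal]
    filter_upwards [eventually_lt_im 1] with z hz hz'
    exact norm_mul_nome_le hz'.1 hz'.2 hz.le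
  have hpi : (Real.pi : ℂ) ≠ 0 := by exact_mod_cast Real.pi_ne_zero
  have h3 : Tendsto (fun z => Complex.I * (1 - 504 * sigS (nome z)) /
      (168 * Real.pi * (sigD (nome z) / nome z))) atImTop
      (𝓝 (Complex.I * (1 - 504 * 0) / (168 * Real.pi * 1))) := by
    refine ((((tendsto_sigma_zero 5).const_mul 504).const_sub 1).const_mul _).div
      (Tendsto.const_mul _ ?_) (by simp [hpi])
    have := ((PolyGrowth.sigma 5).natCast_mul.tendsto_div (by simp)).comp tendsto_nome
    simpa [Function.comp_def, sigD] using this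
  have h4 := h1.add (h3.mono_left (inf_le_left (b := 𝓟 {z : ℂ | 0 ≤ z.re ∧ z.re ≤ 1 / 2})))
  rw [mul_zero, sub_zero, mul_one, mul_one, zero_add] at h4
  refine h4.congr' (Eventually.filter_mono inf_le_left ?_)
  filter_upwards [eventually_lt_im 0.866] with z hz
  have h := sigD_ne_zero (norm_nome_le hz) (nome_ne_zero z)
  have hq := nome_ne_zero z
  rw [phiFin_eq hz, phiCorr, e6_eq (by linarith), ← sigS]
  field_simp

lemma I_div_ne_zero : Complex.I / (168 * Real.pi) ≠ 0 := by
  have hpi : (Real.pi : ℂ) ≠ 0 := by exact_mod_cast Real.pi_ne_zero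
  simp [hpi]

/-- In the strip, `φ` is unbounded at the cusp. -/
lemma exists_lt_norm_phiFin (B : ℝ) :
    ∃ Y, ∀ z : ℂ, 0 ≤ z.re → z.re ≤ 1 / 2 → Y < z.im → B < ‖phiFin z‖ := by
  have h1 := tendsto_phiFin_mul_nome.norm
  have h2 := tendsto_norm_nhdsNE_zero.comp
    (tendsto_nome.mono_left (inf_le_left (b := 𝓟 {z : ℂ | 0 ≤ z.re ∧ z.re ≤ 1 / 2})))
  have h3 := h1.pos_mul_atTop (norm_pos_iff.mpr I_div_ne_zero) h2.inv_tendsto_nhdsGT_zero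
  have h4 := h3.eventually_gt_atTop B
  rw [eventually_inf_principal, eventually_atImTop] at h4
  obtain ⟨Y, hY⟩ := h4
  refine ⟨Y, fun z hz0 hz1 hz => ?_⟩
  have := hY z hz ⟨hz0, hz1⟩
  simp only [Pi.inv_apply, Function.comp_apply, norm_mul] at this
  rwa [mul_inv_cancel_right₀ (norm_ne_zero_iff.mpr (nome_ne_zero z))] at this

/-- The points of the strip with positive value of `φ` approach the line `Re z = 1 / 4`, where
the nome is a positive multiple of `i`. -/
lemma exists_abs_re_sub_lt {ε : ℝ} (hε : 0 < ε) :
    ∃ Y, ∀ z : ℂ, 0 ≤ z.re → z.re ≤ 1 / 2 → Y < z.im → (phiFin z).im = 0 → 0 < (phiFin z).re →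
      |z.re - 1 / 4| < ε := by
  have hpi := Real.pi_pos
  have h1 := tendsto_phiFin_mul_nome
  have h2 : Tendsto (fun z => Real.arccos ((phiFin z * nome z).re / ‖phiFin z * nome z‖))
      (atImTop ⊓ 𝓟 {z : ℂ | 0 ≤ z.re ∧ z.re ≤ 1 / 2}) (𝓝 (2 * Real.pi * (1 / 4))) := by
    have h3 := ((Complex.continuous_re.tendsto _).comp h1).div h1.norm
      (norm_ne_zero_iff.mpr I_div_ne_zero)
    have h4 := (Real.continuous_arccos.tendsto _).comp h3
    have e : (Complex.I / (168 * Real.pi)).re = 0 := by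
      have : Complex.I / (168 * Real.pi) = Complex.I * ((1 / (168 * Real.pi) : ℝ) : ℂ) := by
        push_cast; ring
      rw [this]; simp
    rw [e, zero_div, Real.arccos_zero] at h4
    rw [show 2 * Real.pi * (1 / 4) = Real.pi / 2 by ring]
    exact h4
  have h5 := Metric.tendsto_nhds.mp h2 (2 * Real.pi * ε) (by positivity)
  rw [eventually_inf_principal, eventually_atImTop] at h5
  obtain ⟨Y, hY⟩ := h5
  refine ⟨Y, fun z hz0 hz1 hz him hre => ?_⟩
  have h6 := hY z hz ⟨hz0, hz1⟩
  have hx : phiFin z = ((phiFin z).re : ℂ) := Complex.ext (by simp) (by simp [him])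
  have hn : 0 < ‖nome z‖ := norm_pos_iff.mpr (nome_ne_zero z)
  have hcos : (phiFin z * nome z).re / ‖phiFin z * nome z‖ = Real.cos (2 * Real.pi * z.re) := by
    rw [hx, Complex.re_ofReal_mul, norm_mul, nome_re, Complex.norm_real,
      Real.norm_of_nonneg hre.le]
    field_simp
  rw [hcos, Real.arccos_cos (by positivity) (by nlinarith), Real.dist_eq, ← mul_sub, abs_mul,
    abs_of_pos (by positivity : 0 < 2 * Real.pi)] at h6
  exact lt_of_mul_lt_mul_left h6 (by positivity)

lemma E2_eq_add {z : ℂ} (hz : 0 < z.im) :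
    E2 ⟨z, hz⟩ = 1 - 24 * qSeries (fun n => (ArithmeticFunction.sigma 1 n : ℂ)) (nome z) := by
  rw [E2_eq_qSeries, qSeries_eisCoeff _ _ (norm_nome_lt_one hz)]; ring

lemma E6_eq_add {z : ℂ} (hz : 0 < z.im) :
    E₆ ⟨z, hz⟩ = 1 - 504 * qSeries (fun n => (ArithmeticFunction.sigma 5 n : ℂ)) (nome z) := by
  rw [E6_eq_qSeries, qSeries_eisCoeff _ _ (norm_nome_lt_one hz)]; ring

lemma tendsto_deriv_phiFin_mul_nome :
    Tendsto (fun z => deriv phiFin z * nome z) atImTop (𝓝 (1 / 84)) := by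
  set s2 := fun z => qSeries (fun n => (ArithmeticFunction.sigma 1 n : ℂ)) (nome z)
  set s4 := fun z => qSeries (fun n => (ArithmeticFunction.sigma 3 n : ℂ)) (nome z)
  set s6 := fun z => qSeries (fun n => (ArithmeticFunction.sigma 5 n : ℂ)) (nome z)
  have t2 : Tendsto (fun z => s2 z / nome z) atImTop (𝓝 1) := tendsto_sigma_div 1
  have t4 : Tendsto (fun z => s4 z / nome z) atImTop (𝓝 1) := tendsto_sigma_div 3
  have t6 : Tendsto (fun z => s6 z / nome z) atImTop (𝓝 1) := tendsto_sigma_div 5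
  have u4 : Tendsto s4 atImTop (𝓝 0) := tendsto_sigma_zero 3
  have u6 : Tendsto s6 atImTop (𝓝 0) := tendsto_sigma_zero 5
  have hΔ : Tendsto (fun z => s4 z / nome z * (720 + 3 * 240 ^ 2 * s4 z + 240 ^ 3 * s4 z ^ 2)
      + s6 z / nome z * (1008 - 504 ^ 2 * s6 z)) atImTop
      (𝓝 (1 * (720 + 3 * 240 ^ 2 * 0 + 240 ^ 3 * 0 ^ 2) + 1 * (1008 - 504 ^ 2 * 0))) :=
    (t4.mul ((tendsto_const_nhds.add (u4.const_mul _)).add ((u4.pow 2).const_mul _))).add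
      (t6.mul (tendsto_const_nhds.sub (u6.const_mul _)))
  have hX : Tendsto (fun z => s2 z / nome z * (-24 + 24 * 504 * s6 z) - 504 * (s6 z / nome z)
      - s4 z / nome z * (480 + 240 ^ 2 * s4 z)) atImTop
      (𝓝 (1 * (-24 + 24 * 504 * 0) - 504 * 1 - 1 * (480 + 240 ^ 2 * 0))) :=
    ((t2.mul (tendsto_const_nhds.add (u6.const_mul _))).sub (t6.const_mul _)).sub
      (t4.mul (tendsto_const_nhds.add (u4.const_mul _)))
  have h := (((tendsto_const_nhds (x := (1 : ℂ))).add (u4.const_mul 240)).mul hΔ).const_mul 7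
    |>.div (hX.pow 2) (by norm_num)
  have e : (7 * ((1 + 240 * 0) * (1 * (720 + 3 * 240 ^ 2 * 0 + 240 ^ 3 * 0 ^ 2)
      + 1 * (1008 - 504 ^ 2 * 0))) /
      (1 * (-24 + 24 * 504 * 0) - 504 * 1 - 1 * (480 + 240 ^ 2 * 0)) ^ 2 : ℂ) = 1 / 84 := by
    norm_num
  rw [e] at h
  refine h.congr' ?_
  filter_upwards [eventually_lt_im 0.866] with z hz
  have hz0 : 0 < z.im := by linarith
  have hd := (hasDerivAt_phiFin (τ := ⟨z, hz0⟩) (deriv_e6_ne_zero_of_im_gt hz)).deriv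
  have hq := nome_ne_zero z
  have hX0 := deriv_e6_ne_zero_of_im_gt hz
  have hX1 := deriv_e6 ⟨z, hz0⟩
  simp only at hd hX1
  rw [hX1] at hX0
  rw [phiDerivNum] at hd
  have e4 : E₄ ⟨z, hz0⟩ = 1 + 240 * s4 z := E4_eq_add ⟨z, hz0⟩
  have e6' : E₆ ⟨z, hz0⟩ = 1 - 504 * s6 z := E6_eq_add hz0
  have e2 : E2 ⟨z, hz0⟩ = 1 - 24 * s2 z := E2_eq_add hz0
  rw [hd, e4, e6', e2]
  have hX2 := right_ne_zero_of_mul hX0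
  rw [e4, e6', e2] at hX2
  have e1 : s4 z / nome z * (720 + 3 * 240 ^ 2 * s4 z + 240 ^ 3 * s4 z ^ 2)
      + s6 z / nome z * (1008 - 504 ^ 2 * s6 z)
      = ((1 + 240 * s4 z) ^ 3 - (1 - 504 * s6 z) ^ 2) / nome z := by
    field_simp; ring
  have e3 : s2 z / nome z * (-24 + 24 * 504 * s6 z) - 504 * (s6 z / nome z)
      - s4 z / nome z * (480 + 240 ^ 2 * s4 z)
      = ((1 - 24 * s2 z) * (1 - 504 * s6 z) - (1 + 240 * s4 z) ^ 2) / nome z := by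
    field_simp; ring
  simp only [Pi.div_apply]
  rw [e1, e3]
  field_simp

/-- A holomorphic function on a convex set is injective when its derivative takes values in the
lower half plane. -/
lemma injOn_of_deriv_im_neg {f : ℂ → ℂ} {s : Set ℂ} (hs : Convex ℝ s)
    (hf : ∀ z ∈ s, DifferentiableAt ℂ f z) (hf' : ∀ z ∈ s, (deriv f z).im < 0) : InjOn f s := by
  intro z hz w hw hzw
  by_contra hne
  have hsub : w - z ≠ 0 := sub_ne_zero.mpr (Ne.symm hne)
  have hmem : ∀ t ∈ Icc (0 : ℝ) 1, z + t * (w - z) ∈ s := fun t ht => by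
    have := hs.add_smul_sub_mem hz hw ht
    simpa using this
  have hd : ∀ t ∈ Icc (0 : ℝ) 1, HasDerivAt (fun t : ℝ => (f (z + t * (w - z)) / (w - z)).im)
      (deriv f (z + t * (w - z))).im t := fun t ht => by
    have h1 : HasDerivAt (fun u : ℂ => z + u * (w - z)) (w - z) (t : ℂ) := by
      simpa using ((hasDerivAt_id (t : ℂ)).mul_const (w - z)).const_add z
    have h2 := ((hf _ (hmem t ht)).hasDerivAt.comp (t : ℂ) h1).div_const (w - z)
    have h3 := h2.comp_ofReal
    rw [mul_div_assoc, div_self hsub, mul_one] at h3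
    exact (Complex.imCLM.hasFDerivAt.comp_hasDerivAt t h3)
  obtain ⟨t, ht, ht'⟩ := exists_hasDerivAt_eq_zero (zero_lt_one' ℝ)
    (fun t ht => (hd t ht).continuousAt.continuousWithinAt)
    (by simp [hzw]) fun t ht => hd t (Ioo_subset_Icc_self ht)
  exact (hf' _ (hmem t (Ioo_subset_Icc_self ht))).ne ht'

/-- Near the cusp `φ` is injective around the line `Re z = 1 / 4`. -/
lemma exists_injOn_phiFin :
    ∃ Y, InjOn phiFin {z | (1 / 8 ≤ z.re ∧ z.re ≤ 3 / 8) ∧ Y < z.im} := by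
  have h1 := Metric.tendsto_nhds.mp tendsto_deriv_phiFin_mul_nome (1 / 400) (by norm_num)
  obtain ⟨Y, hY⟩ := eventually_atImTop.mp (h1.and (eventually_lt_im 0.866))
  refine ⟨Y, injOn_of_deriv_im_neg ?_ ?_ ?_⟩
  · exact ((convex_halfSpace_re_ge _).inter (convex_halfSpace_re_le _)).inter
      (convex_halfSpace_im_gt _)
  · rintro z ⟨-, hz⟩
    have hz' := (hY z hz).2
    exact (hasDerivAt_phiFin (τ := ⟨z, by linarith⟩)
      (deriv_e6_ne_zero_of_im_gt hz')).differentiableAt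
  · rintro z ⟨⟨hz1, hz2⟩, hz⟩
    have hpi := Real.pi_pos
    have hd := (hY z hz).1
    rw [dist_eq_norm] at hd
    set G := deriv phiFin z * nome z with hG
    have hre := (Complex.abs_re_le_norm _).trans_lt hd
    have him := (Complex.abs_im_le_norm _).trans_lt hd
    have e1 : (1 / 84 : ℂ) = ((1 / 84 : ℝ) : ℂ) := by push_cast; rfl
    rw [e1, Complex.sub_re, Complex.ofReal_re] at hre
    rw [e1, Complex.sub_im, Complex.ofReal_im, sub_zero] at him
    have hn : 0 < ‖nome z‖ := norm_pos_iff.mpr (nome_ne_zero z)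
    have hsin : 1 / 2 < Real.sin (2 * Real.pi * z.re) := by
      rw [← Real.cos_sub_pi_div_two, ← Real.cos_pi_div_three, ← Real.cos_abs (_ - _)]
      apply Real.cos_lt_cos_of_nonneg_of_le_pi_div_two (abs_nonneg _) (by linarith)
      rw [abs_lt]
      constructor <;> nlinarith
    have hmul : (deriv phiFin z).im * ‖nome z‖ ^ 2 = (G * conj (nome z)).im := by
      rw [hG, mul_assoc, Complex.mul_conj, Complex.normSq_eq_norm_sq, Complex.im_mul_ofReal]
    rw [Complex.mul_im, Complex.conj_re, Complex.conj_im, nome_re, nome_im] at hmul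
    have hcos := Real.abs_cos_le_one (2 * Real.pi * z.re)
    have h3 : G.im * Real.cos (2 * Real.pi * z.re) ≤ 1 / 400 := by
      refine (le_abs_self _).trans ?_
      rw [abs_mul]
      calc _ ≤ 1 / 400 * 1 := mul_le_mul him.le hcos (abs_nonneg _) (by norm_num)
        _ = _ := by norm_num
    have h4 : 1 / 200 < G.re := by
      have := (abs_lt.mp hre).1
      linarith
    have h5 : 1 / 400 < G.re * Real.sin (2 * Real.pi * z.re) := by nlinarith
    have h6 : (deriv phiFin z).im * ‖nome z‖ ^ 2 < 0 := by
      rw [hmul]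
      nlinarith
    exact lt_of_not_ge fun hc => h6.not_ge (mul_nonneg hc (by positivity))

end Cusp

/-! ### The real level curve of `φ` in the kite -/

section Curve

open scoped ComplexConjugate

lemma exists_local_section {z₀ : ℂ} (hz : z₀ ∈ kiteInterior) :
    ∃ g : ℂ → ℂ, ContDiffAt ℂ (⊤ : ℕ∞) g (phiFin z₀) ∧ g (phiFin z₀) = z₀ ∧
      (∀ᶠ w in 𝓝 (phiFin z₀), phiFin (g w) = w) ∧ ∀ᶠ z in 𝓝 z₀, g (phiFin z) = z := by
  obtain ⟨c, hc, h⟩ := exists_hasStrictDerivAt_phiFin hz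
  have hn : ((⊤ : ℕ∞) : WithTop ℕ∞) ≠ 0 := by simp
  have hcd : ContDiffAt ℂ (⊤ : ℕ∞) phiFin z₀ := (analyticAt_phiFin (kiteInterior_subset hz)).contDiffAt
  have hf := (h.hasStrictFDerivAt_equiv hc)
  exact ⟨hcd.localInverse hf.hasFDerivAt hn, hcd.to_localInverse hf.hasFDerivAt hn,
    hcd.localInverse_apply_image hf.hasFDerivAt hn, hf.eventually_right_inverse,
    hf.eventually_left_inverse⟩

lemma continuousOn_phiFin : ContinuousOn phiFin kite := fun _ hz =>
  (analyticAt_phiFin hz).continuousAt.continuousWithinAt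

/-- The part of the half triangle below a given height. -/
def truncatedTriangle (Y : ℝ) : Set ℂ := halfTriangle ∩ {z | z.im ≤ Y}

lemma isCompact_truncatedTriangle (Y : ℝ) : IsCompact (truncatedTriangle Y) := by
  have h : truncatedTriangle Y = (Icc (0 : ℝ) (1 / 2) ×ℂ Icc 0.866 Y) ∩ {z | 1 ≤ ‖z‖} := by
    ext z
    constructor
    · rintro ⟨hz, hY⟩
      exact ⟨⟨⟨hz.2.1, hz.2.2.1⟩, ⟨(im_gt_of_mem_halfTriangle hz).le, hY⟩⟩, hz.2.2.2⟩
    · rintro ⟨⟨h1, h2⟩, h3⟩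
      exact ⟨⟨lt_of_lt_of_le (by norm_num) h2.1, h1.1, h1.2, h3⟩, h2.2⟩
  rw [h]
  exact (isCompact_Icc.reProdIm isCompact_Icc).inter_right
    (isClosed_le continuous_const continuous_norm)

lemma truncatedTriangle_subset (Y : ℝ) : truncatedTriangle Y ⊆ kite :=
  inter_subset_left.trans halfTriangle_subset_kite

lemma isCompact_image_truncatedTriangle (Y : ℝ) : IsCompact (phiFin '' truncatedTriangle Y) :=
  (isCompact_truncatedTriangle Y).image_of_continuousOn
    (continuousOn_phiFin.mono (truncatedTriangle_subset Y))

/-- As a map from the kite to the punctured plane, `φ` is proper. -/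
lemma exists_isCompact_kite (B : ℝ) :
    ∃ K ⊆ kite, IsCompact K ∧ ∀ z ∈ kite, B⁻¹ ≤ ‖phiFin z‖ → ‖phiFin z‖ ≤ B → 0 < B → z ∈ K := by
  obtain ⟨Y, hY⟩ := exists_lt_norm_phiFin B
  have key : ∀ z ∈ halfTriangle, ‖phiFin z‖ ≤ B → z ∈ truncatedTriangle Y := fun z hz h => by
    refine ⟨hz, ?_⟩
    by_contra hc
    exact (hY z hz.2.1 hz.2.2.1 (not_le.mp hc)).not_ge h
  have hsub := truncatedTriangle_subset Y
  refine ⟨truncatedTriangle Y ∪ (fun z => (conj z)⁻¹) '' truncatedTriangle Y, ?_, ?_, ?_⟩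
  · refine union_subset hsub ?_
    rintro _ ⟨z, hz, rfl⟩
    exact inv_conj_mem_kite (hsub hz)
  · refine (isCompact_truncatedTriangle Y).union
      ((isCompact_truncatedTriangle Y).image_of_continuousOn ?_)
    refine Complex.continuous_conj.continuousOn.inv₀ fun z hz => ?_
    rw [map_ne_zero]
    exact ne_zero_of_im_pos (hsub hz).1
  · intro z hz h1 h2 hB
    rcases mem_halfTriangle_or hz with ht | ht
    · exact Or.inl (key z ht h2)
    · refine Or.inr ⟨_, key _ ht ?_, inv_conj_inv_conj z⟩
      rw [phiFin_inv_conj hz, norm_inv_conj]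
      exact inv_le_of_inv_le₀ hB h1

lemma exists_le_norm_phiFin : ∃ δ > 0, ∀ z ∈ halfTriangle, δ ≤ ‖phiFin z‖ := by
  obtain ⟨Y, hY⟩ := exists_lt_norm_phiFin 1
  have h0 : (0 : ℂ) ∈ (phiFin '' truncatedTriangle Y)ᶜ := by
    rintro ⟨z, hz, h⟩
    exact phiFin_ne_zero_of_mem_halfTriangle hz.1 h
  obtain ⟨ε, hε, hb⟩ := Metric.isOpen_iff.mp
    (isCompact_image_truncatedTriangle Y).isClosed.isOpen_compl 0 h0
  refine ⟨min ε 1, by positivity, fun z hz => ?_⟩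
  rcases le_or_gt z.im Y with h | h
  · by_contra! hc
    exact hb (mem_ball_zero_iff.mpr (hc.trans_le (min_le_left _ _)))
      (mem_image_of_mem _ ⟨hz, h⟩)
  · exact (min_le_right _ _).trans (hY z hz.2.1 hz.2.2.1 h).le

/-- Points of the kite with a large value of `φ` are close to `i ∞`. -/
lemma exists_im_gt_of_lt_norm_phiFin (Y : ℝ) :
    ∃ B, ∀ z ∈ kite, B < ‖phiFin z‖ → z ∈ halfTriangle ∧ Y < z.im := by
  obtain ⟨δ, hδ, h1⟩ := exists_le_norm_phiFin
  obtain ⟨B, hB⟩ := (isCompact_image_truncatedTriangle Y).isBounded.exists_norm_le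
  refine ⟨max B δ⁻¹, fun z hz h => ?_⟩
  have hz' : z ∈ halfTriangle := by
    refine (mem_halfTriangle_or hz).resolve_right fun ht => ?_
    have h2 := h1 _ ht
    rw [phiFin_inv_conj hz, norm_inv_conj] at h2
    have h3 : 0 < ‖phiFin z‖ := (inv_pos.mpr hδ).trans_le ((le_max_right _ _).trans h.le)
    have h4 := (le_inv_comm₀ hδ h3).mp h2
    exact (h4.trans (le_max_right _ _)).not_gt h
  refine ⟨hz', ?_⟩
  by_contra! hc
  exact ((hB _ (mem_image_of_mem _ ⟨hz', hc⟩)).trans (le_max_left _ _)).not_gt h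

lemma mem_kiteInterior_of_phiFin_eq {z : ℂ} (hz : z ∈ kite) {C : ℝ} (h : phiFin z = C) :
    z ∈ kiteInterior :=
  (phiFin_real_of_mem_kite hz (by rw [h, Complex.ofReal_im])).1

/-- Values of `φ` near a real value taken at `z` are taken near `z`. -/
lemma eventually_exists_phiFin_eq {z : ℂ} (hz : z ∈ kite) {C : ℝ} (h : phiFin z = C)
    {s : Set ℂ} (hs : s ∈ 𝓝 z) :
    ∀ᶠ t : ℝ in 𝓝 C, ∃ w ∈ s ∩ kite, phiFin w = t := by
  have hzi := mem_kiteInterior_of_phiFin_eq hz h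
  obtain ⟨c, hc, hd⟩ := exists_hasStrictDerivAt_phiFin hzi
  have h1 : phiFin '' (s ∩ kiteInterior) ∈ 𝓝 ((C : ℝ) : ℂ) := by
    rw [← h, ← hd.map_nhds_eq hc]
    exact image_mem_map (inter_mem hs (isOpen_kiteInterior.mem_nhds hzi))
  filter_upwards [Complex.continuous_ofReal.continuousAt.preimage_mem_nhds h1] with t ht
  obtain ⟨w, hw, hwt⟩ := ht
  exact ⟨w, ⟨hw.1, kiteInterior_subset hw.2⟩, hwt⟩

lemma exists_phiFin_eq_pos : ∃ z ∈ kite, ∃ C : ℝ, 0 < C ∧ phiFin z = C := by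
  have hmem : ∀ x ∈ Icc (0 : ℝ) (1 / 2), (⟨x, 2⟩ : ℂ) ∈ halfTriangle := fun x hx => by
    refine ⟨by norm_num, hx.1, hx.2, ?_⟩
    exact (by norm_num : (1 : ℝ) ≤ |(⟨x, 2⟩ : ℂ).im|).trans (Complex.abs_im_le_norm _)
  have hc : ContinuousOn (fun x : ℝ => (phiFin ⟨x, 2⟩).im) (Icc 0 (1 / 2)) := by
    refine Complex.continuous_im.comp_continuousOn (continuousOn_phiFin.comp ?_ fun x hx =>
      halfTriangle_subset_kite (hmem x hx))
    have : (fun x : ℝ => (⟨x, 2⟩ : ℂ)) = fun x : ℝ => (x : ℂ) + 2 * Complex.I := by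
      funext x
      apply Complex.ext <;> simp
    rw [this]
    fun_prop
  have h0 := (phiFin_of_re_eq_zero (z := ⟨0, 2⟩) rfl (by norm_num)).2
  have h1 := phiFin_im_neg (z := ⟨1 / 2, 2⟩) (by norm_num) rfl
  obtain ⟨x, hx, hx0⟩ := intermediate_value_Icc' (by norm_num) hc ⟨h1.le, h0.le⟩
  have hk := halfTriangle_subset_kite (hmem x hx)
  exact ⟨_, hk, (phiFin ⟨x, 2⟩).re, (phiFin_real_of_mem_kite hk hx0).2,
    Complex.ext (by simp) (by simpa using hx0)⟩

lemma exists_eventually_norm_mem {C : ℝ} (hC : 0 < C) :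
    ∃ B > 0, ∀ᶠ t : ℝ in 𝓝 C, B⁻¹ ≤ ‖(t : ℂ)‖ ∧ ‖(t : ℂ)‖ ≤ B := by
  refine ⟨max (2 * C) (2 / C), by positivity, ?_⟩
  filter_upwards [Ioo_mem_nhds (half_lt_self hC) (by linarith : C < 2 * C)] with t ht
  have ht0 : 0 < t := (half_pos hC).trans ht.1
  rw [Complex.norm_real, Real.norm_of_nonneg ht0.le]
  refine ⟨?_, ht.2.le.trans (le_max_left _ _)⟩
  rw [inv_le_comm₀ (by positivity) ht0]
  refine le_trans ?_ (le_max_right _ _)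
  rw [inv_le_comm₀ ht0 (by positivity), inv_div]
  exact ht.1.le

/-- The values of `φ` at points of `K` form a closed set of reals. -/
lemma eventually_forall_phiFin_ne {K : Set ℂ} (hK : IsCompact K) (hsub : K ⊆ kite) {C : ℝ}
    (h : ∀ z ∈ K, phiFin z ≠ C) : ∀ᶠ t : ℝ in 𝓝 C, ∀ z ∈ K, phiFin z ≠ t := by
  have h1 : (phiFin '' K)ᶜ ∈ 𝓝 (C : ℂ) := by
    refine (hK.image_of_continuousOn (continuousOn_phiFin.mono hsub)).isClosed.isOpen_compl.mem_nhds
      ?_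
    rintro ⟨z, hz, hzC⟩
    exact h z hz hzC
  filter_upwards [Complex.continuous_ofReal.continuousAt.preimage_mem_nhds h1] with t ht z hz hzt
  exact ht ⟨z, hz, hzt⟩

lemma Ioi_zero_subset_of_eventually {p : ℝ → Prop} (h0 : ∃ C > 0, p C)
    (h1 : ∀ C > 0, p C → ∀ᶠ t in 𝓝 C, p t) (h2 : ∀ C > 0, ¬ p C → ∀ᶠ t in 𝓝 C, ¬ p t)
    {C : ℝ} (hC : 0 < C) : p C := by
  have h : Ioi (0 : ℝ) ⊆ {t | 0 < t ∧ p t} := by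
    refine isPreconnected_Ioi.subset_of_closure_inter_subset ?_ ?_ ?_
    · rw [isOpen_iff_mem_nhds]
      intro t ht
      filter_upwards [Ioi_mem_nhds ht.1, h1 t ht.1 ht.2] with s hs hs' using ⟨hs, hs'⟩
    · obtain ⟨C, hC, hp⟩ := h0
      exact ⟨C, hC, hC, hp⟩
    · rintro t ⟨htc, ht⟩
      refine ⟨ht, ?_⟩
      by_contra hp
      obtain ⟨s, hs, hs'⟩ := mem_closure_iff_nhds.mp htc _ (h2 t ht hp)
      exact hs hs'.2
  exact (h hC).2

lemma exists_phiFin_eq {C : ℝ} (hC : 0 < C) : ∃ z ∈ kite, phiFin z = C := by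
  refine Ioi_zero_subset_of_eventually (p := fun C : ℝ => ∃ z ∈ kite, phiFin z = C) ?_ ?_ ?_ hC
  · obtain ⟨z, hz, C, hC, h⟩ := exists_phiFin_eq_pos
    exact ⟨C, hC, z, hz, h⟩
  · rintro C hC ⟨z, hz, h⟩
    filter_upwards [eventually_exists_phiFin_eq hz h univ_mem] with t ht
    obtain ⟨w, hw, hwt⟩ := ht
    exact ⟨w, hw.2, hwt⟩
  · intro C hC h
    push Not at h
    obtain ⟨B, hB, hev⟩ := exists_eventually_norm_mem hC
    obtain ⟨K, hKs, hK, hKm⟩ := exists_isCompact_kite B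
    filter_upwards [hev, eventually_forall_phiFin_ne hK hKs fun z hz => h z (hKs hz)] with t h1 h2
    rintro ⟨z, hz, hzt⟩
    exact h2 z (hKm z hz (hzt ▸ h1.1) (hzt ▸ h1.2) hB) hzt

/-- On the part of the kite where it is real, `φ` is injective: the number of points with a given
value is locally constant, and it is one for large values. -/
lemma phiFin_injective {C : ℝ} (hC : 0 < C) {z w : ℂ} (hz : z ∈ kite) (hw : w ∈ kite)
    (hzC : phiFin z = C) (hwC : phiFin w = C) : z = w := by
  suffices h : ∀ z ∈ kite, ∀ w ∈ kite, phiFin z = C → phiFin w = C → z = w from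
    h z hz w hw hzC hwC
  clear hz hw hzC hwC z w
  refine Ioi_zero_subset_of_eventually (p := fun C : ℝ =>
    ∀ z ∈ kite, ∀ w ∈ kite, phiFin z = C → phiFin w = C → z = w) ?_ ?_ ?_ hC
  · obtain ⟨Y₁, h1⟩ := exists_injOn_phiFin
    obtain ⟨Y₂, h2⟩ := exists_abs_re_sub_lt (ε := 1 / 8) (by norm_num)
    obtain ⟨B, hB⟩ := exists_im_gt_of_lt_norm_phiFin (max Y₁ Y₂)
    have hpos : 0 < |B| + 1 := by positivity
    have key : ∀ z ∈ kite, phiFin z = ((|B| + 1 : ℝ) : ℂ) →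
        z ∈ {z : ℂ | (1 / 8 ≤ z.re ∧ z.re ≤ 3 / 8) ∧ Y₁ < z.im} := fun z hz hzC => by
      obtain ⟨h3, h4⟩ := hB z hz (by
        rw [hzC, Complex.norm_real, Real.norm_of_nonneg hpos.le]
        exact (le_abs_self B).trans_lt (lt_add_one _))
      have h5 := abs_lt.mp (h2 z h3.2.1 h3.2.2.1 ((le_max_right _ _).trans_lt h4)
        (by rw [hzC, Complex.ofReal_im]) (by rw [hzC, Complex.ofReal_re]; exact hpos))
      exact ⟨⟨by linarith [h5.1], by linarith [h5.2]⟩, (le_max_left _ _).trans_lt h4⟩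
    exact ⟨|B| + 1, hpos, fun z hz w hw hzC hwC =>
      h1 (key z hz hzC) (key w hw hwC) (hzC.trans hwC.symm)⟩
  · intro C hC h
    obtain ⟨z, hz, hzC⟩ := exists_phiFin_eq hC
    obtain ⟨g, -, -, -, hg⟩ := exists_local_section (mem_kiteInterior_of_phiFin_eq hz hzC)
    obtain ⟨O, hOg, hO, hzO⟩ := eventually_nhds_iff.mp hg
    obtain ⟨B, hB, hev⟩ := exists_eventually_norm_mem hC
    obtain ⟨K, hKs, hK, hKm⟩ := exists_isCompact_kite B
    have hne : ∀ w ∈ K \ O, phiFin w ≠ C := fun w hw hwC =>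
      hw.2 (h z hz w (hKs hw.1) hzC hwC ▸ hzO)
    filter_upwards [hev, eventually_forall_phiFin_ne (hK.diff hO) (sdiff_subset.trans hKs) hne]
      with t h1 h2 u hu v hv hut hvt
    have key : ∀ u ∈ kite, phiFin u = t → u ∈ O := fun u hu hut => by
      by_contra hc
      exact h2 u ⟨hKm u hu (hut ▸ h1.1) (hut ▸ h1.2) hB, hc⟩ hut
    rw [← hOg u (key u hu hut), ← hOg v (key v hv hvt), hut, hvt]
  · intro C hC h
    push Not at h
    obtain ⟨z, hz, w, hw, hzC, hwC, hne⟩ := h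
    obtain ⟨U, V, hU, hV, hzU, hwV, hUV⟩ := t2_separation hne
    filter_upwards [eventually_exists_phiFin_eq hz hzC (hU.mem_nhds hzU),
      eventually_exists_phiFin_eq hw hwC (hV.mem_nhds hwV)] with t h1 h2 h3
    obtain ⟨u, hu, hut⟩ := h1
    obtain ⟨v, hv, hvt⟩ := h2
    have := h3 u hu.2 v hv.2 hut hvt
    exact disjoint_left.mp hUV hu.1 (this ▸ hv.1)

/-- The point of the kite at which `φ` takes the positive value `C`; the value for `C ≤ 0` is
irrelevant. -/
def curve (C : ℝ) : ℍ :=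
  open Classical in
  if h : ∃ τ : ℍ, (τ : ℂ) ∈ kite ∧ phiFin τ = C then h.choose else UpperHalfPlane.I

lemma curve_spec {C : ℝ} (hC : 0 < C) : (curve C : ℂ) ∈ kite ∧ phiFin (curve C) = C := by
  obtain ⟨z, hz, hzC⟩ := exists_phiFin_eq hC
  have h : ∃ τ : ℍ, (τ : ℂ) ∈ kite ∧ phiFin τ = C := ⟨⟨z, hz.1⟩, hz, hzC⟩
  rw [curve, dif_pos h]
  exact h.choose_spec

lemma phiFin_curve {C : ℝ} (hC : 0 < C) : phiFin (curve C) = C := (curve_spec hC).2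

lemma curve_mem_kiteInterior {C : ℝ} (hC : 0 < C) : (curve C : ℂ) ∈ kiteInterior :=
  mem_kiteInterior_of_phiFin_eq (curve_spec hC).1 (phiFin_curve hC)

lemma eq_curve {z : ℂ} {C : ℝ} (hC : 0 < C) (hz : z ∈ kite) (h : phiFin z = C) :
    z = curve C :=
  phiFin_injective hC hz (curve_spec hC).1 h (phiFin_curve hC)

lemma mem_image_curve_iff {τ : ℍ} (hτ : (τ : ℂ) ∈ kite) :
    τ ∈ curve '' Ioi 0 ↔ (phiFin τ).im = 0 := by
  constructor
  · rintro ⟨C, hC, rfl⟩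
    rw [phiFin_curve hC, Complex.ofReal_im]
  · intro h
    refine ⟨(phiFin τ).re, (phiFin_real_of_mem_kite hτ h).2, ?_⟩
    exact (UpperHalfPlane.ext (eq_curve (phiFin_real_of_mem_kite hτ h).2 hτ
      (Complex.ext (by simp) (by simp [h])))).symm

lemma contDiffAt_curve {C : ℝ} (hC : 0 < C) :
    ContDiffAt ℝ (⊤ : ℕ∞) (fun t => (curve t : ℂ)) C := by
  obtain ⟨g, hg, hg0, hgr, -⟩ := exists_local_section (curve_mem_kiteInterior hC)
  rw [phiFin_curve hC] at hg hg0 hgr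
  have h1 : ContDiffAt ℝ (⊤ : ℕ∞) (fun t : ℝ => g t) C :=
    (hg.restrict_scalars ℝ).comp C Complex.ofRealCLM.contDiff.contDiffAt
  refine h1.congr_of_eventuallyEq ?_
  have h2 : ∀ᶠ t : ℝ in 𝓝 C, g t ∈ kiteInterior := by
    refine h1.continuousAt.eventually_mem (isOpen_kiteInterior.mem_nhds ?_)
    rw [hg0]
    exact curve_mem_kiteInterior hC
  filter_upwards [h2, Complex.continuous_ofReal.continuousAt.eventually hgr, Ioi_mem_nhds hC]
    with t ht1 ht2 ht3
  exact (eq_curve ht3 (kiteInterior_subset ht1) ht2).symm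

lemma deriv_curve_ne_zero {C : ℝ} (hC : 0 < C) : deriv (fun t => (curve t : ℂ)) C ≠ 0 := by
  intro h0
  obtain ⟨c, -, hc⟩ := exists_hasStrictDerivAt_phiFin (curve_mem_kiteInterior hC)
  have h1 := ((contDiffAt_curve hC).differentiableAt (by simp)).hasDerivAt
  rw [h0] at h1
  have h2 := hc.hasDerivAt.comp_of_eq C h1 rfl
  have h3 : HasDerivAt (fun t : ℝ => (t : ℂ)) (c * 0) C :=
    h2.congr_of_eventuallyEq (by
      filter_upwards [Ioi_mem_nhds hC] with t ht using (phiFin_curve ht).symm)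
  have := h3.unique Complex.ofRealCLM.hasDerivAt
  simp at this

lemma isEmbedding_of_leftInvOn {X Y : Type*} [TopologicalSpace X] [TopologicalSpace Y] {J : Set X}
    {c : X → Y} {g : Y → X} (hc : ContinuousOn c J) (hg : ∀ t ∈ J, ContinuousAt g (c t))
    (h : ∀ t ∈ J, g (c t) = t) : IsEmbedding (J.domRestrict c) := by
  refine ⟨isInducing_iff_nhds.mpr fun t => le_antisymm
    (continuousOn_iff_continuous_domRestrict.mp hc).continuousAt.tendsto.le_comap ?_,
    fun s t hst => Subtype.ext ?_⟩
  · rw [nhds_subtype, ← tendsto_iff_comap]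
    have h1 := (hg t t.2).tendsto.comp (tendsto_comap (f := J.domRestrict c))
    rw [h t t.2] at h1
    exact h1.congr fun s => h s s.2
  · rw [← h s s.2, ← h t t.2]
    exact congrArg g hst

lemma isSmoothCurve_curve : IsSmoothCurve (Ioi 0) curve (curve '' Ioi 0) where
  contDiffOn _ ht := (contDiffAt_curve ht).contDiffWithinAt
  deriv_ne_zero _ ht := deriv_curve_ne_zero ht
  isEmbedding := by
    refine isEmbedding_of_leftInvOn (g := fun τ : ℍ => (phiFin τ).re) ?_ ?_ ?_
    · intro t ht
      have h := (contDiffAt_curve ht).continuousAt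
      exact (isEmbedding_coe.continuousAt_iff.mpr h).continuousWithinAt
    · intro t ht
      have h := (analyticAt_phiFin (curve_spec ht).1).continuousAt
      exact Complex.continuous_re.continuousAt.comp
        (h.comp UpperHalfPlane.continuous_coe.continuousAt)
    · intro t ht
      simp only [phiFin_curve ht, Complex.ofReal_re]
  image_eq := rfl

lemma eventually_curve_mem_halfTriangle (Y : ℝ) :
    ∀ᶠ C in atTop, (curve C : ℂ) ∈ halfTriangle ∧ Y < (curve C).im := by
  obtain ⟨B, hB⟩ := exists_im_gt_of_lt_norm_phiFin Y
  filter_upwards [eventually_gt_atTop B, eventually_gt_atTop 0] with C h1 h0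
  refine hB _ (curve_spec h0).1 ?_
  rwa [phiFin_curve h0, Complex.norm_real, Real.norm_of_nonneg h0.le]

lemma tendsto_curve_im : Tendsto (fun C => (curve C).im) atTop atTop :=
  tendsto_atTop.mpr fun Y => (eventually_curve_mem_halfTriangle Y).mono fun _ h => h.2.le

lemma tendsto_curve_re : Tendsto (fun C => (curve C).re) atTop (𝓝 (1 / 4)) := by
  refine Metric.tendsto_nhds.mpr fun ε hε => ?_
  obtain ⟨Y, hY⟩ := exists_abs_re_sub_lt hε
  filter_upwards [eventually_curve_mem_halfTriangle Y, eventually_gt_atTop 0] with C h1 h0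
  exact hY _ h1.1.2.1 h1.1.2.2.1 h1.2 (by rw [phiFin_curve h0, Complex.ofReal_im])
    (by rwa [phiFin_curve h0, Complex.ofReal_re])

lemma curve_inv {C : ℝ} (hC : 0 < C) : (curve C⁻¹ : ℂ) = (conj (curve C : ℂ))⁻¹ := by
  refine (eq_curve (inv_pos.mpr hC) (inv_conj_mem_kite (curve_spec hC).1) ?_).symm
  rw [phiFin_inv_conj (curve_spec hC).1, phiFin_curve hC]
  simp

lemma tendsto_curve_zero : Tendsto (fun C => (curve C : ℂ)) (𝓝[>] 0) (𝓝 0) := by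
  have h1 : Tendsto (fun C => ‖(curve C : ℂ)‖) atTop atTop :=
    tendsto_atTop_mono (fun C => (le_abs_self _).trans (Complex.abs_im_le_norm _))
      tendsto_curve_im
  have h2 := h1.inv_tendsto_atTop.comp tendsto_inv_nhdsGT_zero
  rw [tendsto_zero_iff_norm_tendsto_zero]
  refine h2.congr' ?_
  filter_upwards [self_mem_nhdsWithin] with C hC
  have h3 := curve_inv (inv_pos.mpr hC)
  rw [inv_inv] at h3
  rw [h3, norm_inv_conj]
  rfl

end Curve

/-! ### The points where `φ` is real or infinite -/

section RealLocus

open scoped ComplexConjugate MatrixGroups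

/-- The function `Im ((z E₆' + 6 E₆) conj E₆')`, which vanishes exactly where `φ` is real or
infinite. -/
def realDefect (z : ℂ) : ℝ := (phiNum z * conj (deriv e6 z)).im

/-- The points of the upper half plane where `φ` is real or infinite. -/
def realLocus : Set ℍ := {τ | realDefect τ = 0}

lemma isClosed_realLocus : IsClosed realLocus := by
  have h1 : Continuous fun τ : ℍ => deriv e6 τ := continuous_iff_continuousAt.mpr fun τ =>
    (analyticAt_e6 τ.im_pos).deriv.continuousAt.comp UpperHalfPlane.continuous_coe.continuousAt
  have h2 : Continuous fun τ : ℍ => e6 τ := continuous_iff_continuousAt.mpr fun τ =>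
    (analyticAt_e6 τ.im_pos).continuousAt.comp UpperHalfPlane.continuous_coe.continuousAt
  have h3 : Continuous fun τ : ℍ => phiNum τ := by
    simp only [phiNum]
    exact (UpperHalfPlane.continuous_coe.mul h1).add (continuous_const.mul h2)
  exact isClosed_eq (Complex.continuous_im.comp (h3.mul (Complex.continuous_conj.comp h1)))
    continuous_const

lemma det_cast (γ : SL(2, ℤ)) : (γ 0 0 : ℝ) * γ 1 1 - γ 0 1 * γ 1 0 = 1 := by
  have := γ.det_coe
  rw [Matrix.det_fin_two] at this
  exact_mod_cast this

/-- The pair `(z E₆' + 6 E₆, E₆')` transforms by the integral matrix `γ`, up to a common factor, so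
the condition that `φ` is real or infinite is invariant under the modular group. -/
lemma smul_mem_realLocus_iff (γ : SL(2, ℤ)) (τ : ℍ) : γ • τ ∈ realLocus ↔ τ ∈ realLocus := by
  set j : ℂ := (γ 1 0 : ℂ) * τ + γ 1 1 with hj
  have hj0 : j ≠ 0 := cz_add_d_ne_zero γ τ
  have h : realDefect (γ • τ : ℍ) = Complex.normSq j ^ 7 * realDefect τ := by
    have e : ∀ N M : ℂ, ((γ 0 0 * N + γ 0 1 * M) * conj (γ 1 0 * N + γ 1 1 * M)).im
        = (N * conj M).im := by
      intro N M
      simp only [Complex.mul_im, Complex.add_re, Complex.add_im, Complex.mul_re, Complex.conj_re,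
        Complex.conj_im, Complex.intCast_re, Complex.intCast_im]
      linear_combination (N.im * M.re - N.re * M.im) * det_cast γ
    rw [realDefect, realDefect, phiNum_smul, deriv_e6_smul, ← hj, map_mul,
      mul_mul_mul_comm, map_pow, ← mul_pow, Complex.mul_conj, ← Complex.ofReal_pow,
      Complex.im_ofReal_mul, e]
  have hn : Complex.normSq j ^ 7 ≠ 0 := pow_ne_zero _ (by simpa using hj0)
  change realDefect (γ • τ : ℍ) = 0 ↔ realDefect τ = 0
  rw [h, mul_eq_zero, or_iff_right hn]

lemma mem_realLocus_iff {τ : ℍ} (h : deriv e6 τ ≠ 0) : τ ∈ realLocus ↔ (phiFin τ).im = 0 := by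
  have hn : Complex.normSq (deriv e6 τ) ≠ 0 := by simpa using h
  have e : realDefect τ = Complex.normSq (deriv e6 τ) * (phiFin τ).im := by
    rw [phiFin_eq_div h, realDefect, ← Complex.im_ofReal_mul, ← Complex.mul_conj]
    congr 1
    field_simp
  simp [realLocus, e, hn]

/-- If `φ(τ) = a / c` with `a` odd and `c` even, then some `γ ∈ Γ₀(2)` with first column
proportional to `(a, c)` satisfies `φ(γ⁻¹ τ) = ∞`: it moves a critical point of `E₆` to `τ`. -/
lemma mem_D0_of_mul_eq {τ : ℍ} (hτ : τ ∈ F0) {a c : ℤ} (ha : Odd a) (hc : Even c)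
    (h : (a : ℂ) * deriv e6 τ = c * phiNum τ) : τ ∈ D0 := by
  have hg : 0 < Int.gcd a c := Int.gcd_pos_of_ne_zero_left _ (by rintro rfl; simp at ha)
  obtain ⟨g, a', c', hg0, hcop, rfl, rfl⟩ := Int.exists_gcd_one' hg
  obtain ⟨ha', hgo⟩ := Int.odd_mul.mp ha
  have hc' : Even c' := (Int.even_mul.mp hc).resolve_right (Int.not_even_iff_odd.mpr hgo)
  have hgC : (g : ℂ) ≠ 0 := by exact_mod_cast hg0.ne'
  push_cast at h
  obtain ⟨γ, h0, h1⟩ := (Int.isCoprime_iff_gcd_eq_one.mpr hcop).exists_SL2_col 0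
  refine ⟨hτ, γ, ?_, γ⁻¹ • τ, ?_, (smul_inv_smul γ τ).symm⟩
  · rw [CongruenceSubgroup.Gamma0_mem, h1]
    exact (ZMod.intCast_zmod_eq_zero_iff_dvd _ 2).mpr hc'.two_dvd
  · rw [isCriticalPointE6_iff, deriv_e6_smul]
    simp only [Matrix.SpecialLinearGroup.SL2_inv_expl γ]
    simp only [Matrix.cons_val', Matrix.cons_val_zero, Matrix.cons_val_one,
      Matrix.cons_val_fin_one, h0, h1]
    refine mul_eq_zero_of_right _ (mul_left_cancel₀ hgC ?_)
    push_cast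
    linear_combination h

lemma D0_subset_realLocus : D0 ⊆ realLocus := by
  rintro _ ⟨-, γ, -, z, hz, rfl⟩
  rw [smul_mem_realLocus_iff]
  rw [isCriticalPointE6_iff] at hz
  simp [realLocus, realDefect, hz]

end RealLocus

/-! ### The three pieces of the fundamental domain of `Γ₀(2)` -/

section Symmetries

open scoped ComplexConjugate MatrixGroups

/-- The reflection `τ ↦ 1 - conj τ` in the line `Re τ = 1 / 2`. -/
def lineReflection : ℍ ≃ₜ ℍ where
  toFun τ := ⟨1 - conj (τ : ℂ), by simpa using τ.im_pos⟩
  invFun τ := ⟨1 - conj (τ : ℂ), by simpa using τ.im_pos⟩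
  left_inv τ := by ext; simp
  right_inv τ := by ext; simp
  continuous_toFun := isEmbedding_coe.continuous_iff.mpr
    (continuous_const.sub (Complex.continuous_conj.comp continuous_coe))
  continuous_invFun := isEmbedding_coe.continuous_iff.mpr
    (continuous_const.sub (Complex.continuous_conj.comp continuous_coe))

/-- The matrix of the elliptic transformation `τ ↦ 1 / (1 - τ)` of order three, which permutes the
cusps `0`, `1` and `∞`. -/
def rotationMatrix : SL(2, ℤ) := ⟨!![0, 1; -1, 1], by simp⟩

/-- The elliptic transformation `τ ↦ 1 / (1 - τ)`. -/
def cuspRotation : ℍ ≃ₜ ℍ := Homeomorph.smul (rotationMatrix : GL (Fin 2) ℝ)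

lemma lineReflection_coe (τ : ℍ) : (lineReflection τ : ℂ) = 1 - conj (τ : ℂ) := rfl

lemma cuspRotation_coe (τ : ℍ) : (cuspRotation τ : ℂ) = (1 - (τ : ℂ))⁻¹ := by
  change ((rotationMatrix • τ : ℍ) : ℂ) = _
  rw [smul_eq_div]
  simp [rotationMatrix]
  ring

lemma one_sub_ne_zero_of_im_pos (τ : ℍ) : 1 - (τ : ℂ) ≠ 0 := fun h => by
  have := congrArg Complex.im h
  simp at this
  exact τ.im_ne_zero this

lemma cuspRotation_symm_coe (τ : ℍ) : (cuspRotation.symm τ : ℂ) = 1 - (τ : ℂ)⁻¹ := by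
  have h := cuspRotation_coe (cuspRotation.symm τ)
  rw [Homeomorph.apply_symm_apply] at h
  rw [h]; simp

lemma deriv_e6_cuspRotation (τ : ℍ) :
    deriv e6 (cuspRotation τ) = (1 - (τ : ℂ)) ^ 7 * (deriv e6 τ - phiNum τ) := by
  have h := deriv_e6_smul rotationMatrix τ
  simp only [rotationMatrix, Matrix.SpecialLinearGroup.coe_mk] at h
  simp only [Matrix.of_apply, Matrix.cons_val', Matrix.cons_val_zero, Matrix.cons_val_one,
    Matrix.cons_val_fin_one, Int.cast_one, Int.cast_neg] at h
  refine h.trans ?_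
  ring

lemma phiNum_cuspRotation (τ : ℍ) :
    phiNum (cuspRotation τ) = (1 - (τ : ℂ)) ^ 7 * deriv e6 τ := by
  have h := phiNum_smul rotationMatrix τ
  simp only [rotationMatrix, Matrix.SpecialLinearGroup.coe_mk] at h
  simp only [Matrix.of_apply, Matrix.cons_val', Matrix.cons_val_zero, Matrix.cons_val_one,
    Matrix.cons_val_fin_one, Int.cast_one, Int.cast_neg, Int.cast_zero] at h
  refine h.trans ?_
  ring

lemma cuspRotation_mem_realLocus_iff (τ : ℍ) : cuspRotation τ ∈ realLocus ↔ τ ∈ realLocus :=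
  smul_mem_realLocus_iff rotationMatrix τ

lemma lineReflection_mem_realLocus_iff (τ : ℍ) : lineReflection τ ∈ realLocus ↔ τ ∈ realLocus := by
  have h : realDefect (lineReflection τ) = realDefect τ := by
    rw [realDefect, realDefect, lineReflection_coe, deriv_e6_one_sub_conj τ.im_pos,
      phiNum_one_sub_conj τ.im_pos]
    simp
    ring
  simp [realLocus, h]

lemma mem_F0_iff (τ : ℍ) : τ ∈ F0 ↔ 0 ≤ τ.re ∧ τ.re ≤ 1 ∧ τ.re ≤ ‖(τ : ℂ)‖ ^ 2 := by
  have h : 1 / 2 ≤ ‖(τ : ℂ) - 1 / 2‖ ↔ τ.re ≤ ‖(τ : ℂ)‖ ^ 2 := by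
    rw [← sq_le_sq₀ (by norm_num) (norm_nonneg _), normSq_eq_re_sq_add_im_sq,
      normSq_eq_re_sq_add_im_sq]
    norm_num
    constructor <;> intro h <;> nlinarith
  rw [F0, mem_ofPred_eq, h]

lemma mem_kite_iff (τ : ℍ) :
    (τ : ℂ) ∈ kite ↔ 0 ≤ τ.re ∧ τ.re ≤ 1 / 2 ∧ 2 * τ.re ≤ ‖(τ : ℂ)‖ ^ 2 := by
  rw [kite, mem_ofPred_eq, one_le_norm_sub_one_iff]
  simp [τ.im_pos]

lemma norm_coe_pos (τ : ℍ) : 0 < ‖(τ : ℂ)‖ := norm_pos_iff.mpr (ne_zero_of_im_pos τ.im_pos)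

lemma kite_subset_F0 {τ : ℍ} (h : (τ : ℂ) ∈ kite) : τ ∈ F0 := by
  obtain ⟨h1, h2, h3⟩ := (mem_kite_iff τ).mp h
  exact (mem_F0_iff τ).mpr ⟨h1, by linarith, by linarith⟩

lemma lineReflection_re (τ : ℍ) : (lineReflection τ).re = 1 - τ.re := by
  rw [← coe_re, lineReflection_coe]; simp

lemma lineReflection_im (τ : ℍ) : (lineReflection τ).im = τ.im := by
  rw [← coe_im, lineReflection_coe]; simp

lemma norm_lineReflection (τ : ℍ) : ‖(lineReflection τ : ℂ)‖ = ‖(τ : ℂ) - 1‖ := by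
  rw [lineReflection_coe, ← RCLike.norm_conj, ← norm_neg]
  simp

lemma lineReflection_mem_F0 {τ : ℍ} (h : τ ∈ F0) : lineReflection τ ∈ F0 := by
  rw [mem_F0_iff] at h ⊢
  rw [lineReflection_re, norm_lineReflection, norm_sub_one_sq, coe_re]
  exact ⟨by linarith [h.2.1], by linarith [h.1], by linarith [h.2.2]⟩

lemma norm_cuspRotation_symm (τ : ℍ) : (cuspRotation.symm τ).re = 1 - τ.re / ‖(τ : ℂ)‖ ^ 2 ∧
    ‖(cuspRotation.symm τ : ℂ) - 1‖ = ‖(τ : ℂ)‖⁻¹ := by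
  constructor
  · rw [← coe_re, cuspRotation_symm_coe, Complex.sub_re, Complex.inv_re, Complex.normSq_eq_norm_sq]
    simp
  · rw [cuspRotation_symm_coe, sub_sub_cancel_left, norm_neg, norm_inv]

lemma cuspRotation_norm (τ : ℍ) : ‖(cuspRotation τ : ℂ)‖ = ‖(τ : ℂ) - 1‖⁻¹ ∧
    ‖(cuspRotation τ : ℂ) - 1‖ = ‖(τ : ℂ)‖ * ‖(τ : ℂ) - 1‖⁻¹ := by
  have h := one_sub_ne_zero_of_im_pos τ
  constructor
  · rw [cuspRotation_coe, norm_inv, norm_sub_rev]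
  · have : (1 - (τ : ℂ))⁻¹ - 1 = τ * (1 - (τ : ℂ))⁻¹ := by field_simp; ring
    rw [cuspRotation_coe, this, norm_mul, norm_inv, norm_sub_rev]

lemma cuspRotation_re (τ : ℍ) : (cuspRotation τ).re = (1 - τ.re) / ‖(τ : ℂ) - 1‖ ^ 2 := by
  rw [← coe_re, cuspRotation_coe, Complex.inv_re, Complex.normSq_eq_norm_sq, norm_sub_rev]
  simp

lemma cuspRotation_mem_F0 {τ : ℍ} (h : (τ : ℂ) ∈ kite) : cuspRotation τ ∈ F0 := by
  obtain ⟨h1, h2, h3⟩ := (mem_kite_iff τ).mp h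
  have hpos : 0 < ‖(τ : ℂ) - 1‖ ^ 2 := by
    rw [norm_sub_rev]
    exact pow_pos (norm_pos_iff.mpr (one_sub_ne_zero_of_im_pos τ)) 2
  rw [mem_F0_iff, cuspRotation_re, (cuspRotation_norm τ).1, inv_pow, ← one_div]
  refine ⟨div_nonneg (by linarith) hpos.le, (div_le_one hpos).mpr ?_, ?_⟩
  · rw [norm_sub_one_sq, coe_re]
    linarith
  · gcongr
    linarith

/-- The domain `F0` is the union of the kite and of its images under the reflection and the
rotation. -/
lemma mem_F0_cases {τ : ℍ} (h : τ ∈ F0) : (τ : ℂ) ∈ kite ∨ (lineReflection τ : ℂ) ∈ kite ∨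
    (cuspRotation.symm τ : ℂ) ∈ kite := by
  obtain ⟨h1, h2, h3⟩ := (mem_F0_iff τ).mp h
  have hpos : 0 < ‖(τ : ℂ)‖ ^ 2 := pow_pos (norm_coe_pos τ) 2
  have key : ‖(τ : ℂ)‖ ^ 2 ≤ 2 * τ.re → ‖(τ : ℂ)‖ ≤ 1 → (cuspRotation.symm τ : ℂ) ∈ kite := by
    intro h4 h5
    obtain ⟨e1, e2⟩ := norm_cuspRotation_symm τ
    refine ⟨(cuspRotation.symm τ).im_pos, ?_, ?_, ?_⟩
    · rw [coe_re, e1, sub_nonneg, div_le_one hpos]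
      exact h3
    · rw [coe_re, e1]
      have : 1 / 2 ≤ τ.re / ‖(τ : ℂ)‖ ^ 2 := by
        rw [le_div_iff₀ hpos]; linarith
      linarith
    · rw [e2]
      exact (one_le_inv₀ (norm_coe_pos τ)).mpr h5
  rw [mem_kite_iff, mem_kite_iff, lineReflection_re, norm_lineReflection, norm_sub_one_sq, coe_re]
  rcases le_total τ.re (1 / 2) with hx | hx
  · rcases le_total (2 * τ.re) (‖(τ : ℂ)‖ ^ 2) with h4 | h4
    · exact Or.inl ⟨h1, hx, h4⟩
    · refine Or.inr (Or.inr (key h4 ?_))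
      rw [← sq_le_one_iff₀ (norm_nonneg _)]
      linarith
  · rcases le_total 1 (‖(τ : ℂ)‖ ^ 2) with h4 | h4
    · exact Or.inr (Or.inl ⟨by linarith, by linarith, by linarith⟩)
    · exact Or.inr (Or.inr (key (by linarith) ((sq_le_one_iff₀ (norm_nonneg _)).mp h4)))

/-- The real locus in `F0` consists of the curve in the kite and of its images. -/
lemma realLocus_inter_F0 :
    cuspRotation '' (curve '' Ioi 0) ∪ curve '' Ioi 0 ∪ lineReflection '' (curve '' Ioi 0)
      = realLocus ∩ F0 := by
  have hk : ∀ τ : ℍ, (τ : ℂ) ∈ kite → (τ ∈ curve '' Ioi 0 ↔ τ ∈ realLocus) := fun τ hτ => by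
    rw [mem_image_curve_iff hτ, mem_realLocus_iff (deriv_e6_ne_zero_of_mem_kite hτ)]
  have hc : ∀ C ∈ Ioi (0 : ℝ), (curve C : ℂ) ∈ kite ∧ curve C ∈ realLocus := fun C hC =>
    ⟨(curve_spec hC).1, (hk _ (curve_spec hC).1).mp (mem_image_of_mem _ hC)⟩
  apply Subset.antisymm
  · rintro _ ((⟨_, ⟨C, hC, rfl⟩, rfl⟩ | ⟨C, hC, rfl⟩) | ⟨_, ⟨C, hC, rfl⟩, rfl⟩)
    · exact ⟨(cuspRotation_mem_realLocus_iff _).mpr (hc C hC).2, cuspRotation_mem_F0 (hc C hC).1⟩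
    · exact ⟨(hc C hC).2, kite_subset_F0 (hc C hC).1⟩
    · exact ⟨(lineReflection_mem_realLocus_iff _).mpr (hc C hC).2,
        lineReflection_mem_F0 (kite_subset_F0 (hc C hC).1)⟩
  · rintro τ ⟨hτ, hF⟩
    rcases mem_F0_cases hF with h | h | h
    · exact Or.inl (Or.inr ((hk τ h).mpr hτ))
    · refine Or.inr ⟨lineReflection τ, (hk _ h).mpr ((lineReflection_mem_realLocus_iff τ).mpr hτ), ?_⟩
      exact lineReflection.symm_apply_apply τ
    · refine Or.inl (Or.inl ⟨cuspRotation.symm τ, (hk _ h).mpr ?_, cuspRotation.apply_symm_apply τ⟩)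
      rw [← cuspRotation_mem_realLocus_iff, Homeomorph.apply_symm_apply]
      exact hτ

/-- A diffeomorphism of the half plane followed by the change of parameter `t ↦ 1 - t` maps smooth
curves to smooth curves. -/
lemma IsSmoothCurve.comp_one_sub {c : ℝ → ℍ} {S : Set ℍ} (h : IsSmoothCurve (Ioi 0) c S)
    (g : ℍ ≃ₜ ℍ) {G G' : ℂ → ℂ} (hg : ∀ τ : ℍ, (g τ : ℂ) = G τ)
    (hg' : ∀ τ : ℍ, (g.symm τ : ℂ) = G' τ) (hG : ∀ τ : ℍ, ContDiffAt ℝ (⊤ : ℕ∞) G τ)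
    (hG' : ∀ τ : ℍ, DifferentiableAt ℝ G' τ) :
    IsSmoothCurve (Iio 1) (fun t => g (c (1 - t))) (g '' S) where
  contDiffOn := by
    intro t ht
    have ht' : 1 - t ∈ Ioi (0 : ℝ) := mem_Ioi.mpr (sub_pos.mpr (mem_Iio.mp ht))
    have h1 : ContDiffAt ℝ (⊤ : ℕ∞) (fun s => (c s : ℂ)) (1 - t) :=
      h.contDiffOn.contDiffAt (Ioi_mem_nhds ht')
    have h2 : ContDiffAt ℝ (⊤ : ℕ∞) (fun s : ℝ => 1 - s) t := by fun_prop
    simp only [hg]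
    exact ((hG _).comp t (h1.comp t h2)).contDiffWithinAt
  deriv_ne_zero := by
    intro t ht h0
    have ht' : 1 - t ∈ Ioi (0 : ℝ) := mem_Ioi.mpr (sub_pos.mpr (mem_Iio.mp ht))
    have h1 : ContDiffAt ℝ (⊤ : ℕ∞) (fun s => (c s : ℂ)) (1 - t) :=
      h.contDiffOn.contDiffAt (Ioi_mem_nhds ht')
    have h2 : ContDiffAt ℝ (⊤ : ℕ∞) (fun s : ℝ => 1 - s) t := by fun_prop
    have h3 : DifferentiableAt ℝ (fun s => (g (c (1 - s)) : ℂ)) t := by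
      simp only [hg]
      exact ((hG _).comp t (h1.comp t h2)).differentiableAt (by simp)
    have h4 := h3.hasDerivAt
    rw [h0] at h4
    have h5 := (hG' (g (c (1 - t)))).hasFDerivAt.comp_hasDerivAt t h4
    rw [map_zero] at h5
    have h6 : HasDerivAt (fun s => (c (1 - s) : ℂ)) 0 t := by
      refine h5.congr_of_eventuallyEq (Eventually.of_forall fun s => ?_)
      simp [← hg']
    have h7 : HasDerivAt (fun s => (c (1 - s) : ℂ)) (-deriv (fun s => (c s : ℂ)) (1 - t)) t := by
      have h8 := (h1.differentiableAt (by simp)).hasDerivAt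
      have := h8.scomp t ((hasDerivAt_id t).const_sub 1)
      simpa [Function.comp_def] using this
    exact h.deriv_ne_zero _ ht' (neg_eq_zero.mp (h7.unique h6))
  isEmbedding := by
    have hm : MapsTo (fun t : ℝ => 1 - t) (Iio 1) (Ioi 0) := fun t ht =>
      mem_Ioi.mpr (sub_pos.mpr (mem_Iio.mp ht))
    exact g.isEmbedding.comp
      (h.isEmbedding.comp ((Homeomorph.subLeft (1 : ℝ)).isEmbedding.restrict hm))
  image_eq := by
    rw [← h.image_eq, image_image]
    ext τ
    constructor
    · rintro ⟨t, ht, rfl⟩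
      exact ⟨1 - t, mem_Ioi.mpr (sub_pos.mpr (mem_Iio.mp ht)), rfl⟩
    · rintro ⟨t, ht, rfl⟩
      exact ⟨1 - t, mem_Iio.mpr (sub_lt_self 1 (mem_Ioi.mp ht)), by simp⟩

lemma isSmoothCurve_lineReflection :
    IsSmoothCurve (Iio 1) (fun t => lineReflection (curve (1 - t))) (lineReflection '' (curve '' Ioi 0)) := by
  have h : ContDiff ℝ (⊤ : ℕ∞) fun z : ℂ => 1 - conj z :=
    contDiff_const.sub Complex.conjCLE.contDiff
  exact isSmoothCurve_curve.comp_one_sub lineReflection (fun _ => rfl) (fun _ => rfl)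
    (fun _ => h.contDiffAt) fun _ => h.contDiffAt.differentiableAt (by simp)

lemma isSmoothCurve_cuspRotation :
    IsSmoothCurve (Iio 1) (fun t => cuspRotation (curve (1 - t))) (cuspRotation '' (curve '' Ioi 0)) := by
  refine isSmoothCurve_curve.comp_one_sub cuspRotation (G := fun z => (1 - z)⁻¹)
    (G' := fun z => 1 - z⁻¹) cuspRotation_coe cuspRotation_symm_coe
    (fun τ => ContDiffAt.inv (by fun_prop) (one_sub_ne_zero_of_im_pos τ)) fun τ => ?_
  have h := ne_zero_of_im_pos τ.im_pos
  fun_prop (disch := assumption)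

end Symmetries

/-! ### Density and closures -/

section Density

open scoped ComplexConjugate

lemma cuspRotation_curve {s : ℝ} (hs : s < 1) :
    deriv e6 (cuspRotation (curve (1 - s)))
      = s * phiNum (cuspRotation (curve (1 - s))) ∧
    phiNum (cuspRotation (curve (1 - s))) ≠ 0 := by
  have h0 : 0 < 1 - s := sub_pos.mpr hs
  obtain ⟨hk, hφ⟩ := curve_spec h0
  have hM := deriv_e6_ne_zero_of_mem_kite hk
  rw [phiFin_eq_div hM, div_eq_iff hM] at hφ
  rw [deriv_e6_cuspRotation, phiNum_cuspRotation, hφ]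
  refine ⟨by push_cast; ring, mul_ne_zero (pow_ne_zero _ (one_sub_ne_zero_of_im_pos _)) hM⟩

lemma lineReflection_curve {t : ℝ} (ht : t < 1) :
    phiNum (lineReflection (curve (1 - t)))
      = t * deriv e6 (lineReflection (curve (1 - t))) ∧
    deriv e6 (lineReflection (curve (1 - t))) ≠ 0 := by
  have h0 : 0 < 1 - t := sub_pos.mpr ht
  obtain ⟨hk, hφ⟩ := curve_spec h0
  have hM := deriv_e6_ne_zero_of_mem_kite hk
  rw [phiFin_eq_div hM, div_eq_iff hM] at hφ
  rw [lineReflection_coe, deriv_e6_one_sub_conj (curve (1 - t)).im_pos,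
    phiNum_one_sub_conj (curve (1 - t)).im_pos, hφ]
  refine ⟨?_, by simpa using hM⟩
  simp
  ring

lemma curve_mul {C : ℝ} (hC : 0 < C) : phiNum (curve C) = C * deriv e6 (curve C) := by
  obtain ⟨hk, hφ⟩ := curve_spec hC
  have hM := deriv_e6_ne_zero_of_mem_kite hk
  rwa [phiFin_eq_div hM, div_eq_iff hM] at hφ

lemma phi_of_eq_mul {τ : ℍ} {C : ℝ} (h0 : deriv e6 τ ≠ 0) (h : phiNum τ = C * deriv e6 τ) :
    phi τ = ((C : ℂ) : OnePoint ℂ) := by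
  rw [phi_eq_coe h0, phiFin_eq_div h0, h, mul_div_cancel_right₀ _ h0]

lemma exists_int_abs_sub_le (x : ℝ) : ∃ n : ℤ, |x - 2 * n| ≤ 1 := by
  refine ⟨round (x / 2), ?_⟩
  have h := abs_sub_round (x / 2)
  rw [abs_le] at h ⊢
  constructor <;> linarith [h.1, h.2]

/-- The quotients of an odd by an even integer are dense. -/
lemma dense_odd_div_even :
    Dense {x : ℝ | ∃ a c : ℤ, Odd a ∧ Even c ∧ c ≠ 0 ∧ x = a / c} := by
  refine Metric.dense_iff.mpr fun x ε hε => ?_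
  obtain ⟨n, hn⟩ := exists_nat_gt (1 / ε)
  have hn0 : (0 : ℝ) < n := (by positivity : 0 < 1 / ε).trans hn
  obtain ⟨m, hm⟩ := exists_int_abs_sub_le (x * (2 * n) - 1)
  refine ⟨((2 * m + 1 : ℤ) : ℝ) / ((2 * n : ℤ) : ℝ), ?_, 2 * m + 1, 2 * n, odd_two_mul_add_one m,
    even_two_mul _, ?_, rfl⟩
  · rw [Metric.mem_ball', Real.dist_eq]
    have e : x - ((2 * m + 1 : ℤ) : ℝ) / ((2 * n : ℤ) : ℝ)
        = (x * (2 * n) - 1 - 2 * m) / (2 * n) := by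
      push_cast
      field_simp
      ring
    rw [e, abs_div, abs_of_pos (by positivity : (0 : ℝ) < 2 * n), div_lt_iff₀ (by positivity)]
    rw [div_lt_iff₀ hε] at hn
    linarith
  · have : n ≠ 0 := by exact_mod_cast hn0.ne'
    omega

/-- The quotients of an even by an odd integer are dense. -/
lemma dense_even_div_odd :
    Dense {x : ℝ | ∃ a c : ℤ, Odd a ∧ Even c ∧ x = c / a} := by
  refine Metric.dense_iff.mpr fun x ε hε => ?_
  obtain ⟨n, hn⟩ := exists_nat_gt (1 / ε)
  obtain ⟨m, hm⟩ := exists_int_abs_sub_le (x * (2 * n + 1))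
  refine ⟨((2 * m : ℤ) : ℝ) / ((2 * n + 1 : ℤ) : ℝ), ?_, 2 * n + 1, 2 * m, odd_two_mul_add_one _,
    even_two_mul _, rfl⟩
  rw [Metric.mem_ball', Real.dist_eq]
  have e : x - ((2 * m : ℤ) : ℝ) / ((2 * n + 1 : ℤ) : ℝ)
      = (x * (2 * n + 1) - 2 * m) / (2 * n + 1) := by
    push_cast
    field_simp
  rw [e, abs_div, abs_of_pos (by positivity : (0 : ℝ) < 2 * n + 1), div_lt_iff₀ (by positivity)]
  rw [div_lt_iff₀ hε] at hn
  nlinarith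

lemma image_subset_closure_of_dense {X : Type*} [TopologicalSpace X] {J A : Set ℝ} (hJ : IsOpen J)
    (hA : Dense A) {c : ℝ → X} (hc : ContinuousOn c J) {D : Set X}
    (h : ∀ t ∈ J, t ∈ A → c t ∈ D) : c '' J ⊆ closure D := by
  rintro _ ⟨t, ht, rfl⟩
  rw [mem_closure_iff_nhds]
  intro V hV
  obtain ⟨s, hs, hsA⟩ := mem_closure_iff_nhds.mp (hA t) _
    (inter_mem (hJ.mem_nhds ht) ((hc.continuousAt (hJ.mem_nhds ht)).preimage_mem_nhds hV))
  exact ⟨c s, hs.2, h s hs.1 hsA⟩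

lemma IsSmoothCurve.continuousOn {J : Set ℝ} {c : ℝ → ℍ} {S : Set ℍ} (h : IsSmoothCurve J c S) :
    ContinuousOn c J :=
  continuousOn_iff_continuous_domRestrict.mpr h.isEmbedding.continuous

/-- The set `D0` is dense in the real locus of `φ` in `F0`, since the rational numbers of each
parity are dense. -/
lemma realLocus_inter_F0_subset_closure : realLocus ∩ F0 ⊆ closure D0 := by
  have hF : ∀ {τ}, τ ∈ cuspRotation '' (curve '' Ioi 0) ∪ curve '' Ioi 0 ∪
      lineReflection '' (curve '' Ioi 0) → τ ∈ F0 := fun {τ} h => by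
    rw [realLocus_inter_F0] at h
    exact h.2
  have key : ∀ {τ : ℍ} {a c : ℤ} {x : ℝ}, c ≠ 0 → x = a / c → phiNum τ = x * deriv e6 τ →
      (a : ℂ) * deriv e6 τ = c * phiNum τ := by
    rintro τ a c x hc rfl h
    have : (c : ℂ) ≠ 0 := by exact_mod_cast hc
    rw [h]
    push_cast
    field_simp
  rw [← realLocus_inter_F0]
  refine union_subset (union_subset ?_ ?_) ?_
  · rw [← isSmoothCurve_cuspRotation.image_eq]
    refine image_subset_closure_of_dense isOpen_Iio dense_even_div_odd
      isSmoothCurve_cuspRotation.continuousOn ?_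
    rintro s hs ⟨a, c, ha, hc, rfl⟩
    have ha0 : (a : ℂ) ≠ 0 := by
      have : a ≠ 0 := by rintro rfl; simp at ha
      exact_mod_cast this
    refine mem_D0_of_mul_eq (hF (Or.inl (Or.inl ?_))) ha hc ?_
    · rw [← isSmoothCurve_cuspRotation.image_eq]
      exact mem_image_of_mem _ hs
    · rw [(cuspRotation_curve hs).1]
      push_cast
      field_simp
  · refine image_subset_closure_of_dense isOpen_Ioi dense_odd_div_even
      isSmoothCurve_curve.continuousOn ?_
    rintro t ht ⟨a, c, ha, hc, hc0, hx⟩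
    exact mem_D0_of_mul_eq (hF (Or.inl (Or.inr (mem_image_of_mem _ ht)))) ha hc
      (key hc0 hx (curve_mul ht))
  · rw [← isSmoothCurve_lineReflection.image_eq]
    refine image_subset_closure_of_dense isOpen_Iio dense_odd_div_even
      isSmoothCurve_lineReflection.continuousOn ?_
    rintro t ht ⟨a, c, ha, hc, hc0, hx⟩
    refine mem_D0_of_mul_eq (hF (Or.inr ?_)) ha hc (key hc0 hx (lineReflection_curve ht).1)
    rw [← isSmoothCurve_lineReflection.image_eq]
    exact mem_image_of_mem _ ht

lemma closure_D0_inter_F0 : closure D0 ∩ F0 = realLocus ∩ F0 :=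
  Subset.antisymm
    (inter_subset_inter_left _ (closure_minimal D0_subset_realLocus isClosed_realLocus))
    (subset_inter realLocus_inter_F0_subset_closure inter_subset_right)

lemma toPlane_realLocus :
    toPlane (realLocus ∩ F0) = closure (toPlane D0) ∩ toPlane F0 := by
  rw [← closure_D0_inter_F0, isEmbedding_coe.isInducing.closure_eq_preimage_closure_image]
  apply Subset.antisymm
  · rintro _ ⟨τ, ⟨h1, h2⟩, rfl⟩
    exact ⟨h1, mem_image_of_mem _ h2⟩
  · rintro _ ⟨h1, τ, h2, rfl⟩
    exact ⟨τ, ⟨h1, h2⟩, rfl⟩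

/-- The closure of `F0` in the plane adds only the cusps `0` and `1`. -/
lemma closure_toPlane_F0_subset : closure (toPlane F0) ⊆ toPlane F0 ∪ {0, 1} := by
  have hcl : IsClosed {z : ℂ | 0 ≤ z.im ∧ 0 ≤ z.re ∧ z.re ≤ 1 ∧ 1 / 2 ≤ ‖z - 1 / 2‖} := by
    refine (isClosed_le continuous_const Complex.continuous_im).inter
      ((isClosed_le continuous_const Complex.continuous_re).inter
      ((isClosed_le Complex.continuous_re continuous_const).inter ?_))
    exact isClosed_le (f := fun _ : ℂ => (1 / 2 : ℝ)) (g := fun z : ℂ => ‖z - 1 / 2‖)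
      continuous_const (by fun_prop)
  intro z hz
  have hz' : z ∈ {z : ℂ | 0 ≤ z.im ∧ 0 ≤ z.re ∧ z.re ≤ 1 ∧ 1 / 2 ≤ ‖z - 1 / 2‖} := by
    refine closure_minimal ?_ hcl hz
    rintro _ ⟨τ, ⟨h1, h2, h3⟩, rfl⟩
    exact ⟨τ.im_pos.le, h1, h2, h3⟩
  obtain ⟨h0, h1, h2, h3⟩ := hz'
  rcases h0.lt_or_eq with him | him
  · exact Or.inl ⟨⟨z, him⟩, ⟨h1, h2, h3⟩, rfl⟩
  · right
    have h4 : (1 / 2 : ℝ) ^ 2 ≤ ‖z - 1 / 2‖ ^ 2 := by gcongr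
    rw [normSq_eq_re_sq_add_im_sq] at h4
    norm_num [← him] at h4
    have h5 : z.re * (z.re - 1) = 0 := by nlinarith
    rcases mul_eq_zero.mp h5 with h | h
    · exact Or.inl (Complex.ext h him.symm)
    · exact Or.inr (Complex.ext (by rw [Complex.one_re]; linarith) him.symm)

lemma toSphere_realLocus : toSphere (realLocus ∩ F0) = closure (toSphere D0) \
    {((0 : ℂ) : OnePoint ℂ), ((1 : ℂ) : OnePoint ℂ), OnePoint.infty} := by
  have hS : ∀ S : Set ℍ, toSphere S = ((↑) : ℂ → OnePoint ℂ) '' toPlane S := fun S => by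
    rw [toSphere, toPlane, image_image]
  have hcl : ∀ z : ℂ, (z : OnePoint ℂ) ∈ closure (toSphere D0) ↔ z ∈ closure (toPlane D0) :=
    fun z => by
      rw [hS, OnePoint.isOpenEmbedding_coe.isInducing.closure_eq_preimage_closure_image (toPlane D0)]
      rfl
  rw [hS, toPlane_realLocus]
  ext x
  constructor
  · rintro ⟨_, ⟨h1, τ, h2, rfl⟩, rfl⟩
    refine ⟨(hcl _).mpr h1, ?_⟩
    rintro (h | h | h)
    · exact τ.ne_zero (OnePoint.coe_injective h)
    · have := congrArg Complex.im (OnePoint.coe_injective h)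
      simp only [coe_im, Complex.one_im] at this
      exact τ.im_ne_zero this
    · exact OnePoint.coe_ne_infty _ h
  · rintro ⟨h1, h2⟩
    simp only [mem_insert_iff, mem_singleton_iff, not_or] at h2
    obtain ⟨z, rfl⟩ := OnePoint.ne_infty_iff_exists.mp h2.2.2
    have h3 := (hcl z).mp h1
    refine ⟨z, ⟨h3, ?_⟩, rfl⟩
    have hsub : toPlane D0 ⊆ toPlane F0 := image_mono fun τ h => h.1
    refine (closure_toPlane_F0_subset (closure_mono hsub h3)).resolve_right ?_
    rintro (rfl | rfl)
    · exact h2.1 rfl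
    · exact h2.2.1 rfl

end Density

/-! ### Endpoints and disjointness of the curves -/

section Endpoints

open scoped ComplexConjugate

lemma tendsto_one_sub_nhdsLT_one : Tendsto (fun t : ℝ => 1 - t) (𝓝[<] 1) (𝓝[>] 0) := by
  refine tendsto_nhdsWithin_iff.mpr ⟨?_, ?_⟩
  · have h : Tendsto (fun t : ℝ => 1 - t) (𝓝 1) (𝓝 (1 - 1)) :=
      (continuous_const.sub continuous_id).tendsto 1
    rw [sub_self] at h
    exact h.mono_left nhdsWithin_le_nhds
  · filter_upwards [self_mem_nhdsWithin] with t ht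
    exact mem_Ioi.mpr (sub_pos.mpr (mem_Iio.mp ht))

lemma tendsto_one_sub_atBot : Tendsto (fun t : ℝ => 1 - t) atBot atTop := by
  simp only [sub_eq_add_neg]
  exact tendsto_atTop_add_const_left atBot (1 : ℝ) tendsto_neg_atBot_atTop

lemma tendsto_cuspRotation_curve_atBot :
    Tendsto (fun s => (cuspRotation (curve (1 - s)) : ℂ)) atBot (𝓝 0) := by
  have h1 := tendsto_curve_im.comp tendsto_one_sub_atBot
  have h2 := h1.inv_tendsto_atTop
  refine squeeze_zero_norm (fun s => ?_) h2
  rw [cuspRotation_coe, norm_inv]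
  refine inv_anti₀ (curve (1 - s)).im_pos ?_
  have := Complex.abs_im_le_norm (1 - (curve (1 - s) : ℂ))
  rw [Complex.sub_im, Complex.one_im, zero_sub, abs_neg] at this
  exact (le_abs_self _).trans this

lemma tendsto_cuspRotation_curve_one :
    Tendsto (fun s => (cuspRotation (curve (1 - s)) : ℂ)) (𝓝[<] 1) (𝓝 1) := by
  have h1 := tendsto_curve_zero.comp tendsto_one_sub_nhdsLT_one
  have h2 := (h1.const_sub 1).inv₀ (by simp)
  simp only [sub_zero, inv_one] at h2
  exact h2.congr fun s => (cuspRotation_coe _).symm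

lemma tendsto_lineReflection_curve_one :
    Tendsto (fun t => (lineReflection (curve (1 - t)) : ℂ)) (𝓝[<] 1) (𝓝 1) := by
  have h1 := tendsto_curve_zero.comp tendsto_one_sub_nhdsLT_one
  have h2 := ((Complex.continuous_conj.tendsto 0).comp h1).const_sub 1
  rw [map_zero, sub_zero] at h2
  exact h2

lemma tendsto_lineReflection_curve_re :
    Tendsto (fun t => (lineReflection (curve (1 - t))).re) atBot (𝓝 (3 / 4)) := by
  have h := (tendsto_curve_re.comp tendsto_one_sub_atBot).const_sub 1
  rw [show (1 : ℝ) - 1 / 4 = 3 / 4 by norm_num] at h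
  exact h.congr fun t => (lineReflection_re _).symm

lemma tendsto_lineReflection_curve_im :
    Tendsto (fun t => (lineReflection (curve (1 - t))).im) atBot atTop :=
  (tendsto_curve_im.comp tendsto_one_sub_atBot).congr fun _ => (lineReflection_im _).symm

lemma norm_cuspRotation_lt_one {τ : ℍ} (h : (τ : ℂ) ∈ kiteInterior) :
    ‖(cuspRotation τ : ℂ)‖ < 1 ∧ ‖(cuspRotation τ : ℂ) - 1‖ < 1 := by
  obtain ⟨h1, h2⟩ := cuspRotation_norm τ
  obtain ⟨-, -, h4, h5⟩ := h
  have h6 : ‖(τ : ℂ)‖ < ‖(τ : ℂ) - 1‖ := by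
    rw [← sq_lt_sq₀ (norm_nonneg _) (norm_nonneg _), norm_sub_one_sq]
    linarith
  rw [h1, h2, ← div_eq_mul_inv]
  exact ⟨inv_lt_one_of_one_lt₀ h5, (div_lt_one (by linarith)).mpr h6⟩

lemma disjoint_cuspRotation_curve :
    Disjoint (cuspRotation '' (curve '' Ioi 0)) (curve '' Ioi 0) := by
  rw [disjoint_left]
  rintro _ ⟨_, ⟨C, hC, rfl⟩, rfl⟩ ⟨C', hC', h⟩
  have h1 := (norm_cuspRotation_lt_one (curve_mem_kiteInterior hC)).2
  rw [← h] at h1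
  exact h1.not_gt (curve_mem_kiteInterior hC').2.2.2

lemma disjoint_cuspRotation_lineReflection :
    Disjoint (cuspRotation '' (curve '' Ioi 0)) (lineReflection '' (curve '' Ioi 0)) := by
  rw [disjoint_left]
  rintro _ ⟨_, ⟨C, hC, rfl⟩, rfl⟩ ⟨_, ⟨C', hC', rfl⟩, h⟩
  have h1 := (norm_cuspRotation_lt_one (curve_mem_kiteInterior hC)).1
  rw [← h, norm_lineReflection] at h1
  exact h1.not_gt (curve_mem_kiteInterior hC').2.2.2

lemma disjoint_curve_lineReflection :
    Disjoint (curve '' Ioi 0) (lineReflection '' (curve '' Ioi 0)) := by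
  rw [disjoint_left]
  rintro _ ⟨C, hC, rfl⟩ ⟨_, ⟨C', hC', rfl⟩, h⟩
  have h1 := (curve_mem_kiteInterior hC).2.2.1
  have h2 := (curve_mem_kiteInterior hC').2.2.1
  rw [coe_re] at h1 h2
  rw [← h, lineReflection_re] at h1
  linarith

end Endpoints

end

/-- The curve `C₁` is parametrized by `C ∈ (1, +∞) ∪ {∞} ∪ (-∞, 0)`, an open arc of the real
projective line, written through the coordinate `s = 1 / C ∈ (-∞, 1)`, with `s = 0` for `C = ∞`. -/
theorem theorem1p2 :
    ∃ (C₁ C₂ C₃ : Set ℍ) (c₁ c₂ c₃ : ℝ → ℍ),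
      -- three disjoint smooth curves in `F0`
      (C₁ ⊆ F0 ∧ C₂ ⊆ F0 ∧ C₃ ⊆ F0) ∧
      (Disjoint C₁ C₂ ∧ Disjoint C₁ C₃ ∧ Disjoint C₂ C₃) ∧
      (IsSmoothCurve (Iio 1) c₁ C₁ ∧ IsSmoothCurve (Ioi 0) c₂ C₂ ∧
        IsSmoothCurve (Iio 1) c₃ C₃) ∧
      -- the endpoints of `C₁` are `0` and `1`
      (Tendsto (fun s => (c₁ s : ℂ)) atBot (𝓝 0) ∧
        Tendsto (fun s => (c₁ s : ℂ)) (𝓝[<] 1) (𝓝 1)) ∧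
      -- the endpoints of `C₂` are `0` and `1/4 + i∞`
      (Tendsto (fun C => (c₂ C : ℂ)) (𝓝[>] 0) (𝓝 0) ∧
        Tendsto (fun C => (c₂ C).re) atTop (𝓝 (1 / 4)) ∧
        Tendsto (fun C => (c₂ C).im) atTop atTop) ∧
      -- the endpoints of `C₃` are `1` and `3/4 + i∞`
      (Tendsto (fun C => (c₃ C : ℂ)) (𝓝[<] 1) (𝓝 1) ∧
        Tendsto (fun C => (c₃ C).re) atBot (𝓝 (3 / 4)) ∧
        Tendsto (fun C => (c₃ C).im) atBot atTop) ∧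
      -- the parameter is the value of `τ + 36 π i g₃ / (g₂² - 18 η₁ g₃)`
      (phi (c₁ 0) = OnePoint.infty ∧
        (∀ s : ℝ, s < 1 → s ≠ 0 → phi (c₁ s) = (((s⁻¹ : ℝ) : ℂ) : OnePoint ℂ)) ∧
        (∀ C : ℝ, 0 < C → phi (c₂ C) = ((C : ℂ) : OnePoint ℂ)) ∧
        (∀ C : ℝ, C < 1 → phi (c₃ C) = ((C : ℂ) : OnePoint ℂ))) ∧
      -- `D0` lies in the union, which is its closure in `F0` and its closure minus the cusps
      D0 ⊆ C₁ ∪ C₂ ∪ C₃ ∧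
      toPlane (C₁ ∪ C₂ ∪ C₃) = closure (toPlane D0) ∩ toPlane F0 ∧
      toSphere (C₁ ∪ C₂ ∪ C₃) =
        closure (toSphere D0) \ {((0 : ℂ) : OnePoint ℂ), ((1 : ℂ) : OnePoint ℂ), OnePoint.infty} := by
  have hF : cuspRotation '' (curve '' Ioi 0) ∪ curve '' Ioi 0 ∪ lineReflection '' (curve '' Ioi 0)
      ⊆ F0 := by
    rw [realLocus_inter_F0]
    exact inter_subset_right
  refine ⟨cuspRotation '' (curve '' Ioi 0), curve '' Ioi 0, lineReflection '' (curve '' Ioi 0),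
    fun s => cuspRotation (curve (1 - s)), curve, fun t => lineReflection (curve (1 - t)),
    ⟨fun _ h => hF (Or.inl (Or.inl h)), fun _ h => hF (Or.inl (Or.inr h)),
      fun _ h => hF (Or.inr h)⟩,
    ⟨disjoint_cuspRotation_curve, disjoint_cuspRotation_lineReflection,
      disjoint_curve_lineReflection⟩,
    ⟨isSmoothCurve_cuspRotation, isSmoothCurve_curve, isSmoothCurve_lineReflection⟩,
    ⟨tendsto_cuspRotation_curve_atBot, tendsto_cuspRotation_curve_one⟩,
    ⟨tendsto_curve_zero, tendsto_curve_re, tendsto_curve_im⟩,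
    ⟨tendsto_lineReflection_curve_one, tendsto_lineReflection_curve_re,
      tendsto_lineReflection_curve_im⟩, ⟨?_, ?_, ?_, ?_⟩, ?_, ?_, ?_⟩
  · refine phi_eq_infty ?_
    rw [(cuspRotation_curve one_pos).1, Complex.ofReal_zero, zero_mul]
  · intro s hs hs0
    obtain ⟨h1, h2⟩ := cuspRotation_curve hs
    have hsC : (s : ℂ) ≠ 0 := by exact_mod_cast hs0
    refine phi_of_eq_mul (by rw [h1]; exact mul_ne_zero hsC h2) ?_
    rw [h1, Complex.ofReal_inv, inv_mul_cancel_left₀ hsC]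
  · intro C hC
    exact phi_of_eq_mul (deriv_e6_ne_zero_of_mem_kite (curve_spec hC).1) (curve_mul hC)
  · intro C hC
    obtain ⟨h1, h2⟩ := lineReflection_curve hC
    exact phi_of_eq_mul h2 h1
  · rw [realLocus_inter_F0]
    exact fun τ h => ⟨D0_subset_realLocus h, h.1⟩
  · rw [realLocus_inter_F0]
    exact toPlane_realLocus
  · rw [realLocus_inter_F0]
    exact toSphere_realLocus
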